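/- For $p=(a,b,c)\in\mathbb C^3$ let $H_p$ be the Gauss hypergeometric equation $$y''+\Bigl(\frac cz+\frac{a+b-c+1}{z-1}\Bigr)y'+\frac{ab}{z(z-1)}\,y=0,$$ with local exponent differences $e_0=1-c$, $e_1=c-a-b$, $e_\infty=a-b$ at its singular points $0,1,\infty$. A Heun equation is $$y''+\Bigl(\frac{c}{x}+\frac{d}{x-1}+\frac{a+b-c-d+1}{x-t}\Bigr)y'+\frac{abx-q}{x(x-1)(x-t)}\,y=0\qquad(t\ne0,1;\ a,b,c,d,q\in\mathbb C),$$ with exponent differences $1-c$, $1-d$, $c+d-a-b$, $a-b$ at $0,1,t,\infty$. We call it non-degenerate if all four points are relevant singularities, i.e. none of them becomes a non-singular point after multiplying the solutions by a radical function (a product of complex powers of rational functions). A pull-back transformation along a non-constant rational function $\varphi$ is $z\mapsto\varphi(x)$, $y(z)\mapsto\theta(x)\,y(\varphi(x))$ with $\theta$ a radical function, combined with a Möbius change of $x$. Exponent differences are considered up to order and sign. The branching pattern of $\varphi$ is the triple of partitions of $\deg\varphi$ given by the branching indices of $\varphi$ above $0,1,\infty$. A family with $n$ free parameters is an irreducible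 algebraic subvariety $V\subseteq\mathbb C^3$ of dimension $n$; "generic $p\in V$" means: all $p\in V$ outside the zero set of some polynomial not vanishing identically on $V$. **(1) Three free parameters.** Let $V$ be a family with 3 free parameters and $d\ge0$. For generic $p\in V$, every pull-back transformation along a covering $\varphi$ of degree $d$ of $H_p$ to a non-degenerate Heun equation is quadratic: $\deg\varphi=2$, and the branching pattern above $0,1,\infty$, taken in a suitable order, is $2=1+1=2$. If $\alpha,\beta,\gamma$ are the exponent differences of $H_p$ at these points in that order, then the Heun equation has the exponent differences $(2\alpha,\beta,\beta,2\gamma)$. Conversely, for each order of $0,1,\infty$ there is a covering with this pattern, unique up to Möbius transformations of $x$, and it transforms every $H_p$ to a Heun equation with exponent differences $(2\alpha,\beta,\beta,2\gamma)$; for generic $p\in\mathbb C^3$ it transforms $H_p$ to a non-degenerate Heun equation. **(2) Two free parameters.** Let $V$ be a family with 2 free parameters and $d\ge0$. For generic $p\in V$, every pull-back transformation along a covering $\varphi$ of degree $d$ of $H_p$ to a non-degenerate Heun equation is either quadratic as in (1), or it is given by a row of the following table: $V$ is the plane on which the exponent difference at one of the points $0,1,\infty$ equals $1/k$, or the plane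 on which it equals $-1/k$; with $\alpha,\beta$ the exponent differences of $H_p$ at the other two points in a suitable order, the degree, the branching pattern (above the points with exponent differences $\pm1/k$, $\alpha$, $\beta$, in this order) and the exponent differences of the Heun equation are those of the row. | hypergeometric | Heun | degree | pattern above $\pm1/k,\ \alpha,\ \beta$ | composition | |---|---|---|---|---| | $(1/2,\alpha,\beta)$ | $(1/2,\alpha,2\alpha,3\beta)$ | 3 | $2+1=2+1=3$ | indecomposable | | $(1/2,\alpha,\beta)$ | $(\alpha,\alpha,2\alpha,4\beta)$ | 4 | $2+2=2+1+1=4$ | $2\times2$ | | $(1/2,\alpha,\beta)$ | $(\alpha,3\alpha,\beta,3\beta)$ | 4 | $2+2=3+1=3+1$ | indecomposable | | $(1/2,\alpha,\beta)$ | $(2\alpha,2\alpha,\beta,3\beta)$ | 4 | $2+2=2+2=3+1$ | no covering | | $(1/2,\alpha,\beta)$ | $(2\alpha,2\alpha,2\beta,2\beta)$ | 4 | $2+2=2+2=2+2$ | various $2\times2$ | | $(1/3,\alpha,\beta)$ | $(\alpha,2\alpha,\beta,2\beta)$ | 3 | $3=2+1=2+1$ | indecomposable | | $(1/3,\alpha,\beta)$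 | $(\alpha,\alpha,\alpha,3\beta)$ | 3 | $3=1+1+1=3$ | indecomposable | **(3) The coverings of the table.** For each row and each assignment of the three partitions to the points $0,1,\infty$: in the fourth row there is no covering with the pattern; in every other row there is exactly one up to Möbius transformations of $x$. "Indecomposable" means that it is not a composition of two rational functions of degree at least 2; "$2\times2$" that it is a composition $g\circ h$ of two rational functions of degree 2; "various $2\times2$" that for each $z_0\in\{0,1,\infty\}$ it is such a composition $g\circ h$ with $g$ unbranched above $z_0$ and branched above the other two points. A covering $\varphi$ with the pattern transforms every $H_p$ whose exponent difference at the first of the three points is $1/k$ or $-1/k$ to a Heun equation with the listed exponent differences, and for generic such $p$ (on each of the two planes) it transforms $H_p$ to a non-degenerate Heun equation. -/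

import Mathlib

open Polynomial

noncomputable section

namespace HeunPullback

/-! ### Rational functions as coverings of the complex projective line -/

/-- The derivative `df/dx` of a rational function. -/
def ratDeriv (f : RatFunc ℂ) : RatFunc ℂ :=
  algebraMap ℂ[X] (RatFunc ℂ)
      (derivative f.num * f.denom - f.num * derivative f.denom) /
    algebraMap ℂ[X] (RatFunc ℂ) (f.denom ^ 2)

/-- The composition `f ∘ g`, i.e. the rational function `f(g(x))`. -/
def ratComp (f g : RatFunc ℂ) : RatFunc ℂ :=
  RatFunc.eval (algebraMap ℂ (RatFunc ℂ)) g f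

/-- The degree of a rational function as a map `ℙ¹ → ℙ¹` (it is `0` for constants). -/
def ratDegree (f : RatFunc ℂ) : ℕ := max f.num.natDegree f.denom.natDegree

/-- Fractional-linear (Möbius) transformations are the rational functions of degree one. -/
def IsMoebius (f : RatFunc ℂ) : Prop := ratDegree f = 1

/-- The polynomial whose roots are the finite points of the fibre `φ⁻¹(z)`, the multiplicity of a
root being the branching index there. -/
def fiberPoly (φ : RatFunc ℂ) (z : OnePoint ℂ) : ℂ[X] :=
  z.elim φ.denom (fun c : ℂ => φ.num - Polynomial.C c * φ.denom)

/-- The branching pattern of `φ` above `z`: the multiset of the branching indices of `φ` at the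
points of `φ⁻¹(z)`, a partition of `deg φ`.  The second summand is the contribution of the point
`x = ∞`, which lies above `z` exactly if the fibre polynomial has degree less than `deg φ`. -/
def fiberPartition (φ : RatFunc ℂ) (z : OnePoint ℂ) : Multiset ℕ :=
  (fiberPoly φ z).roots.dedup.map (fun s => (fiberPoly φ z).rootMultiplicity s) +
    if (fiberPoly φ z).natDegree < ratDegree φ then
      {ratDegree φ - (fiberPoly φ z).natDegree} else 0

/-- `φ` is not a composition of two rational functions of degree at least two. -/
def IsIndecomposable (φ : RatFunc ℂ) : Prop :=
  ∀ g h : RatFunc ℂ, φ = ratComp g h → ratDegree g ≤ 1 ∨ ratDegree h ≤ 1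

/-! ### Linear differential equations of second order -/

/-- The differential equation `y'' + P y' + Q y = 0` with rational coefficients. -/
@[ext]
structure LinearODE where
  P : RatFunc ℂ
  Q : RatFunc ℂ

/-- The equation for `u(x) = y(φ(x))`, where `y(z)` runs through the solutions of `E`.  It results
from `u' = φ' y'(φ)` and
`u'' = φ'' y'(φ) + φ'² y''(φ) = φ'' y'(φ) - φ'² (P(φ) y'(φ) + Q(φ) y(φ))`. -/
def LinearODE.substitute (E : LinearODE) (φ : RatFunc ℂ) : LinearODE where
  P := ratDeriv φ * ratComp E.P φ - ratDeriv (ratDeriv φ) / ratDeriv φ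
  Q := ratDeriv φ ^ 2 * ratComp E.Q φ

/-- The equation for `Y = θ u`, where `u` runs through the solutions of `E`, and the prefactor `θ`
is given by its logarithmic derivative `w = θ' / θ`.  It results from `u' = θ⁻¹ (Y' - w Y)` and
`u'' = θ⁻¹ (Y'' - 2 w Y' + (w² - w') Y)`. -/
def LinearODE.twist (E : LinearODE) (w : RatFunc ℂ) : LinearODE where
  P := E.P - 2 * w
  Q := E.Q - E.P * w + w ^ 2 - ratDeriv w

/-- `w` is the logarithmic derivative `θ' / θ` of a radical function `θ = ∏ fᵢ ^ eᵢ`, a product of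
complex powers of nonzero rational functions: `w = ∑ eᵢ fᵢ' / fᵢ`. -/
def IsRadicalLogDeriv (w : RatFunc ℂ) : Prop :=
  w ∈ Submodule.span ℂ {v : RatFunc ℂ | ∃ f : RatFunc ℂ, f ≠ 0 ∧ v = ratDeriv f / f}

/-- The point `s` of `ℙ¹` is not a singular point of `E`.  The point `∞` is examined in the local
coordinate `u = 1 / x`. -/
def LinearODE.IsRegularAt (E : LinearODE) (s : OnePoint ℂ) : Prop :=
  s.elim
    ((E.substitute RatFunc.X⁻¹).P.denom.eval 0 ≠ 0 ∧ (E.substitute RatFunc.X⁻¹).Q.denom.eval 0 ≠ 0)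
    (fun c : ℂ => E.P.denom.eval c ≠ 0 ∧ E.Q.denom.eval c ≠ 0)

/-- `s` is a relevant singularity of `E`: it is a singular point, and it is not an irrelevant one,
i.e. no radical prefactor turns it into a non-singular point. -/
def LinearODE.IsRelevantAt (E : LinearODE) (s : OnePoint ℂ) : Prop :=
  ∀ w : RatFunc ℂ, IsRadicalLogDeriv w → ¬ (E.twist w).IsRegularAt s

/-! ### The hypergeometric equation -/

/-- The Gauss hypergeometric equation with the parameters `a = p 0`, `b = p 1`, `c = p 2`. -/
def hypergeometric (p : Fin 3 → ℂ) : LinearODE where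
  P := RatFunc.C (p 2) / RatFunc.X + RatFunc.C (p 0 + p 1 - p 2 + 1) / (RatFunc.X - 1)
  Q := RatFunc.C (p 0 * p 1) / (RatFunc.X * (RatFunc.X - 1))

/-- The singular points `0`, `1`, `∞` of the hypergeometric equation. -/
def singPt : Fin 3 → OnePoint ℂ :=
  ![((0 : ℂ) : OnePoint ℂ), ((1 : ℂ) : OnePoint ℂ), OnePoint.infty]

/-- The local exponent differences `1 - c`, `c - a - b`, `a - b` of the hypergeometric equation at
`0`, `1`, `∞`. -/
def expDiff (p : Fin 3 → ℂ) : Fin 3 → ℂ :=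
  ![1 - p 2, p 2 - p 0 - p 1, p 0 - p 1]

/-! ### The Heun equation -/

/-- The data of a Heun equation with singular points `0`, `1`, `t`, `∞`. -/
structure HeunParams where
  t : ℂ
  q : ℂ
  a : ℂ
  b : ℂ
  c : ℂ
  d : ℂ
  t_ne_zero : t ≠ 0
  t_ne_one : t ≠ 1

/-- The Heun equation. -/
def HeunParams.equation (h : HeunParams) : LinearODE where
  P := RatFunc.C h.c / RatFunc.X + RatFunc.C h.d / (RatFunc.X - 1) +
    RatFunc.C (h.a + h.b - h.c - h.d + 1) / (RatFunc.X - RatFunc.C h.t)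
  Q := (RatFunc.C (h.a * h.b) * RatFunc.X - RatFunc.C h.q) /
    (RatFunc.X * (RatFunc.X - 1) * (RatFunc.X - RatFunc.C h.t))

/-- The local exponent differences of the Heun equation at `0`, `1`, `t`, `∞`. -/
def HeunParams.expDiffs (h : HeunParams) : Multiset ℂ :=
  {1 - h.c, 1 - h.d, h.c + h.d - h.a - h.b, h.a - h.b}

/-- The four points `0`, `1`, `t`, `∞` are relevant singularities, so that the Heun equation does
not degenerate to an equation with fewer singular points. -/
def HeunParams.HasFourSingularities (h : HeunParams) : Prop :=
  h.equation.IsRelevantAt ((0 : ℂ) : OnePoint ℂ) ∧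
  h.equation.IsRelevantAt ((1 : ℂ) : OnePoint ℂ) ∧
  h.equation.IsRelevantAt ((h.t : ℂ) : OnePoint ℂ) ∧
  h.equation.IsRelevantAt OnePoint.infty

/-- The multisets of local exponent differences agree up to signs. -/
def EqUpToSign (A B : Multiset ℂ) : Prop :=
  Multiset.Rel (fun x y => x = y ∨ x = -y) A B

/-! ### Pull-back transformations -/

/-- There is a pull-back transformation `z ↦ φ(x)`, `y(z) ↦ θ(x) y(φ(x))` with a radical prefactor
`θ` that transforms the hypergeometric equation with the parameters `p` to the Heun equation `h`,
up to a fractional-linear change `x ↦ M(x)` of the variable of the transformed equation. -/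
def PullsBackTo (p : Fin 3 → ℂ) (φ : RatFunc ℂ) (h : HeunParams) : Prop :=
  0 < ratDegree φ ∧ ∃ M w : RatFunc ℂ, IsMoebius M ∧ IsRadicalLogDeriv w ∧
    ((hypergeometric p).substitute (ratComp φ M)).twist w = h.equation

/-- `V` is a family of hypergeometric equations with `n` free continuous parameters: an irreducible
algebraic subvariety of dimension `n` of the space of all `(a, b, c)`. -/
def IsParameterFamily (n : ℕ) (V : Set (Fin 3 → ℂ)) : Prop :=
  ∃ I : Ideal (MvPolynomial (Fin 3) ℂ), I.IsPrime ∧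
    ringKrullDim (MvPolynomial (Fin 3) ℂ ⧸ I) = n ∧ V = MvPolynomial.zeroLocus ℂ I

/-- `A p` holds for generic `p` in the irreducible variety `V`: it holds on `V` outside the zero set
of a polynomial that does not vanish identically on `V`. -/
def GenericOn (V : Set (Fin 3 → ℂ)) (A : (Fin 3 → ℂ) → Prop) : Prop :=
  ∃ F : MvPolynomial (Fin 3) ℂ, (∃ p ∈ V, MvPolynomial.eval p F ≠ 0) ∧
    ∀ p ∈ V, MvPolynomial.eval p F ≠ 0 → A p

/-- The hypergeometric equations whose local exponent difference at the `i`-th singular point is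
`e`. -/
def fixedExpDiff (i : Fin 3) (e : ℂ) : Set (Fin 3 → ℂ) := {p | expDiff p i = e}

/-- `φ` has the branching pattern `A 0 = A 1 = A 2`, where `A j` is the partition above the
singular point number `σ j` of the hypergeometric equation. -/
def HasPattern (φ : RatFunc ℂ) (σ : Equiv.Perm (Fin 3)) (A : Fin 3 → Multiset ℕ) : Prop :=
  ∀ j, fiberPartition φ (singPt (σ j)) = A j

/-- Up to fractional-linear transformations `x ↦ M(x)`, there is exactly one covering with the given
branching pattern. -/
def UniqueCovering (σ : Equiv.Perm (Fin 3)) (A : Fin 3 → Multiset ℕ) : Prop :=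
  (∃ φ, HasPattern φ σ A) ∧
    ∀ φ ψ, HasPattern φ σ A → HasPattern ψ σ A → ∃ M, IsMoebius M ∧ ψ = ratComp φ M

/-- The branching pattern `2 = 1+1 = 2` of the quadratic transformations
`(α, β, γ) ← (2α, β, β, 2γ)`. -/
def quadraticPattern : Fin 3 → Multiset ℕ := ![{2}, {1, 1}, {2}]

/-- The local exponent differences of the Heun equations obtained by the quadratic
transformations. -/
def quadraticDiffs (α β γ : ℂ) : Multiset ℂ := {2 * α, β, β, 2 * γ}

/-! ### The classification table -/

/-- The entries of the column "covering composition". -/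
inductive Composition
  | indecomposable
  | twoTimesTwo
  | variousTwoTimesTwo
  | noCovering

/-- A row of the table of transformations of hypergeometric equations with the local exponent
differences `(1/k, α, β)`. -/
structure TableRow where
  /-- the restricted local exponent difference is `1/k` -/
  k : ℕ
  /-- the local exponent differences of the Heun equation, as functions of `α`, `β` -/
  heunDiffs : ℂ → ℂ → Multiset ℂ
  /-- the degree of the covering -/
  deg : ℕ
  /-- the branching pattern above the points with the exponent differences `1/k`, `α`, `β` -/
  pattern : Fin 3 → Multiset ℕ
  /-- existence and decomposability of the covering -/
  composition : Composition

/-- The table of hypergeometric-to-Heun transformations with two free continuous parameters. -/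
def table : List TableRow := [
  ⟨2, fun α β => {1 / 2, α, 2 * α, 3 * β}, 3, ![{2, 1}, {2, 1}, {3}], .indecomposable⟩,
  ⟨2, fun α β => {α, α, 2 * α, 4 * β}, 4, ![{2, 2}, {2, 1, 1}, {4}], .twoTimesTwo⟩,
  ⟨2, fun α β => {α, 3 * α, β, 3 * β}, 4, ![{2, 2}, {3, 1}, {3, 1}], .indecomposable⟩,
  ⟨2, fun α β => {2 * α, 2 * α, β, 3 * β}, 4, ![{2, 2}, {2, 2}, {3, 1}], .noCovering⟩,
  ⟨2, fun α β => {2 * α, 2 * α, 2 * β, 2 * β}, 4, ![{2, 2}, {2, 2}, {2, 2}], .variousTwoTimesTwo⟩,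
  ⟨3, fun α β => {α, 2 * α, β, 2 * β}, 3, ![{3}, {2, 1}, {2, 1}], .indecomposable⟩,
  ⟨3, fun α β => {α, α, α, 3 * β}, 3, ![{3}, {1, 1, 1}, {3}], .indecomposable⟩]

/-- What the column "covering composition" asserts about the coverings with the branching pattern
`A`, the fibres being distributed according to `σ`.  In the case "various 2×2" there are three
decompositions into quadratic coverings `φ = g ∘ h`, one for each choice of the fibre above which
`g` does not branch. -/
def Composition.Holds (σ : Equiv.Perm (Fin 3)) (A : Fin 3 → Multiset ℕ) : Composition → Prop
  | .indecomposable => UniqueCovering σ A ∧ ∀ φ, HasPattern φ σ A → IsIndecomposable φ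
  | .twoTimesTwo => UniqueCovering σ A ∧ ∀ φ, HasPattern φ σ A →
      ∃ g h, ratDegree g = 2 ∧ ratDegree h = 2 ∧ φ = ratComp g h
  | .variousTwoTimesTwo => UniqueCovering σ A ∧ ∀ φ, HasPattern φ σ A → ∀ i : Fin 3,
      ∃ g h, ratDegree g = 2 ∧ ratDegree h = 2 ∧ φ = ratComp g h ∧
        fiberPartition g (singPt i) = {1, 1} ∧ ∀ j, j ≠ i → fiberPartition g (singPt j) = {2}
  | .noCovering => ¬ ∃ φ, HasPattern φ σ A

end HeunPullback

end

/-!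
Two equations `y'' + P y' + Q y = 0` differ by a prefactor exactly if their invariants
`I = Q - P² / 4 - P' / 2` agree, and the pull-back along `φ` has the invariant
`pullInv I φ = φ'² I(φ) + S(φ) / 2` with the Schwarzian derivative `S`. A pull-back transformation
is therefore an identity between such projective connections on the line: all logarithmic
derivatives in question are radical, so that the prefactor exists automatically
(`pullsBackTo_iff`), and the relevant singularities of an equation are the singularities of its
invariant (`LinearODE.isRelevantAt_iff`).

Locally, a pull-back multiplies the exponent difference by the branching index
(`CoeffAt.pullInv`). Hence a point `s` above a nonsingular point is a singularity exactly if `φ`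
branches at `s` (`regAt_pullInv_of_off`), and a point with the branching index `m` above one of
`0`, `1`, `∞` can only be nonsingular if the exponent difference there is `±1/m`. For `m ≥ 2` this
condition is sufficient, since all terms that could obstruct it vanish to a sufficient order
(`reg_pullInv`, `regAt_pullInv_of_exceptional`). For `m = 1` the two other exponent differences
have to agree up to sign in addition (`sq_eq_of_regAt`).

For generic members of a family with three parameters no exponent difference is `±1/m` with
`m ≤ deg φ`. On a surface at most one of them is so identically: by the irreducibility and a
comparison of Krull dimensions the surface is then the plane given by this linear condition
(`zeroLocus_eq_fixedExpDiff`), and the other exponent differences are generic. So the nonsingular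
points of the three fibres are the points with the branching index `k` above a single point, for
one `k ≥ 2`, or there are none (`Controlled`). If there are `n` of them, and the pull-back has
four singularities, then the Riemann–Hurwitz formula (`riemannHurwitz`) and `k n ≤ deg φ` show
that there is no other branching, that the three fibres have `deg φ + 2` points in total, and that
`deg φ = n + 2` (`Controlled.pattern`). This leaves the quadratic pattern for `n = 0` and the
patterns of the table for `n > 0` (`pattern_quadratic`, `pattern_table`).

Conversely, the same count shows that a covering with such a pattern gives a connection with four
double poles at most. The connections with four double poles and prescribed exponent differences
form a line, on which the accessory parameter is a coordinate; so the pull-back is a Heun equation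
(`exists_heun`, `exists_pullsBackTo`).

The coverings are found by moving three distinguished points to `0`, `1`, `∞`, whereupon the
divisibility conditions on the numerator and the denominator have one solution (`IsNormalForm`),
or none (`not_hasPattern_table_three`). Two of the normal forms of degree four are squares of
quadratic functions; the third one has a point with the branching index `3`, which is not a
product of branching indices of quadratic functions.
-/

noncomputable section

namespace HeunPullback

/-! ### Differentiation and composition of rational functions -/

theorem ratDeriv_div (p q : ℂ[X]) (hq : q ≠ 0) :
    ratDeriv (algebraMap ℂ[X] (RatFunc ℂ) p / algebraMap ℂ[X] (RatFunc ℂ) q) =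
      algebraMap ℂ[X] (RatFunc ℂ) (derivative p * q - p * derivative q) /
        algebraMap ℂ[X] (RatFunc ℂ) (q ^ 2) := by
  obtain ⟨f, hf⟩ : ∃ f, f = algebraMap ℂ[X] (RatFunc ℂ) p / algebraMap ℂ[X] (RatFunc ℂ) q :=
    ⟨_, rfl⟩
  rw [← hf]
  have key : f.num * q = p * f.denom := (RatFunc.num_mul_eq_mul_denom_iff hq).2 hf
  have hd := f.denom_ne_zero
  have key' := congrArg derivative key
  simp only [derivative_mul] at key'
  rw [ratDeriv, div_eq_div_iff (RatFunc.algebraMap_ne_zero (pow_ne_zero 2 hd))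
    (RatFunc.algebraMap_ne_zero (pow_ne_zero 2 hq)), ← map_mul, ← map_mul]
  refine congrArg _ ?_
  linear_combination (q * f.denom) * key' - (derivative f.denom * q + f.denom * derivative q) * key

theorem exists_eq_div (f : RatFunc ℂ) : ∃ p q : ℂ[X], q ≠ 0 ∧
    f = algebraMap ℂ[X] (RatFunc ℂ) p / algebraMap ℂ[X] (RatFunc ℂ) q :=
  ⟨f.num, f.denom, f.denom_ne_zero, f.num_div_denom.symm⟩

theorem ratDeriv_algebraMap (p : ℂ[X]) :
    ratDeriv (algebraMap ℂ[X] (RatFunc ℂ) p) = algebraMap ℂ[X] (RatFunc ℂ) (derivative p) := by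
  simpa using ratDeriv_div p 1 one_ne_zero

theorem ratDeriv_C (c : ℂ) : ratDeriv (RatFunc.C c) = 0 := by
  rw [← RatFunc.algebraMap_C, ratDeriv_algebraMap]; simp

theorem ratDeriv_X : ratDeriv RatFunc.X = 1 := by
  rw [← RatFunc.algebraMap_X, ratDeriv_algebraMap]; simp

theorem ratDeriv_add (f g : RatFunc ℂ) : ratDeriv (f + g) = ratDeriv f + ratDeriv g := by
  obtain ⟨p, q, hq, rfl⟩ := exists_eq_div f
  obtain ⟨r, s, hs, rfl⟩ := exists_eq_div g
  have hq' := RatFunc.algebraMap_ne_zero hq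
  have hs' := RatFunc.algebraMap_ne_zero hs
  rw [div_add_div _ _ hq' hs', ← map_mul, ← map_mul, ← map_add, ← map_mul,
    ratDeriv_div _ _ (mul_ne_zero hq hs), ratDeriv_div _ _ hq, ratDeriv_div _ _ hs]
  simp only [map_mul, map_add, map_sub, map_pow, derivative_mul]
  field_simp
  ring

theorem ratDeriv_mul (f g : RatFunc ℂ) : ratDeriv (f * g) = f * ratDeriv g + g * ratDeriv f := by
  obtain ⟨p, q, hq, rfl⟩ := exists_eq_div f
  obtain ⟨r, s, hs, rfl⟩ := exists_eq_div g
  have hq' := RatFunc.algebraMap_ne_zero hq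
  have hs' := RatFunc.algebraMap_ne_zero hs
  rw [div_mul_div_comm, ← map_mul, ← map_mul,
    ratDeriv_div _ _ (mul_ne_zero hq hs), ratDeriv_div _ _ hq, ratDeriv_div _ _ hs]
  simp only [map_mul, map_add, map_sub, map_pow, derivative_mul]
  field_simp
  ring

/-- `d/dx` as a derivation of the field of rational functions. -/
def ratD : Derivation ℂ (RatFunc ℂ) (RatFunc ℂ) :=
  Derivation.mk'
    { toFun := ratDeriv
      map_add' := ratDeriv_add
      map_smul' := fun c f => by
        simp [RatFunc.smul_eq_C_mul, ratDeriv_mul, ratDeriv_C] }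
    (fun a b => by simpa using ratDeriv_mul a b)

theorem ratD_apply (f : RatFunc ℂ) : ratD f = ratDeriv f := rfl

theorem ratD_C (c : ℂ) : ratD (RatFunc.C c) = 0 := ratDeriv_C c

theorem ratD_X : ratD RatFunc.X = 1 := ratDeriv_X

/-- `φ` is not constant, so that substituting `φ` is an endomorphism of the field of rational
functions. -/
def Nonconst (φ : RatFunc ℂ) : Prop := ¬ ∃ c, φ = RatFunc.C c

theorem nonconst_iff {φ : RatFunc ℂ} : Nonconst φ ↔ 0 < ratDegree φ := by
  rw [Nonconst, RatFunc.eq_C_iff, ratDegree]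
  omega

theorem Nonconst.ne_zero {φ : RatFunc ℂ} (h : Nonconst φ) : φ ≠ 0 := by
  rintro rfl; exact h ⟨0, by simp⟩

theorem Nonconst.sub_C_ne_zero {φ : RatFunc ℂ} (h : Nonconst φ) (c : ℂ) :
    φ - RatFunc.C c ≠ 0 := fun h0 => h ⟨c, sub_eq_zero.1 h0⟩

/-- Substitution of a nonconstant rational function, as a homomorphism. -/
theorem Nonconst.exists_hom {φ : RatFunc ℂ} (h : Nonconst φ) :
    ∃ T : RatFunc ℂ →ₐ[ℂ] RatFunc ℂ, T RatFunc.X = φ ∧ ∀ f, ratComp f φ = T f := by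
  have htr : Transcendental ℂ φ := RatFunc.transcendental_of_ne_C φ h
  have hinj : Function.Injective (aeval φ : ℂ[X] →ₐ[ℂ] RatFunc ℂ) :=
    transcendental_iff_injective.1 htr
  refine ⟨RatFunc.liftAlgHom (aeval φ)
    (nonZeroDivisors_le_comap_nonZeroDivisors_of_injective _ hinj), ?_, fun f => ?_⟩
  · have := RatFunc.liftAlgHom_apply_div (aeval φ)
      (nonZeroDivisors_le_comap_nonZeroDivisors_of_injective _ hinj) X 1
    simpa using this
  · rw [RatFunc.liftAlgHom_apply, ratComp, RatFunc.eval]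
    rfl

theorem ratComp_X_right (f : RatFunc ℂ) : ratComp f RatFunc.X = f := by
  rw [ratComp, RatFunc.eval]
  have : ∀ p : ℂ[X], eval₂ (algebraMap ℂ (RatFunc ℂ)) RatFunc.X p = algebraMap ℂ[X] (RatFunc ℂ) p :=
    fun p => RatFunc.aeval_X_left_eq_algebraMap p
  rw [this, this, RatFunc.num_div_denom]

theorem ratComp_X_left (f : RatFunc ℂ) : ratComp RatFunc.X f = f := by
  simp [ratComp]

theorem algHom_C (T : RatFunc ℂ →ₐ[ℂ] RatFunc ℂ) (c : ℂ) : T (RatFunc.C c) = RatFunc.C c :=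
  T.commutes c

theorem algHom_algebraMap (T : RatFunc ℂ →ₐ[ℂ] RatFunc ℂ) (p : ℂ[X]) :
    T (algebraMap ℂ[X] (RatFunc ℂ) p) = aeval (T RatFunc.X) p := by
  rw [← RatFunc.aeval_X_left_eq_algebraMap, Polynomial.aeval_algHom_apply]

/-- Two endomorphisms of the field of rational functions agree if they agree on the variable. -/
theorem algHom_ext {T S : RatFunc ℂ →ₐ[ℂ] RatFunc ℂ} (h : T RatFunc.X = S RatFunc.X)
    (f : RatFunc ℂ) : T f = S f := by
  obtain ⟨p, q, -, rfl⟩ := exists_eq_div f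
  rw [map_div₀, map_div₀, algHom_algebraMap, algHom_algebraMap, algHom_algebraMap,
    algHom_algebraMap, h]

theorem Nonconst.comp {φ ψ : RatFunc ℂ} (hφ : Nonconst φ) (hψ : Nonconst ψ) :
    Nonconst (ratComp φ ψ) := by
  obtain ⟨T, -, hT⟩ := hψ.exists_hom
  rintro ⟨c, hc⟩
  refine hφ ⟨c, ?_⟩
  rw [hT, ← algHom_C T c] at hc
  exact T.toRingHom.injective hc

theorem ratComp_assoc (f : RatFunc ℂ) {φ ψ : RatFunc ℂ} (hφ : Nonconst φ) (hψ : Nonconst ψ) :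
    ratComp (ratComp f φ) ψ = ratComp f (ratComp φ ψ) := by
  obtain ⟨T, hTX, hT⟩ := hψ.exists_hom
  obtain ⟨S, hSX, hS⟩ := hφ.exists_hom
  obtain ⟨R, hRX, hR⟩ := (hφ.comp hψ).exists_hom
  rw [hT, hS, hR]
  refine algHom_ext (T := T.comp S) ?_ f
  rw [AlgHom.comp_apply, hSX, hRX, hT]

/-- The chain rule. -/
theorem ratD_algHom (T : RatFunc ℂ →ₐ[ℂ] RatFunc ℂ) (f : RatFunc ℂ) :
    ratD (T f) = T (ratD f) * ratD (T RatFunc.X) := by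
  have hp : ∀ p : ℂ[X], ratD (T (algebraMap ℂ[X] (RatFunc ℂ) p)) =
      T (ratD (algebraMap ℂ[X] (RatFunc ℂ) p)) * ratD (T RatFunc.X) := by
    intro p
    induction p using Polynomial.induction_on' with
    | add p q hp hq => simp only [map_add, hp, hq, add_mul]
    | monomial n a =>
      rw [RatFunc.algebraMap_monomial]
      simp only [map_mul, map_pow, Derivation.leibniz, Derivation.leibniz_pow, ratD_C, algHom_C,
        ratD_X, smul_eq_mul, nsmul_eq_mul]
      simp [algHom_C]
      ring
  obtain ⟨p, q, hq, rfl⟩ := exists_eq_div f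
  have hq' : T (algebraMap ℂ[X] (RatFunc ℂ) q) ≠ 0 :=
    (map_ne_zero T).2 (RatFunc.algebraMap_ne_zero hq)
  simp only [map_div₀, Derivation.leibniz_div, hp, smul_eq_mul, map_mul, map_pow, map_sub, map_inv₀]
  ring

/-- A rational function with zero derivative is constant, since its reduced denominator would divide
its own derivative. -/
theorem ratD_eq_zero {f : RatFunc ℂ} (h : ratD f = 0) : ∃ c, f = RatFunc.C c := by
  rw [ratD_apply, ratDeriv, div_eq_zero_iff] at h
  have h1 : derivative f.num * f.denom - f.num * derivative f.denom = 0 := by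
    rcases h with h | h
    · exact (map_eq_zero_iff _ (RatFunc.algebraMap_injective ℂ)).1 h
    · exact absurd h (RatFunc.algebraMap_ne_zero (pow_ne_zero 2 f.denom_ne_zero))
  have hden : derivative f.denom = 0 := by
    by_contra h0
    have hdvd : f.denom ∣ derivative f.denom := by
      refine (RatFunc.isCoprime_num_denom f).symm.dvd_of_dvd_mul_left
        (Dvd.intro_left (derivative f.num) (sub_eq_zero.1 h1))
    have := Polynomial.degree_le_of_dvd hdvd h0
    exact absurd (Polynomial.degree_derivative_lt f.denom_ne_zero) (not_lt.2 this)
  have hnum : derivative f.num = 0 := by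
    rw [hden, mul_zero, sub_zero] at h1
    exact (mul_eq_zero.1 h1).resolve_right f.denom_ne_zero
  rw [RatFunc.eq_C_iff]
  exact ⟨derivative_eq_zero.1 hnum, derivative_eq_zero.1 hden⟩

theorem Nonconst.ratD_ne_zero {φ : RatFunc ℂ} (h : Nonconst φ) : ratD φ ≠ 0 :=
  fun h0 => h (ratD_eq_zero h0)

theorem nonconst_X : Nonconst RatFunc.X := by
  rw [nonconst_iff]; simp [ratDegree]

theorem nonconst_X_inv : Nonconst (RatFunc.X⁻¹ : RatFunc ℂ) := by
  rintro ⟨c, hc⟩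
  exact nonconst_X ⟨c⁻¹, by rw [map_inv₀, ← hc, inv_inv]⟩

theorem nonconst_X_add_C (c : ℂ) : Nonconst (RatFunc.X + RatFunc.C c) := by
  rintro ⟨d, hd⟩
  exact nonconst_X ⟨d - c, by rw [map_sub, ← hd, add_sub_cancel_right]⟩

/-! ### The invariant of an equation under prefactors -/

/-- The coefficient of the normal form `u'' + I u = 0` of `y'' + P y' + Q y = 0`, which is
`I = Q - P² / 4 - P' / 2`. -/
def LinearODE.normalInv (E : LinearODE) : RatFunc ℂ := E.Q - E.P ^ 2 / 4 - ratD E.P / 2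

/-- The pull-back of a projective connection: if `I` is the invariant of an equation, then
`pullInv I φ = φ'² I(φ) + S(φ) / 2`, where `S` is the Schwarzian derivative, is the invariant of its
pull-back along `φ`. -/
def pullInv (I φ : RatFunc ℂ) : RatFunc ℂ :=
  ratD φ ^ 2 * ratComp I φ +
    (ratD (ratD (ratD φ) / ratD φ) - (ratD (ratD φ) / ratD φ) ^ 2 / 2) / 2

theorem ratD_natCast_mul (n : ℕ) (f : RatFunc ℂ) : ratD (n * f) = n * ratD f := by
  rw [← nsmul_eq_mul, map_nsmul, nsmul_eq_mul]

theorem ratD_two_mul (f : RatFunc ℂ) : ratD (2 * f) = 2 * ratD f :=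
  mod_cast ratD_natCast_mul 2 f

theorem ratD_mul (f g : RatFunc ℂ) : ratD (f * g) = f * ratD g + g * ratD f := ratDeriv_mul f g

theorem ratD_div (f g : RatFunc ℂ) : ratD (f / g) = (g * ratD f - f * ratD g) / g ^ 2 := by
  rw [Derivation.leibniz_div, smul_eq_mul, smul_eq_mul, smul_eq_mul, inv_pow, div_eq_inv_mul]

theorem ratD_div_two (f : RatFunc ℂ) : ratD (f / 2) = ratD f / 2 := by
  have := ratD_two_mul (f / 2)
  rw [mul_div_cancel₀ f two_ne_zero] at this
  rw [this]; field_simp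

/-- Prefactors do not change the invariant. -/
theorem LinearODE.normalInv_twist (E : LinearODE) (w : RatFunc ℂ) :
    (E.twist w).normalInv = E.normalInv := by
  simp only [normalInv, twist, map_sub, ratD_two_mul, ← ratD_apply]
  ring

/-- Equations with the same invariant differ by a prefactor only. -/
theorem LinearODE.twist_eq_of_normalInv_eq {E F : LinearODE} (h : E.normalInv = F.normalInv) :
    E.twist ((E.P - F.P) / 2) = F := by
  simp only [normalInv] at h
  ext1
  · simp only [twist]; ring
  · simp only [twist, ← ratD_apply, ratD_div_two, map_sub]
    linear_combination h

theorem LinearODE.normalInv_substitute (E : LinearODE) {φ : RatFunc ℂ} (hφ : Nonconst φ) :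
    (E.substitute φ).normalInv = pullInv E.normalInv φ := by
  obtain ⟨T, hTX, hT⟩ := hφ.exists_hom
  have hN : ratD (ratD φ) = (ratD (ratD φ) / ratD φ) * ratD φ :=
    (div_mul_cancel₀ _ hφ.ratD_ne_zero).symm
  simp only [normalInv, substitute, pullInv, ← ratD_apply, hT, map_sub, map_div₀, map_pow,
    ratD_mul, ratD_algHom, hTX, map_ofNat]
  set N := ratD (ratD φ) / ratD φ
  rw [hN]
  ring

/-- Pull-backs of projective connections compose; this is the cocycle identity of the Schwarzian
derivative. -/
theorem pullInv_comp (I : RatFunc ℂ) {φ ψ : RatFunc ℂ} (hφ : Nonconst φ) (hψ : Nonconst ψ) :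
    pullInv (pullInv I φ) ψ = pullInv I (ratComp φ ψ) := by
  obtain ⟨T, hTX, hT⟩ := hψ.exists_hom
  have hTφ : T (ratD φ) ≠ 0 := (map_ne_zero T).2 hφ.ratD_ne_zero
  have hψ0 := hψ.ratD_ne_zero
  have h2 : ratD (ratComp φ ψ) = T (ratD φ) * ratD ψ := by
    rw [hT, ratD_algHom, hTX]
  have h3 : ratD (ratD (ratComp φ ψ)) / ratD (ratComp φ ψ) =
      ratD ψ * T (ratD (ratD φ) / ratD φ) + ratD (ratD ψ) / ratD ψ := by
    rw [h2, ratD_mul, ratD_algHom, hTX, map_div₀]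
    field_simp
    ring
  have h4 : ratD (ratD ψ) = (ratD (ratD ψ) / ratD ψ) * ratD ψ := (div_mul_cancel₀ _ hψ0).symm
  have h5 : ratComp I (ratComp φ ψ) = T (ratComp I φ) := by
    rw [← ratComp_assoc I hφ hψ, hT]
  rw [pullInv, pullInv, pullInv, h3, h2, h5, hT]
  simp only [map_add, map_mul, map_sub, map_pow, map_div₀, map_ofNat, ratD_mul]
  rw [← map_div₀ T, ratD_algHom, hTX]
  set N := ratD (ratD ψ) / ratD ψ
  rw [h4]
  ring

/-! ### Radical prefactors -/

theorem isRadicalLogDeriv_logDeriv {f : RatFunc ℂ} (hf : f ≠ 0) :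
    IsRadicalLogDeriv (ratD f / f) :=
  Submodule.subset_span ⟨f, hf, rfl⟩

theorem IsRadicalLogDeriv.add {v w : RatFunc ℂ} (hv : IsRadicalLogDeriv v)
    (hw : IsRadicalLogDeriv w) : IsRadicalLogDeriv (v + w) := Submodule.add_mem _ hv hw

theorem IsRadicalLogDeriv.sub {v w : RatFunc ℂ} (hv : IsRadicalLogDeriv v)
    (hw : IsRadicalLogDeriv w) : IsRadicalLogDeriv (v - w) := Submodule.sub_mem _ hv hw

theorem IsRadicalLogDeriv.C_mul {v : RatFunc ℂ} (hv : IsRadicalLogDeriv v) (c : ℂ) :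
    IsRadicalLogDeriv (RatFunc.C c * v) := by
  rw [← RatFunc.smul_eq_C_mul]; exact Submodule.smul_mem _ c hv

theorem IsRadicalLogDeriv.div_two {v : RatFunc ℂ} (hv : IsRadicalLogDeriv v) :
    IsRadicalLogDeriv (v / 2) := by
  have := hv.C_mul (1 / 2)
  rwa [map_div₀, map_one, map_ofNat, one_div, inv_mul_eq_div] at this

theorem isRadicalLogDeriv_C_div (c s : ℂ) :
    IsRadicalLogDeriv (RatFunc.C c / (RatFunc.X - RatFunc.C s)) := by
  have h := (isRadicalLogDeriv_logDeriv (nonconst_X.sub_C_ne_zero s)).C_mul c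
  rwa [map_sub, ratD_X, ratD_C, sub_zero, mul_one_div] at h

/-- Substitution carries logarithmic derivatives to logarithmic derivatives. -/
theorem IsRadicalLogDeriv.pull {w φ : RatFunc ℂ} (hw : IsRadicalLogDeriv w) (hφ : Nonconst φ) :
    IsRadicalLogDeriv (ratD φ * ratComp w φ) := by
  obtain ⟨T, hTX, hT⟩ := hφ.exists_hom
  rw [hT]
  induction hw using Submodule.span_induction with
  | mem v hv =>
    obtain ⟨f, hf, rfl⟩ := hv
    have h := isRadicalLogDeriv_logDeriv ((map_ne_zero T).2 hf)
    rw [ratD_algHom, hTX] at h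
    rwa [map_div₀, ← ratD_apply, mul_comm, div_mul_eq_mul_div]
  | zero => rw [map_zero, mul_zero]; exact Submodule.zero_mem _
  | add v w _ _ hv hw => rw [map_add, mul_add]; exact hv.add hw
  | smul c v _ hv =>
    rw [RatFunc.smul_eq_C_mul, map_mul, algHom_C, mul_left_comm]; exact hv.C_mul c

theorem isRadicalLogDeriv_hypergeometric (p : Fin 3 → ℂ) :
    IsRadicalLogDeriv (hypergeometric p).P := by
  have h0 := isRadicalLogDeriv_C_div (p 2) 0
  have h1 := isRadicalLogDeriv_C_div (p 0 + p 1 - p 2 + 1) 1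
  rw [map_zero, sub_zero] at h0
  rw [map_one] at h1
  exact h0.add h1

theorem HeunParams.isRadicalLogDeriv (h : HeunParams) : IsRadicalLogDeriv h.equation.P := by
  have h0 := isRadicalLogDeriv_C_div h.c 0
  have h1 := isRadicalLogDeriv_C_div h.d 1
  have h2 := isRadicalLogDeriv_C_div (h.a + h.b - h.c - h.d + 1) h.t
  rw [map_zero, sub_zero] at h0
  rw [map_one] at h1
  exact (h0.add h1).add h2

/-- A pull-back transformation is an identity between invariants: the prefactor exists
automatically. -/
theorem pullsBackTo_iff (p : Fin 3 → ℂ) (φ : RatFunc ℂ) (h : HeunParams) :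
    PullsBackTo p φ h ↔ Nonconst φ ∧ ∃ M, IsMoebius M ∧
      pullInv (pullInv (hypergeometric p).normalInv φ) M = h.equation.normalInv := by
  rw [PullsBackTo, ← nonconst_iff]
  refine and_congr_right fun hφ => exists_congr fun M => ?_
  constructor
  · rintro ⟨w, hM, hw, heq⟩
    have hM' : Nonconst M := nonconst_iff.2 (by rw [hM]; exact one_pos)
    refine ⟨hM, ?_⟩
    rw [← heq, LinearODE.normalInv_twist, LinearODE.normalInv_substitute _ (hφ.comp hM'),
      pullInv_comp _ hφ hM']
  · rintro ⟨hM, heq⟩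
    have hM' : Nonconst M := nonconst_iff.2 (by rw [hM]; exact one_pos)
    rw [pullInv_comp _ hφ hM', ← LinearODE.normalInv_substitute _ (hφ.comp hM')] at heq
    refine ⟨_, hM, ?_, LinearODE.twist_eq_of_normalInv_eq heq⟩
    refine IsRadicalLogDeriv.div_two (IsRadicalLogDeriv.sub ?_ h.isRadicalLogDeriv)
    exact ((isRadicalLogDeriv_hypergeometric p).pull (hφ.comp hM')).sub
      (isRadicalLogDeriv_logDeriv (hφ.comp hM').ratD_ne_zero)

/-! ### Values and orders at the origin -/

/-- The rational function `f` is regular at `0` with the value `c`. -/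
def HasVal (f : RatFunc ℂ) (c : ℂ) : Prop :=
  ∃ p q : ℂ[X], q.eval 0 ≠ 0 ∧
    f = algebraMap ℂ[X] (RatFunc ℂ) p / algebraMap ℂ[X] (RatFunc ℂ) q ∧
    p.eval 0 = c * q.eval 0

/-- The rational function `f` is regular at `0`. -/
def Reg (f : RatFunc ℂ) : Prop := ∃ c, HasVal f c

theorem ne_zero_of_eval_ne_zero {q : ℂ[X]} {x : ℂ} (h : q.eval x ≠ 0) : q ≠ 0 := by
  rintro rfl; simp at h

theorem hasVal_algebraMap (p : ℂ[X]) : HasVal (algebraMap ℂ[X] (RatFunc ℂ) p) (p.eval 0) :=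
  ⟨p, 1, by simp, by simp, by simp⟩

theorem hasVal_C (c : ℂ) : HasVal (RatFunc.C c) c := by
  simpa using hasVal_algebraMap (C c)

theorem hasVal_X : HasVal RatFunc.X 0 := by
  simpa using hasVal_algebraMap X

theorem hasVal_natCast (n : ℕ) : HasVal (n : RatFunc ℂ) n := by
  simpa using hasVal_C n

theorem hasVal_one : HasVal 1 1 := by simpa using hasVal_C 1

theorem hasVal_zero : HasVal 0 0 := by simpa using hasVal_C 0

theorem hasVal_ofNat (n : ℕ) [n.AtLeastTwo] :
    HasVal (OfNat.ofNat n : RatFunc ℂ) (OfNat.ofNat n : ℂ) := by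
  exact_mod_cast hasVal_natCast (OfNat.ofNat n)

theorem HasVal.add {f g : RatFunc ℂ} {a b : ℂ} (hf : HasVal f a) (hg : HasVal g b) :
    HasVal (f + g) (a + b) := by
  obtain ⟨p, q, hq, rfl, h1⟩ := hf
  obtain ⟨r, s, hs, rfl, h2⟩ := hg
  refine ⟨p * s + q * r, q * s, by simp [hq, hs], ?_, ?_⟩
  · rw [div_add_div _ _ (RatFunc.algebraMap_ne_zero (ne_zero_of_eval_ne_zero hq))
      (RatFunc.algebraMap_ne_zero (ne_zero_of_eval_ne_zero hs))]
    simp only [map_add, map_mul]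
  · simp only [eval_add, eval_mul, h1, h2]; ring

theorem HasVal.mul {f g : RatFunc ℂ} {a b : ℂ} (hf : HasVal f a) (hg : HasVal g b) :
    HasVal (f * g) (a * b) := by
  obtain ⟨p, q, hq, rfl, h1⟩ := hf
  obtain ⟨r, s, hs, rfl, h2⟩ := hg
  refine ⟨p * r, q * s, by simp [hq, hs], ?_, ?_⟩
  · rw [div_mul_div_comm]
    simp only [map_mul]
  · simp only [eval_mul, h1, h2]; ring

theorem HasVal.neg {f : RatFunc ℂ} {a : ℂ} (hf : HasVal f a) : HasVal (-f) (-a) := by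
  simpa using (hasVal_C (-1)).mul hf

theorem HasVal.sub {f g : RatFunc ℂ} {a b : ℂ} (hf : HasVal f a) (hg : HasVal g b) :
    HasVal (f - g) (a - b) := by
  simpa [sub_eq_add_neg] using hf.add hg.neg

theorem HasVal.pow {f : RatFunc ℂ} {a : ℂ} (hf : HasVal f a) (n : ℕ) : HasVal (f ^ n) (a ^ n) := by
  induction n with
  | zero => simpa using hasVal_one
  | succ n ih => simpa [pow_succ] using ih.mul hf

theorem HasVal.inv {f : RatFunc ℂ} {a : ℂ} (hf : HasVal f a) (ha : a ≠ 0) : HasVal f⁻¹ a⁻¹ := by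
  obtain ⟨p, q, hq, rfl, h1⟩ := hf
  refine ⟨q, p, by rw [h1]; exact mul_ne_zero ha hq, by rw [inv_div], ?_⟩
  rw [h1]; field_simp

theorem HasVal.div {f g : RatFunc ℂ} {a b : ℂ} (hf : HasVal f a) (hg : HasVal g b) (hb : b ≠ 0) :
    HasVal (f / g) (a / b) := by
  simpa [div_eq_mul_inv] using hf.mul (hg.inv hb)

theorem HasVal.unique {f : RatFunc ℂ} {a b : ℂ} (h : HasVal f a) (h' : HasVal f b) : a = b := by
  obtain ⟨p, q, hq, rfl, h1⟩ := h
  obtain ⟨r, s, hs, h, h2⟩ := h'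
  rw [div_eq_div_iff (RatFunc.algebraMap_ne_zero (ne_zero_of_eval_ne_zero hq))
      (RatFunc.algebraMap_ne_zero (ne_zero_of_eval_ne_zero hs)), ← map_mul, ← map_mul] at h
  have := congrArg (eval 0) (RatFunc.algebraMap_injective ℂ h)
  rw [eval_mul, eval_mul, h1, h2] at this
  have h3 : (a - b) * (q.eval 0 * s.eval 0) = 0 := by linear_combination this
  exact sub_eq_zero.1 ((mul_eq_zero.1 h3).resolve_right (mul_ne_zero hq hs))

theorem HasVal.ne_zero {f : RatFunc ℂ} {a : ℂ} (h : HasVal f a) (ha : a ≠ 0) : f ≠ 0 := by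
  rintro rfl; exact ha (h.unique hasVal_zero)

theorem HasVal.reg {f : RatFunc ℂ} {a : ℂ} (h : HasVal f a) : Reg f := ⟨a, h⟩

theorem Reg.add {f g : RatFunc ℂ} : Reg f → Reg g → Reg (f + g)
  | ⟨_, hf⟩, ⟨_, hg⟩ => ⟨_, hf.add hg⟩

theorem Reg.sub {f g : RatFunc ℂ} : Reg f → Reg g → Reg (f - g)
  | ⟨_, hf⟩, ⟨_, hg⟩ => ⟨_, hf.sub hg⟩

theorem Reg.mul {f g : RatFunc ℂ} : Reg f → Reg g → Reg (f * g)
  | ⟨_, hf⟩, ⟨_, hg⟩ => ⟨_, hf.mul hg⟩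

theorem Reg.pow {f : RatFunc ℂ} : Reg f → ∀ n : ℕ, Reg (f ^ n)
  | ⟨_, hf⟩, n => ⟨_, hf.pow n⟩

theorem reg_C (c : ℂ) : Reg (RatFunc.C c) := (hasVal_C c).reg

theorem reg_X : Reg RatFunc.X := hasVal_X.reg

theorem Reg.div_ofNat {f : RatFunc ℂ} (h : Reg f) (n : ℕ) [n.AtLeastTwo] :
    Reg (f / OfNat.ofNat n) := by
  obtain ⟨a, ha⟩ := h
  exact (ha.div (hasVal_ofNat n) (NeZero.ne _)).reg

theorem Reg.hasVal_X_mul {f : RatFunc ℂ} (h : Reg f) : HasVal (RatFunc.X * f) 0 := by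
  obtain ⟨a, ha⟩ := h
  simpa using hasVal_X.mul ha

theorem Reg.ratD {f : RatFunc ℂ} (h : Reg f) : Reg (ratD f) := by
  obtain ⟨a, p, q, hq, rfl, -⟩ := h
  have hq2 : (q ^ 2).eval 0 ≠ 0 := by simp [hq]
  exact ⟨_, _, q ^ 2, hq2, ratDeriv_div p q (ne_zero_of_eval_ne_zero hq),
    (div_mul_cancel₀ _ hq2).symm⟩

theorem HasVal.exists_eq_X_mul {f : RatFunc ℂ} (h : HasVal f 0) :
    ∃ g, Reg g ∧ f = RatFunc.X * g := by
  obtain ⟨p, q, hq, rfl, h1⟩ := h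
  rw [zero_mul, ← IsRoot.def, ← dvd_iff_isRoot, map_zero, sub_zero] at h1
  obtain ⟨r, rfl⟩ := h1
  refine ⟨algebraMap ℂ[X] (RatFunc ℂ) r / algebraMap ℂ[X] (RatFunc ℂ) q,
    ⟨r.eval 0 / q.eval 0, r, q, hq, rfl, (div_mul_cancel₀ _ hq).symm⟩, ?_⟩
  rw [map_mul, RatFunc.algebraMap_X, mul_div_assoc]

theorem HasVal.comp {f : RatFunc ℂ} {c : ℂ} (hf : HasVal f c) (T : RatFunc ℂ →ₐ[ℂ] RatFunc ℂ)
    (hT : HasVal (T RatFunc.X) 0) : HasVal (T f) c := by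
  have hp : ∀ p : ℂ[X], HasVal (T (algebraMap ℂ[X] (RatFunc ℂ) p)) (p.eval 0) := by
    intro p
    induction p using Polynomial.induction_on' with
    | add p q hp hq => simpa using hp.add hq
    | monomial n a =>
      rw [RatFunc.algebraMap_monomial, map_mul, map_pow, algHom_C]
      simpa using (hasVal_C a).mul (hT.pow n)
  obtain ⟨p, q, hq, rfl, h1⟩ := hf
  rw [map_div₀]
  have := (hp p).div (hp q) hq
  rwa [h1, mul_div_cancel_right₀ _ hq] at this

/-- A rational function is either regular at `0` or has a pole there. -/
theorem reg_or_hasVal_inv (f : RatFunc ℂ) : Reg f ∨ HasVal f⁻¹ 0 := by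
  by_cases h : f.denom.eval 0 = 0
  · right
    have hn : f.num.eval 0 ≠ 0 := by
      intro hn
      obtain ⟨u, v, huv⟩ := RatFunc.isCoprime_num_denom f
      have := congrArg (eval 0) huv
      simp [h, hn] at this
    refine ⟨f.denom, f.num, hn, ?_, by simp [h]⟩
    rw [← inv_div, RatFunc.num_div_denom]
  · left
    exact ⟨f.num.eval 0 / f.denom.eval 0, f.num, f.denom, h, (RatFunc.num_div_denom f).symm,
      (div_mul_cancel₀ _ h).symm⟩

theorem not_reg_of_hasVal_inv {f : RatFunc ℂ} (hf : f ≠ 0) (h : HasVal f⁻¹ 0) : ¬ Reg f := by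
  rintro ⟨a, ha⟩
  have := ha.mul h
  rw [mul_inv_cancel₀ hf, mul_zero] at this
  exact one_ne_zero (hasVal_one.unique this)

/-- `χ` has a zero of order `m` at `0` (or a nonzero value there, if `m = 0`). -/
def HasOrder (χ : RatFunc ℂ) (m : ℕ) : Prop :=
  ∃ v c, c ≠ 0 ∧ HasVal v c ∧ χ = RatFunc.X ^ m * v

theorem HasOrder.hasVal {χ : RatFunc ℂ} {m : ℕ} (h : HasOrder χ m) (hm : 0 < m) : HasVal χ 0 := by
  obtain ⟨v, c, -, hv, rfl⟩ := h
  simpa [zero_pow hm.ne'] using (hasVal_X.pow m).mul hv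

theorem HasOrder.ne_zero {χ : RatFunc ℂ} {m : ℕ} (h : HasOrder χ m) : χ ≠ 0 := by
  obtain ⟨v, c, hc, hv, rfl⟩ := h
  exact mul_ne_zero (pow_ne_zero _ RatFunc.X_ne_zero) (hv.ne_zero hc)

theorem HasOrder.nonconst {χ : RatFunc ℂ} {m : ℕ} (h : HasOrder χ m) (hm : 0 < m) :
    Nonconst χ := by
  rintro ⟨c, rfl⟩
  have h1 := (h.hasVal hm).unique (hasVal_C c)
  exact h.ne_zero (by rw [← h1, map_zero])

theorem HasOrder.le {χ : RatFunc ℂ} {m n : ℕ} (h : HasOrder χ m) (h' : HasOrder χ n) : n ≤ m := by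
  by_contra! hlt
  obtain ⟨v, c, hc, hv, rfl⟩ := h
  obtain ⟨w, d, hd, hw, h⟩ := h'
  obtain ⟨k, rfl⟩ := Nat.exists_eq_add_of_lt hlt
  have h1 : v = RatFunc.X ^ (k + 1) * w := by
    refine mul_left_cancel₀ (pow_ne_zero m RatFunc.X_ne_zero) ?_
    rw [h]; ring
  have h2 := (hasVal_X.pow (k + 1)).mul hw
  rw [← h1] at h2
  exact hc (by simpa using hv.unique h2)

theorem HasOrder.unique {χ : RatFunc ℂ} {m n : ℕ} (h : HasOrder χ m) (h' : HasOrder χ n) : m = n :=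
  le_antisymm (h'.le h) (h.le h')

theorem HasOrder.comp {f χ : RatFunc ℂ} {m n : ℕ} (T : RatFunc ℂ →ₐ[ℂ] RatFunc ℂ)
    (hTX : T RatFunc.X = χ) (hχ : HasOrder χ m) (hm : 0 < m) (hf : HasOrder f n) :
    HasOrder (T f) (m * n) := by
  have h0 := hχ.hasVal hm
  obtain ⟨v, c, hc, hv, rfl⟩ := hχ
  obtain ⟨w, d, hd, hw, rfl⟩ := hf
  refine ⟨v ^ n * T w, c ^ n * d, mul_ne_zero (pow_ne_zero _ hc) hd,
    (hv.pow n).mul (hw.comp T (by rwa [hTX])), ?_⟩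
  rw [map_mul, map_pow, hTX]; ring

/-! ### Local behaviour of the invariant under pull-back -/

theorem ratD_X_pow (m : ℕ) :
    ratD (RatFunc.X ^ m) * RatFunc.X = (m : RatFunc ℂ) * RatFunc.X ^ m := by
  rw [Derivation.leibniz_pow, ratD_X]
  cases m with
  | zero => simp
  | succ m => simp [pow_succ]; ring

/-- The local expansion of a pull-back along `χ = x ^ m v`.  Here `g = v' / v` and
`L = x χ' / χ`. -/
theorem pullInv_expansion {A χ v R : RatFunc ℂ} {m : ℕ} (hm : 0 < m) (hχ : χ = RatFunc.X ^ m * v)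
    {c : ℂ} (hc : c ≠ 0) (hv : HasVal v c) (T : RatFunc ℂ →ₐ[ℂ] RatFunc ℂ) (hTX : T RatFunc.X = χ)
    (hT : ∀ f, ratComp f χ = T f) (a : RatFunc ℂ) (ha : T a = a)
    (hR : RatFunc.X ^ 2 * A = a + RatFunc.X * R) :
    ∃ L r1 r2, HasVal L m ∧ Reg r1 ∧ Reg r2 ∧
      RatFunc.X ^ 2 * pullInv A χ = L ^ 2 * (a + χ * T R) + (1 - (m : RatFunc ℂ) ^ 2) / 4
        + RatFunc.X * r1 ∧
      pullInv A χ = (a + (1 / (m : RatFunc ℂ) ^ 2 - 1) / 4) * (L / RatFunc.X) ^ 2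
        + L ^ 2 * (χ * T R / RatFunc.X ^ 2) + r2 := by
  have hv0 : v ≠ 0 := hv.ne_zero hc
  have hX0 : (RatFunc.X : RatFunc ℂ) ≠ 0 := RatFunc.X_ne_zero
  have hm0 : (m : RatFunc ℂ) ≠ 0 := Nat.cast_ne_zero.2 hm.ne'
  obtain ⟨g, hg⟩ : ∃ g, g = ratD v / v := ⟨_, rfl⟩
  have hgr : Reg g := by
    obtain ⟨b, hb⟩ := hv.reg.ratD
    rw [hg]; exact (hb.div hv hc).reg
  obtain ⟨L, hL⟩ : ∃ L, L = (m : RatFunc ℂ) + RatFunc.X * g := ⟨_, rfl⟩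
  have hLv : HasVal L m := by simpa [hL] using (hasVal_natCast m).add hgr.hasVal_X_mul
  have hL0 : L ≠ 0 := hLv.ne_zero (Nat.cast_ne_zero.2 hm.ne')
  obtain ⟨l, hl⟩ : ∃ l, l = ratD L / L := ⟨_, rfl⟩
  have hlr : Reg l := by
    obtain ⟨b, hb⟩ := hLv.reg.ratD
    rw [hl]; exact (hb.div hLv (Nat.cast_ne_zero.2 hm.ne')).reg
  have hχ0 : χ ≠ 0 := by rw [hχ]; exact mul_ne_zero (pow_ne_zero _ hX0) hv0
  have hdv : ratD v = g * v := by rw [hg, div_mul_cancel₀ _ hv0]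
  have hdL : ratD L = l * L := by rw [hl, div_mul_cancel₀ _ hL0]
  have hdL' : ratD L = g + RatFunc.X * ratD g := by
    rw [hL, map_add, ratD_mul, ratD_X, Derivation.map_natCast]; ring
  have hd1 : ratD χ = L * χ / RatFunc.X := by
    rw [eq_div_iff hX0, hχ, ratD_mul, hdv]
    linear_combination v * ratD_X_pow m - RatFunc.X ^ m * v * hL
  have hN : ratD (ratD χ) / ratD χ = ((m : RatFunc ℂ) - 1) / RatFunc.X + (g + l) := by
    have h2 : ratD (ratD χ) =
        (RatFunc.X * (L * (L * χ / RatFunc.X) + χ * (l * L)) - L * χ) / RatFunc.X ^ 2 := by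
      conv_lhs => rw [hd1]
      rw [ratD_div, ratD_mul, hdL, hd1, ratD_X, mul_one]
    rw [h2, hd1, div_eq_iff (by positivity)]
    field_simp
    rw [hL]; ring
  have hdN : ratD (((m : RatFunc ℂ) - 1) / RatFunc.X + (g + l)) =
      -((m : RatFunc ℂ) - 1) / RatFunc.X ^ 2 + ratD (g + l) := by
    rw [map_add, ratD_div, ratD_X, map_sub, Derivation.map_natCast, Derivation.map_one_eq_zero]
    ring
  have hTA : χ ^ 2 * T A = a + χ * T R := by
    have := congrArg T hR
    simpa [hTX, ha] using this
  have hml : (m : RatFunc ℂ) * l = g + RatFunc.X * (ratD g - g * l) := by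
    have h1 : l * L = g + RatFunc.X * ratD g := by rw [← hdL, hdL']
    rw [hL] at h1
    linear_combination h1
  have hl2 : l = (g + RatFunc.X * (ratD g - g * l)) / (m : RatFunc ℂ) := by
    rw [eq_div_iff hm0, ← hml, mul_comm]
  have hpull : pullInv A χ = (L / RatFunc.X) ^ 2 * (a + χ * T R) +
      (-((m : RatFunc ℂ) - 1) / RatFunc.X ^ 2 + ratD (g + l) -
        (((m : RatFunc ℂ) - 1) / RatFunc.X + (g + l)) ^ 2 / 2) / 2 := by
    rw [pullInv, hN, hdN, hT, ← hTA, hd1]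
    field_simp
  refine ⟨L, -(((m : RatFunc ℂ) - 1) * (g + l)) / 2 +
      RatFunc.X * (ratD (g + l) / 2 - (g + l) ^ 2 / 4),
    ratD (g + l) / 2 - (g + l) ^ 2 / 4 + (1 - 1 / (m : RatFunc ℂ) ^ 2) / 4 * g ^ 2
      - ((m : RatFunc ℂ) - 1) / (2 * m) * (ratD g - g * l), hLv, ?_, ?_, ?_, ?_⟩
  · have hmr : Reg ((m : RatFunc ℂ) - 1) := ((hasVal_natCast m).sub hasVal_one).reg
    have h3 : Reg (-(((m : RatFunc ℂ) - 1) * (g + l)) / 2) := by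
      have := ((reg_C (-1)).mul (hmr.mul (hgr.add hlr))).div_ofNat 2
      simpa using this
    exact h3.add (reg_X.mul (((hgr.add hlr).ratD.div_ofNat 2).sub
      (((hgr.add hlr).pow 2).div_ofNat 4)))
  · have h4 : Reg ((1 - 1 / (m : RatFunc ℂ) ^ 2) / 4) := by
      have := reg_C ((1 - 1 / (m : ℂ) ^ 2) / 4)
      rwa [map_div₀, map_sub, map_one, map_div₀, map_one, map_pow, map_natCast, map_ofNat] at this
    have h5 : Reg (((m : RatFunc ℂ) - 1) / (2 * m)) := by
      simpa only [map_div₀, map_sub, map_one, map_mul, map_natCast, map_ofNat] using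
        reg_C (((m : ℂ) - 1) / (2 * m))
    exact ((((hgr.add hlr).ratD.div_ofNat 2).sub (((hgr.add hlr).pow 2).div_ofNat 4)).add
      (h4.mul (hgr.pow 2))).sub (h5.mul (hgr.ratD.sub (hgr.mul hlr)))
  · rw [hpull]
    field_simp
    ring
  · rw [hpull]
    have e1 : (a + χ * T R) * (L / RatFunc.X) ^ 2 = a * (L / RatFunc.X) ^ 2 +
      L ^ 2 * (χ * T R / RatFunc.X ^ 2) := by ring
    have e2 : (1 / (m : RatFunc ℂ) ^ 2 - 1) / 4 * (L / RatFunc.X) ^ 2 =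
      (1 / (m : RatFunc ℂ) ^ 2 - 1) / 4 * ((m : RatFunc ℂ) / RatFunc.X + g) ^ 2 := by
      rw [hL]; field_simp
    rw [mul_comm, e1, add_mul, e2]
    obtain ⟨h, hh⟩ : ∃ h, h = ratD g - g * l := ⟨_, rfl⟩
    rw [← hh] at hl2 ⊢
    obtain ⟨G, hG⟩ : ∃ G, G = ratD (g + l) := ⟨_, rfl⟩
    rw [← hG]
    have e3 : (((m : RatFunc ℂ) - 1) / RatFunc.X + (g + l)) ^ 2 =
        (((m : RatFunc ℂ) - 1) / RatFunc.X) ^ 2 +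
          2 * (((m : RatFunc ℂ) - 1) / RatFunc.X) *
            (g + (g + RatFunc.X * h) / (m : RatFunc ℂ)) + (g + l) ^ 2 := by
      rw [← hl2]; ring
    rw [e3]
    field_simp
    ring

/-- A double pole with the exponent difference `e` becomes a double pole with the exponent
difference `m e` under a substitution of order `m`; in terms of the leading coefficient
`a = (1 - e²) / 4`. -/
theorem HasVal.pullInv {A χ : RatFunc ℂ} {a : ℂ} (hA : HasVal (RatFunc.X ^ 2 * A) a) {m : ℕ}
    (hm : 0 < m) (hχ : HasOrder χ m) :
    HasVal (RatFunc.X ^ 2 * pullInv A χ) (m ^ 2 * a + (1 - m ^ 2) / 4) := by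
  obtain ⟨T, hTX, hT⟩ := (hχ.nonconst hm).exists_hom
  have hχ0 := hχ.hasVal hm
  obtain ⟨v, c, hc, hv, hχv⟩ := hχ
  obtain ⟨R, hR, hAR⟩ := HasVal.exists_eq_X_mul (f := RatFunc.X ^ 2 * A - RatFunc.C a)
    (by simpa using hA.sub (hasVal_C a))
  obtain ⟨L, r1, r2, hL, hr1, -, h1, -⟩ := pullInv_expansion (A := A) (R := R) hm hχv hc hv T
    hTX hT (RatFunc.C a) (algHom_C T a) (by rw [← hAR]; ring)
  obtain ⟨b, hR⟩ := hR
  rw [h1]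
  have hTR := hR.comp T (by rw [hTX]; exact hχ0)
  have h4 := ((hasVal_one.sub ((hasVal_natCast m).pow 2)).div (hasVal_ofNat 4)
    (OfNat.ofNat_ne_zero 4))
  have := (((hL.pow 2).mul ((hasVal_C a).add (hχ0.mul hTR))).add h4).add hr1.hasVal_X_mul
  simpa only [zero_mul, add_zero] using this

/-- A singularity with the exponent difference `1 / m`, not logarithmic if `m = 1`, disappears under
a substitution of order `m`. -/
theorem reg_pullInv {A χ : RatFunc ℂ} {m : ℕ} (hm : 0 < m) (hχ : HasOrder χ m)
    (hA : HasVal (RatFunc.X ^ 2 * A) ((1 - 1 / m ^ 2) / 4)) (h1 : m = 1 → Reg A) :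
    Reg (pullInv A χ) := by
  obtain ⟨T, hTX, hT⟩ := (hχ.nonconst hm).exists_hom
  have hχ0 := hχ.hasVal hm
  obtain ⟨v, c, hc, hv, hχv⟩ := hχ
  set a : ℂ := (1 - 1 / (m : ℂ) ^ 2) / 4 with ha
  obtain ⟨R, hR, hAR⟩ := HasVal.exists_eq_X_mul (f := RatFunc.X ^ 2 * A - RatFunc.C a)
    (by simpa using hA.sub (hasVal_C a))
  obtain ⟨L, r1, r2, hL, -, hr2, -, h2⟩ := pullInv_expansion (A := A) (R := R) hm hχv hc hv T
    hTX hT (RatFunc.C a) (algHom_C T a) (by rw [← hAR]; ring)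
  have hcancel : RatFunc.C a + (1 / (m : RatFunc ℂ) ^ 2 - 1) / 4 = 0 := by
    simp only [ha, map_div₀, map_sub, map_one, map_pow, map_natCast, map_ofNat]; ring
  rw [h2, hcancel, zero_mul, zero_add]
  refine Reg.add (Reg.mul (hL.reg.pow 2) ?_) hr2
  obtain rfl | hm1 := eq_or_ne m 1
  · have hRA : R = RatFunc.X * A := by
      refine mul_left_cancel₀ RatFunc.X_ne_zero (hAR.symm.trans ?_)
      simp [ha]; ring
    obtain ⟨b, hb⟩ := h1 rfl
    have : χ * T R / RatFunc.X ^ 2 = v ^ 2 * T A := by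
      rw [hRA, map_mul, hTX, hχv]
      field_simp [RatFunc.X_ne_zero (K := ℂ)]
    rw [this]
    exact (hv.reg.pow 2).mul (hb.comp T (by rw [hTX]; exact hχ0)).reg
  · obtain ⟨k, rfl⟩ := Nat.exists_eq_add_of_le (show 2 ≤ m by omega)
    obtain ⟨b, hb⟩ := hR
    have : χ * T R / RatFunc.X ^ 2 = RatFunc.X ^ k * v * T R := by
      rw [hχv, pow_add]
      field_simp [RatFunc.X_ne_zero (K := ℂ)]
    rw [this]
    exact ((reg_X.pow k).mul hv.reg).mul (hb.comp T (by rw [hTX]; exact hχ0)).reg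

/-- A local coordinate change does not remove a singularity. -/
theorem reg_of_reg_pullInv {A χ : RatFunc ℂ} (hχ : HasOrder χ 1) (h : Reg (pullInv A χ)) :
    Reg A := by
  obtain ⟨T, hTX, hT⟩ := (hχ.nonconst one_pos).exists_hom
  have hχ0 := hχ.hasVal one_pos
  obtain ⟨v, c, hc, hv, hχv⟩ := hχ
  obtain ⟨L, r1, r2, hL, -, hr2, -, h2⟩ := pullInv_expansion (A := A) one_pos hχv hc hv T hTX hT 0
    (map_zero T) (R := RatFunc.X * A) (by ring)
  have hLv : Reg (L ^ 2 * v ^ 2)⁻¹ :=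
    (((hL.pow 2).mul (hv.pow 2)).inv (by simp [hc])).reg
  have h3 : T A = (L ^ 2 * v ^ 2)⁻¹ * (pullInv A χ - r2) := by
    have hL0 : L ≠ 0 := hL.ne_zero (by simp)
    have hv0 : v ≠ 0 := hv.ne_zero hc
    have : χ * T (RatFunc.X * A) / RatFunc.X ^ 2 = v ^ 2 * T A := by
      rw [map_mul, hTX, hχv]
      field_simp [RatFunc.X_ne_zero (K := ℂ)]
    rw [h2, this]
    field_simp
    simp
    ring
  have hTA : Reg (T A) := by rw [h3]; exact hLv.mul (h.sub hr2)
  rcases reg_or_hasVal_inv A with hA | hA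
  · exact hA
  by_cases hA0 : A = 0
  · rw [hA0]; exact hasVal_zero.reg
  have h4 := hA.comp T (by rw [hTX]; exact hχ0)
  rw [map_inv₀] at h4
  exact absurd hTA (not_reg_of_hasVal_inv ((map_ne_zero T).2 hA0) h4)

/-! ### Charts of the projective line and branching indices -/

/-- A fractional-linear chart that carries `0` to the point `s`. -/
def chart (s : OnePoint ℂ) : RatFunc ℂ :=
  s.elim RatFunc.X⁻¹ (fun c : ℂ => RatFunc.X + RatFunc.C c)

theorem chart_infty : chart OnePoint.infty = RatFunc.X⁻¹ := rfl

theorem chart_coe (c : ℂ) : chart (c : OnePoint ℂ) = RatFunc.X + RatFunc.C c := rfl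

theorem nonconst_chart (s : OnePoint ℂ) : Nonconst (chart s) := by
  induction s using OnePoint.rec with
  | infty => exact nonconst_X_inv
  | coe c => exact nonconst_X_add_C c

/-- The projective connection with the invariant `A` has no singularity at `s`. -/
def RegAt (A : RatFunc ℂ) (s : OnePoint ℂ) : Prop := Reg (pullInv A (chart s))

/-- The projective connection with the invariant `A` has at most a double pole at `s`, with the
leading coefficient `a`.  The coefficient is `(1 - e²) / 4` if `e` is the exponent difference. -/
def CoeffAt (A : RatFunc ℂ) (s : OnePoint ℂ) (a : ℂ) : Prop :=
  HasVal (RatFunc.X ^ 2 * pullInv A (chart s)) a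

/-- The map `φ` carries the point `s` to `z` with the branching index `m`. -/
def RamAt (φ : RatFunc ℂ) (s z : OnePoint ℂ) (m : ℕ) : Prop :=
  0 < m ∧ ∃ χ, HasOrder χ m ∧ ratComp φ (chart s) = ratComp (chart z) χ

theorem ratComp_chart_coe (c : ℂ) {χ : RatFunc ℂ} (hχ : Nonconst χ) :
    ratComp (chart c) χ = χ + RatFunc.C c := by
  obtain ⟨T, hTX, hT⟩ := hχ.exists_hom
  rw [hT, chart_coe, map_add, hTX, algHom_C]

theorem ratComp_chart_infty {χ : RatFunc ℂ} (hχ : Nonconst χ) :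
    ratComp (chart OnePoint.infty) χ = χ⁻¹ := by
  obtain ⟨T, hTX, hT⟩ := hχ.exists_hom
  rw [hT, chart_infty, map_inv₀, hTX]

theorem RamAt.unique {φ : RatFunc ℂ} {s z z' : OnePoint ℂ} {m m' : ℕ} (h : RamAt φ s z m)
    (h' : RamAt φ s z' m') : z = z' ∧ m = m' := by
  obtain ⟨hm, χ, hχ, h⟩ := h
  obtain ⟨hm', χ', hχ', h'⟩ := h'
  rw [h] at h'
  have key : ∀ {ξ ξ' : RatFunc ℂ} {n n' : ℕ} {c : ℂ}, HasOrder ξ n → 0 < n → HasOrder ξ' n' →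
      0 < n' → ξ + RatFunc.C c ≠ ξ'⁻¹ := by
    intro ξ ξ' n n' c hξ hn hξ' hn' heq
    refine not_reg_of_hasVal_inv (inv_ne_zero hξ'.ne_zero)
      (by rw [inv_inv]; exact hξ'.hasVal hn') ?_
    rw [← heq]; exact ((hξ.hasVal hn).add (hasVal_C c)).reg
  induction z using OnePoint.rec with
  | infty =>
    induction z' using OnePoint.rec with
    | infty =>
      rw [ratComp_chart_infty (hχ.nonconst hm), ratComp_chart_infty (hχ'.nonconst hm'),
        inv_inj] at h'
      subst h'
      exact ⟨rfl, hχ.unique hχ'⟩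
    | coe c =>
      rw [ratComp_chart_infty (hχ.nonconst hm), ratComp_chart_coe _ (hχ'.nonconst hm')] at h'
      exact absurd h'.symm (key hχ' hm' hχ hm)
  | coe c =>
    induction z' using OnePoint.rec with
    | infty =>
      rw [ratComp_chart_coe _ (hχ.nonconst hm), ratComp_chart_infty (hχ'.nonconst hm')] at h'
      exact absurd h' (key hχ hm hχ' hm')
    | coe d =>
      rw [ratComp_chart_coe _ (hχ.nonconst hm), ratComp_chart_coe _ (hχ'.nonconst hm')] at h'
      have h1 := (hχ.hasVal hm).add (hasVal_C c)
      rw [h'] at h1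
      have h2 := h1.unique ((hχ'.hasVal hm').add (hasVal_C d))
      rw [zero_add, zero_add] at h2
      subst h2
      have h3 := add_right_cancel h'
      subst h3
      exact ⟨rfl, hχ.unique hχ'⟩

theorem RamAt.comp {φ ψ : RatFunc ℂ} {s y z : OnePoint ℂ} {m n : ℕ}
    (hψ : Nonconst ψ) (h : RamAt ψ s y m) (h' : RamAt φ y z n) :
    RamAt (ratComp φ ψ) s z (m * n) := by
  obtain ⟨hm, χ, hχ, h⟩ := h
  obtain ⟨hn, ξ, hξ, h'⟩ := h'
  obtain ⟨T, hTX, hT⟩ := (hχ.nonconst hm).exists_hom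
  refine ⟨Nat.mul_pos hm hn, T ξ, HasOrder.comp T hTX hχ hm hξ, ?_⟩
  rw [ratComp_assoc φ hψ (nonconst_chart s), h, ← ratComp_assoc φ (nonconst_chart y)
    (hχ.nonconst hm), h', ratComp_assoc _ (hξ.nonconst hn) (hχ.nonconst hm), hT]

theorem pullInv_pullInv_chart (A : RatFunc ℂ) {φ χ : RatFunc ℂ} {s z : OnePoint ℂ}
    (hφ : Nonconst φ) (hχ : Nonconst χ) (h : ratComp φ (chart s) = ratComp (chart z) χ) :
    pullInv (pullInv A φ) (chart s) = pullInv (pullInv A (chart z)) χ := by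
  rw [pullInv_comp A hφ (nonconst_chart s), h, pullInv_comp A (nonconst_chart z) hχ]

/-- Exponent differences are multiplied by the branching index. -/
theorem CoeffAt.pullInv {A φ : RatFunc ℂ} {s z : OnePoint ℂ} {m : ℕ} {a : ℂ} (hφ : Nonconst φ)
    (h : RamAt φ s z m) (hA : CoeffAt A z a) :
    CoeffAt (pullInv A φ) s (m ^ 2 * a + (1 - m ^ 2) / 4) := by
  obtain ⟨hm, χ, hχ, h⟩ := h
  rw [CoeffAt, pullInv_pullInv_chart A hφ (hχ.nonconst hm) h]
  exact HasVal.pullInv hA hm hχ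

theorem CoeffAt.regAt_pullInv {A φ : RatFunc ℂ} {s z : OnePoint ℂ} {m : ℕ} (hφ : Nonconst φ)
    (h : RamAt φ s z m) (hA : CoeffAt A z ((1 - 1 / m ^ 2) / 4)) (h1 : m = 1 → RegAt A z) :
    RegAt (HeunPullback.pullInv A φ) s := by
  obtain ⟨hm, χ, hχ, h⟩ := h
  rw [RegAt, pullInv_pullInv_chart A hφ (hχ.nonconst hm) h]
  exact reg_pullInv hm hχ hA h1

theorem RegAt.coeffAt {A : RatFunc ℂ} {s : OnePoint ℂ} (h : RegAt A s) : CoeffAt A s 0 := by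
  have := Reg.hasVal_X_mul (reg_X.mul h)
  rwa [← mul_assoc, ← pow_two] at this

/-- At an unbranched point a singularity neither appears nor disappears. -/
theorem RamAt.regAt_pullInv_iff {A φ : RatFunc ℂ} {s z : OnePoint ℂ} (hφ : Nonconst φ)
    (h : RamAt φ s z 1) : RegAt (pullInv A φ) s ↔ RegAt A z := by
  refine ⟨fun hr => ?_, fun hr => CoeffAt.regAt_pullInv hφ h ?_ fun _ => hr⟩
  · obtain ⟨hm, χ, hχ, h⟩ := h
    rw [RegAt, pullInv_pullInv_chart A hφ (hχ.nonconst hm) h] at hr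
    exact reg_of_reg_pullInv hχ hr
  · simpa using hr.coeffAt

theorem CoeffAt.unique {A : RatFunc ℂ} {s : OnePoint ℂ} {a b : ℂ} (h : CoeffAt A s a)
    (h' : CoeffAt A s b) : a = b := HasVal.unique h h'

/-! ### Fibres -/

/-- The branching index of `φ` at `s`, if `s` lies above `z`, and `0` otherwise. -/
def fiberMult (φ : RatFunc ℂ) (z s : OnePoint ℂ) : ℕ :=
  s.elim (ratDegree φ - (fiberPoly φ z).natDegree) (fun c : ℂ => (fiberPoly φ z).rootMultiplicity c)

/-- The denominator that belongs to the numerator `fiberPoly φ z`: the quotient of the two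
polynomials is `φ - z`, or `1 / φ` if `z = ∞`. -/
def cofiberPoly (φ : RatFunc ℂ) (z : OnePoint ℂ) : ℂ[X] :=
  z.elim φ.num (fun _ => φ.denom)

theorem Nonconst.num_ne_zero {φ : RatFunc ℂ} (h : Nonconst φ) : φ.num ≠ 0 :=
  RatFunc.num_ne_zero h.ne_zero

theorem fiberPoly_infty (φ : RatFunc ℂ) : fiberPoly φ OnePoint.infty = φ.denom := rfl

theorem fiberPoly_coe (φ : RatFunc ℂ) (c : ℂ) :
    fiberPoly φ (c : OnePoint ℂ) = φ.num - C c * φ.denom := rfl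

theorem sub_C_eq_div (φ : RatFunc ℂ) (c : ℂ) :
    φ - RatFunc.C c = algebraMap ℂ[X] (RatFunc ℂ) (φ.num - C c * φ.denom) /
      algebraMap ℂ[X] (RatFunc ℂ) φ.denom := by
  have hd := RatFunc.algebraMap_ne_zero φ.denom_ne_zero
  rw [map_sub, map_mul, RatFunc.algebraMap_C, sub_div, mul_div_cancel_right₀ _ hd,
    RatFunc.num_div_denom]

theorem fiberPoly_ne_zero {φ : RatFunc ℂ} (h : Nonconst φ) (z : OnePoint ℂ) :
    fiberPoly φ z ≠ 0 := by
  induction z using OnePoint.rec with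
  | infty => exact φ.denom_ne_zero
  | coe c =>
    intro h0
    have := sub_C_eq_div φ c
    rw [← fiberPoly_coe, h0, map_zero, zero_div] at this
    exact h.sub_C_ne_zero c this

theorem cofiberPoly_ne_zero {φ : RatFunc ℂ} (h : Nonconst φ) (z : OnePoint ℂ) :
    cofiberPoly φ z ≠ 0 := by
  induction z using OnePoint.rec with
  | infty => exact h.num_ne_zero
  | coe c => exact φ.denom_ne_zero

theorem isCoprime_fiberPoly (φ : RatFunc ℂ) (z : OnePoint ℂ) :
    IsCoprime (fiberPoly φ z) (cofiberPoly φ z) := by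
  induction z using OnePoint.rec with
  | infty => exact (RatFunc.isCoprime_num_denom φ).symm
  | coe c =>
    have := (RatFunc.isCoprime_num_denom φ).add_mul_right_left (-C c)
    rwa [neg_mul, ← sub_eq_add_neg] at this

theorem natDegree_fiberPoly_le (φ : RatFunc ℂ) (z : OnePoint ℂ) :
    (fiberPoly φ z).natDegree ≤ ratDegree φ := by
  induction z using OnePoint.rec with
  | infty => exact le_max_right _ _
  | coe c =>
    refine (natDegree_sub_le _ _).trans (max_le_max le_rfl ?_)
    exact natDegree_C_mul_le c _

theorem natDegree_cofiberPoly {φ : RatFunc ℂ} {z : OnePoint ℂ}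
    (h : (fiberPoly φ z).natDegree < ratDegree φ) :
    (cofiberPoly φ z).natDegree = ratDegree φ := by
  induction z using OnePoint.rec with
  | infty =>
    rw [fiberPoly_infty, ratDegree] at h
    change φ.num.natDegree = max _ _
    omega
  | coe c =>
    change φ.denom.natDegree = ratDegree φ
    by_contra hne
    have h1 : φ.denom.natDegree < φ.num.natDegree := by
      rw [ratDegree] at hne; omega
    have h2 : (C c * φ.denom).natDegree < φ.num.natDegree :=
      (natDegree_C_mul_le c _).trans_lt h1
    rw [fiberPoly_coe, natDegree_sub_eq_left_of_natDegree_lt h2, ratDegree] at h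
    omega

/-- Above `z`, the function `φ` is the local chart of the quotient of the two polynomials. -/
theorem algHom_eq_ratComp_chart {φ : RatFunc ℂ} (z : OnePoint ℂ)
    (T : RatFunc ℂ →ₐ[ℂ] RatFunc ℂ) (hq : Nonconst (T (algebraMap ℂ[X] (RatFunc ℂ) (fiberPoly φ z) /
      algebraMap ℂ[X] (RatFunc ℂ) (cofiberPoly φ z)))) :
    T φ = ratComp (chart z) (T (algebraMap ℂ[X] (RatFunc ℂ) (fiberPoly φ z) /
      algebraMap ℂ[X] (RatFunc ℂ) (cofiberPoly φ z))) := by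
  induction z using OnePoint.rec with
  | infty =>
    rw [ratComp_chart_infty hq, ← map_inv₀, inv_div]
    change T φ = T (algebraMap ℂ[X] (RatFunc ℂ) φ.num / algebraMap ℂ[X] (RatFunc ℂ) φ.denom)
    rw [RatFunc.num_div_denom]
  | coe c =>
    rw [ratComp_chart_coe _ hq]
    change T φ = T (algebraMap ℂ[X] (RatFunc ℂ) (φ.num - C c * φ.denom) /
      algebraMap ℂ[X] (RatFunc ℂ) φ.denom) + RatFunc.C c
    rw [← sub_C_eq_div, map_sub, algHom_C, sub_add_cancel]

theorem hasVal_algHom_algebraMap {T : RatFunc ℂ →ₐ[ℂ] RatFunc ℂ} {c : ℂ}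
    (hT : HasVal (T RatFunc.X) c) (p : ℂ[X]) :
    HasVal (T (algebraMap ℂ[X] (RatFunc ℂ) p)) (p.eval c) := by
  induction p using Polynomial.induction_on' with
  | add p q hp hq => simpa using hp.add hq
  | monomial n a =>
    rw [RatFunc.algebraMap_monomial, map_mul, map_pow, algHom_C]
    simpa using (hasVal_C a).mul (hT.pow n)

theorem algHom_X_inv {T : RatFunc ℂ →ₐ[ℂ] RatFunc ℂ} (hT : T RatFunc.X = RatFunc.X⁻¹) (p : ℂ[X]) :
    T (algebraMap ℂ[X] (RatFunc ℂ) p) * RatFunc.X ^ p.natDegree =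
      algebraMap ℂ[X] (RatFunc ℂ) p.reverse := by
  rw [algHom_algebraMap, hT, ← RatFunc.aeval_X_left_eq_algebraMap]
  let _ : Invertible (RatFunc.X⁻¹ : RatFunc ℂ) :=
    invertibleOfNonzero (inv_ne_zero RatFunc.X_ne_zero)
  have h := eval₂_reverse_mul_pow (algebraMap ℂ (RatFunc ℂ)) (RatFunc.X⁻¹) p
  rw [invOf_eq_inv, inv_inv] at h
  rw [aeval_def, aeval_def, ← h, mul_assoc, ← mul_pow, inv_mul_cancel₀ RatFunc.X_ne_zero, one_pow,
    mul_one]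

/-- The multiplicity of a root of the polynomial of the fibre is the branching index in the sense of
local charts. -/
theorem ramAt_fiberMult {φ : RatFunc ℂ} (h : Nonconst φ) {z s : OnePoint ℂ}
    (hs : 0 < fiberMult φ z s) : RamAt φ s z (fiberMult φ z s) := by
  obtain ⟨T, hTX, hT⟩ := (nonconst_chart s).exists_hom
  have hF := fiberPoly_ne_zero h z
  have hG := cofiberPoly_ne_zero h z
  have hord : HasOrder (T (algebraMap ℂ[X] (RatFunc ℂ) (fiberPoly φ z) /
      algebraMap ℂ[X] (RatFunc ℂ) (cofiberPoly φ z))) (fiberMult φ z s) := by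
    rw [map_div₀]
    induction s using OnePoint.rec with
    | infty =>
      have hTX' : T RatFunc.X = RatFunc.X⁻¹ := hTX
      have hlt : (fiberPoly φ z).natDegree < ratDegree φ := Nat.lt_of_sub_pos hs
      have hd := natDegree_cofiberPoly hlt
      have h1 := algHom_X_inv hTX' (fiberPoly φ z)
      have h2 := algHom_X_inv hTX' (cofiberPoly φ z)
      have v1 := hasVal_algebraMap (fiberPoly φ z).reverse
      have v2 := hasVal_algebraMap (cofiberPoly φ z).reverse
      rw [← coeff_zero_eq_eval_zero, coeff_zero_reverse] at v1 v2
      have l1 := leadingCoeff_ne_zero.2 hF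
      have l2 := leadingCoeff_ne_zero.2 hG
      refine ⟨_, _, div_ne_zero l1 l2, v1.div v2 l2, ?_⟩
      change _ = RatFunc.X ^ (ratDegree φ - (fiberPoly φ z).natDegree) * _
      rw [← h1, ← h2, hd, mul_div_mul_comm, mul_left_comm,
        pow_sub₀ _ RatFunc.X_ne_zero hlt.le]
      have hX : (RatFunc.X : RatFunc ℂ) ≠ 0 := RatFunc.X_ne_zero
      field_simp
    | coe c =>
      have hTX' : T RatFunc.X = RatFunc.X + RatFunc.C c := hTX
      have hv : HasVal (T RatFunc.X) c := by simpa [hTX'] using hasVal_X.add (hasVal_C c)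
      obtain ⟨G, hG1, hG2⟩ := exists_eq_pow_rootMultiplicity_mul_and_not_dvd _ hF c
      have hGc : G.eval c ≠ 0 := by rwa [dvd_iff_isRoot] at hG2
      have hFc : (fiberPoly φ z).eval c = 0 :=
        (rootMultiplicity_pos hF).1 hs
      have hcc : (cofiberPoly φ z).eval c ≠ 0 := by
        intro h0
        obtain ⟨u, v, huv⟩ := isCoprime_fiberPoly φ z
        have := congrArg (eval c) huv
        simp [h0, hFc] at this
      refine ⟨_, _, div_ne_zero hGc hcc, (hasVal_algHom_algebraMap hv G).div
        (hasVal_algHom_algebraMap hv (cofiberPoly φ z)) hcc, ?_⟩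
      change _ = RatFunc.X ^ ((fiberPoly φ z).rootMultiplicity c) * _
      conv_lhs => rw [hG1]
      rw [map_mul, map_mul, map_pow, map_sub, RatFunc.algebraMap_X, RatFunc.algebraMap_C, map_pow,
        map_sub, algHom_C, hTX', add_sub_cancel_right, mul_div_assoc]
  refine ⟨hs, _, hord, ?_⟩
  rw [hT]
  exact algHom_eq_ratComp_chart z T (hord.nonconst hs)

theorem exists_fiberMult_pos {φ : RatFunc ℂ} (h : Nonconst φ) (s : OnePoint ℂ) :
    ∃ z, 0 < fiberMult φ z s := by
  induction s using OnePoint.rec with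
  | infty =>
    by_cases hd : φ.denom.natDegree < ratDegree φ
    · exact ⟨OnePoint.infty, Nat.sub_pos_of_lt hd⟩
    · have hd' : φ.denom.natDegree = ratDegree φ := le_antisymm (le_max_right _ _) (not_lt.1 hd)
      refine ⟨((φ.num.coeff (ratDegree φ) : ℂ) : OnePoint ℂ), Nat.sub_pos_of_lt ?_⟩
      refine lt_of_le_of_ne (natDegree_fiberPoly_le _ _) fun heq => ?_
      have h1 := leadingCoeff_ne_zero.2 (fiberPoly_ne_zero h (φ.num.coeff (ratDegree φ) : ℂ))
      rw [leadingCoeff, heq, fiberPoly_coe, coeff_sub, coeff_C_mul] at h1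
      have h2 := RatFunc.monic_denom φ
      rw [Monic, leadingCoeff, hd'] at h2
      rw [h2, mul_one, sub_self] at h1
      exact h1 rfl
  | coe c =>
    by_cases hd : φ.denom.eval c = 0
    · exact ⟨OnePoint.infty, (rootMultiplicity_pos (fiberPoly_ne_zero h _)).2 hd⟩
    · refine ⟨((φ.num.eval c / φ.denom.eval c : ℂ) : OnePoint ℂ),
        (rootMultiplicity_pos (fiberPoly_ne_zero h _)).2 ?_⟩
      simp [IsRoot, fiberPoly_coe, hd]

open Classical in
/-- The point of the projective line to which `φ` carries `s`. -/
def img (φ : RatFunc ℂ) (s : OnePoint ℂ) : OnePoint ℂ :=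
  if h : ∃ z, 0 < fiberMult φ z s then h.choose else OnePoint.infty

/-- The branching index of `φ` at `s`. -/
def ramIdx (φ : RatFunc ℂ) (s : OnePoint ℂ) : ℕ := fiberMult φ (img φ s) s

section

variable {φ ψ : RatFunc ℂ} {s y z : OnePoint ℂ} {m : ℕ}

theorem ramIdx_pos (h : Nonconst φ) (s : OnePoint ℂ) : 0 < ramIdx φ s := by
  have h1 := exists_fiberMult_pos h s
  rw [ramIdx, img, dif_pos h1]
  exact h1.choose_spec

theorem ramAt_ramIdx (h : Nonconst φ) (s : OnePoint ℂ) : RamAt φ s (img φ s) (ramIdx φ s) :=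
  ramAt_fiberMult h (ramIdx_pos h s)

theorem RamAt.img_eq (h : Nonconst φ) (hr : RamAt φ s z m) : img φ s = z :=
  ((ramAt_ramIdx h s).unique hr).1

theorem RamAt.ramIdx_eq (h : Nonconst φ) (hr : RamAt φ s z m) : ramIdx φ s = m :=
  ((ramAt_ramIdx h s).unique hr).2

theorem fiberMult_pos_iff (h : Nonconst φ) : 0 < fiberMult φ z s ↔ img φ s = z := by
  refine ⟨fun hp => (ramAt_fiberMult h hp).img_eq h, ?_⟩
  rintro rfl
  exact ramIdx_pos h s

theorem fiberMult_of_img_eq (h : img φ s = z) : fiberMult φ z s = ramIdx φ s := by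
  rw [ramIdx, h]

theorem img_comp (hφ : Nonconst φ) (hψ : Nonconst ψ) (s : OnePoint ℂ) :
    img (ratComp φ ψ) s = img φ (img ψ s) :=
  ((ramAt_ramIdx hψ s).comp hψ (ramAt_ramIdx hφ _)).img_eq (hφ.comp hψ)

theorem ramIdx_comp (hφ : Nonconst φ) (hψ : Nonconst ψ) (s : OnePoint ℂ) :
    ramIdx (ratComp φ ψ) s = ramIdx ψ s * ramIdx φ (img ψ s) :=
  ((ramAt_ramIdx hψ s).comp hψ (ramAt_ramIdx hφ _)).ramIdx_eq (hφ.comp hψ)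

/-- The embedding of the affine line into the projective line. -/
def coeEmb : ℂ ↪ OnePoint ℂ := ⟨(↑), OnePoint.coe_injective⟩

theorem coeEmb_apply (c : ℂ) : coeEmb c = (c : OnePoint ℂ) := rfl

open Classical in
/-- The fibre of `φ` above `z`. -/
def fib (φ : RatFunc ℂ) (z : OnePoint ℂ) : Finset (OnePoint ℂ) :=
  (fiberPoly φ z).roots.toFinset.map coeEmb ∪
    if (fiberPoly φ z).natDegree < ratDegree φ then {OnePoint.infty} else ∅

open Classical in
theorem fib_disjoint (φ : RatFunc ℂ) (z : OnePoint ℂ) :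
    Disjoint ((fiberPoly φ z).roots.toFinset.map coeEmb)
      (if (fiberPoly φ z).natDegree < ratDegree φ then {OnePoint.infty} else ∅) := by
  split_ifs
  · simp [coeEmb_apply]
  · simp

theorem mem_fib (h : Nonconst φ) : s ∈ fib φ z ↔ img φ s = z := by
  classical
  rw [← fiberMult_pos_iff h, fib, Finset.mem_union]
  induction s using OnePoint.rec with
  | infty =>
    simp only [Finset.mem_map, coeEmb_apply, OnePoint.coe_ne_infty, and_false,
      exists_false, false_or, fiberMult]
    change _ ↔ 0 < ratDegree φ - _
    rw [tsub_pos_iff_lt]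
    split_ifs with h1 <;> simp [h1]
  | coe c =>
    have : (c : OnePoint ℂ) ∉ (if (fiberPoly φ z).natDegree < ratDegree φ then
        ({OnePoint.infty} : Finset (OnePoint ℂ)) else ∅) := by
      split_ifs <;> simp
    simp only [this, or_false, Finset.mem_map, coeEmb_apply, OnePoint.coe_eq_coe,
      exists_eq_right, Multiset.mem_toFinset]
    change _ ↔ 0 < rootMultiplicity c (fiberPoly φ z)
    rw [mem_roots (fiberPoly_ne_zero h z), rootMultiplicity_pos (fiberPoly_ne_zero h z)]

theorem fiberPartition_eq_map (φ : RatFunc ℂ) (z : OnePoint ℂ) :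
    fiberPartition φ z = (fib φ z).val.map (fiberMult φ z) := by
  classical
  rw [fib, ← Finset.disjUnion_eq_union _ _ (fib_disjoint φ z), Finset.disjUnion_val,
    Multiset.map_add, Finset.map_val, Multiset.map_map, fiberPartition, Multiset.toFinset_val]
  congr 1
  split_ifs <;> simp [fiberMult]

theorem fiberPartition_eq_map_ramIdx (h : Nonconst φ) (z : OnePoint ℂ) :
    fiberPartition φ z = (fib φ z).val.map (ramIdx φ) := by
  rw [fiberPartition_eq_map]
  exact Multiset.map_congr rfl fun s hs => fiberMult_of_img_eq ((mem_fib h).1 hs)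

/-- The branching indices in a fibre add up to the degree. -/
theorem sum_fib (h : Nonconst φ) (z : OnePoint ℂ) :
    ∑ s ∈ fib φ z, ramIdx φ s = ratDegree φ := by
  classical
  have h1 : ∑ s ∈ fib φ z, ramIdx φ s = ∑ s ∈ fib φ z, fiberMult φ z s :=
    Finset.sum_congr rfl fun s hs => (fiberMult_of_img_eq ((mem_fib h).1 hs)).symm
  rw [h1, fib, Finset.sum_union (fib_disjoint φ z), Finset.sum_map]
  have h2 : ∑ x ∈ (fiberPoly φ z).roots.toFinset, fiberMult φ z (coeEmb x) =
      (fiberPoly φ z).natDegree := by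
    rw [← IsAlgClosed.card_roots_eq_natDegree, ← Multiset.toFinset_sum_count_eq]
    refine Finset.sum_congr rfl fun x _ => ?_
    rw [count_roots]; rfl
  rw [h2]
  have h3 := natDegree_fiberPoly_le φ z
  split_ifs with hlt
  · rw [Finset.sum_singleton]
    change _ + (ratDegree φ - _) = _
    omega
  · rw [Finset.sum_empty]; omega

theorem sum_fiberPartition (h : Nonconst φ) (z : OnePoint ℂ) :
    (fiberPartition φ z).sum = ratDegree φ := by
  rw [fiberPartition_eq_map_ramIdx h, ← sum_fib h z]; rfl

theorem card_fiberPartition (φ : RatFunc ℂ) (z : OnePoint ℂ) :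
    Multiset.card (fiberPartition φ z) = (fib φ z).card := by
  rw [fiberPartition_eq_map, Multiset.card_map]; rfl

theorem fib_nonempty (h : Nonconst φ) (z : OnePoint ℂ) : ∃ s, img φ s = z := by
  by_contra! hne
  have h1 := sum_fib h z
  have : fib φ z = ∅ := Finset.eq_empty_of_forall_notMem fun s hs => hne s ((mem_fib h).1 hs)
  rw [this, Finset.sum_empty] at h1
  exact absurd (nonconst_iff.1 h) (by omega)

theorem ramIdx_le (h : Nonconst φ) (s : OnePoint ℂ) : ramIdx φ s ≤ ratDegree φ := by
  rw [← sum_fib h (img φ s)]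
  exact Finset.single_le_sum (f := ramIdx φ) (fun _ _ => Nat.zero_le _) ((mem_fib h).2 rfl)

/-- The degree is multiplicative: the branching indices in a fibre of the composition are products,
and the indices in each fibre add up to the degree. -/
theorem ratDegree_comp (hφ : Nonconst φ) (hψ : Nonconst ψ) :
    ratDegree (ratComp φ ψ) = ratDegree φ * ratDegree ψ := by
  classical
  have h := hφ.comp hψ
  rw [← sum_fib h OnePoint.infty, ← sum_fib hφ OnePoint.infty, Finset.sum_mul]
  have h1 : ∀ s ∈ fib (ratComp φ ψ) OnePoint.infty, img ψ s ∈ fib φ OnePoint.infty := by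
    intro s hs
    rw [mem_fib h, img_comp hφ hψ] at hs
    exact (mem_fib hφ).2 hs
  rw [← Finset.sum_fiberwise_of_maps_to h1]
  refine Finset.sum_congr rfl fun y hy => ?_
  have h2 : (fib (ratComp φ ψ) OnePoint.infty).filter (fun s => img ψ s = y) = fib ψ y := by
    ext s
    rw [Finset.mem_filter, mem_fib h, mem_fib hψ, img_comp hφ hψ]
    refine ⟨fun hs => hs.2, fun hs => ⟨?_, hs⟩⟩
    rw [hs]; exact (mem_fib hφ).1 hy
  rw [h2, ← sum_fib hψ y, Finset.mul_sum]
  refine Finset.sum_congr rfl fun s hs => ?_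
  rw [ramIdx_comp hφ hψ, (mem_fib hψ).1 hs, mul_comm]

/-! ### The Riemann–Hurwitz formula -/

/-- The numerator of the derivative of `φ`, whose zeros are the branching points. -/
def wronsk (φ : RatFunc ℂ) : ℂ[X] := derivative φ.num * φ.denom - φ.num * derivative φ.denom

/-- Up to a factor, the Wronskian does not depend on the coordinate of the target: it may be
computed with the numerator and the denominator that belong to any point `z`. -/
theorem wronsk_eq (φ : RatFunc ℂ) (z : OnePoint ℂ) : ∃ u : ℂ, u ≠ 0 ∧ wronsk φ =
    C u * (derivative (fiberPoly φ z) * cofiberPoly φ z -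
      fiberPoly φ z * derivative (cofiberPoly φ z)) := by
  induction z using OnePoint.rec with
  | infty =>
    refine ⟨-1, by norm_num, ?_⟩
    change derivative φ.num * φ.denom - φ.num * derivative φ.denom =
      C (-1) * (derivative φ.denom * φ.num - φ.denom * derivative φ.num)
    simp; ring
  | coe c =>
    refine ⟨1, one_ne_zero, ?_⟩
    change derivative φ.num * φ.denom - φ.num * derivative φ.denom =
      C 1 * (derivative (φ.num - C c * φ.denom) * φ.denom - (φ.num - C c * φ.denom) *
        derivative φ.denom)
    simp; ring

theorem rootMultiplicity_of_eq {p G : ℂ[X]} {c : ℂ} {n : ℕ} (h : p = (X - C c) ^ n * G)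
    (hG : G.eval c ≠ 0) : p.rootMultiplicity c = n := by
  have hp : p ≠ 0 := by
    rw [h]; exact mul_ne_zero (pow_ne_zero _ (X_sub_C_ne_zero c)) (ne_zero_of_eval_ne_zero hG)
  rw [h, rootMultiplicity_mul (h ▸ hp), rootMultiplicity_X_sub_C_pow,
    rootMultiplicity_eq_zero hG, add_zero]

theorem rootMultiplicity_wronsk (h : Nonconst φ) (c : ℂ) :
    (wronsk φ).rootMultiplicity c + 1 = ramIdx φ (c : OnePoint ℂ) := by
  set z := img φ (c : OnePoint ℂ) with hz
  obtain ⟨u, hu, hW⟩ := wronsk_eq φ z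
  have hF := fiberPoly_ne_zero h z
  have hm := ramIdx_pos h (c : OnePoint ℂ)
  have hm' : ramIdx φ (c : OnePoint ℂ) = (fiberPoly φ z).rootMultiplicity c := rfl
  obtain ⟨G, hG1, hG2⟩ := exists_eq_pow_rootMultiplicity_mul_and_not_dvd _ hF c
  rw [← hm'] at hG1
  have hGc : G.eval c ≠ 0 := by rwa [dvd_iff_isRoot] at hG2
  have hFc : (fiberPoly φ z).eval c = 0 := (rootMultiplicity_pos hF).1 (by rwa [← hm'])
  have hcc : (cofiberPoly φ z).eval c ≠ 0 := by
    intro h0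
    obtain ⟨a, b, hab⟩ := isCoprime_fiberPoly φ z
    have := congrArg (eval c) hab
    simp [h0, hFc] at this
  obtain ⟨n, hn⟩ := Nat.exists_eq_add_of_le' (Nat.one_le_iff_ne_zero.2 hm.ne')
  rw [hn] at hG1 ⊢
  rw [add_left_inj]
  refine rootMultiplicity_of_eq (G := C u * ((n + 1 : ℂ[X]) * G * cofiberPoly φ z +
    (X - C c) * (derivative G * cofiberPoly φ z - G * derivative (cofiberPoly φ z)))) ?_ ?_
  · rw [hW, hG1, derivative_mul, derivative_X_sub_C_pow]
    push_cast
    simp only [map_add, map_natCast, map_one]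
    ring
  · have : (n : ℂ) + 1 ≠ 0 := Nat.cast_add_one_ne_zero n
    simp [hu, hGc, hcc, this]

/-- The branching at `∞` lowers the degree of the Wronskian from its generic value `2 d - 2`. -/
theorem natDegree_wronsk (h : Nonconst φ) :
    (wronsk φ).natDegree + ramIdx φ OnePoint.infty + 1 = 2 * ratDegree φ := by
  set z := img φ OnePoint.infty with hz
  obtain ⟨u, hu, hW⟩ := wronsk_eq φ z
  have hF := fiberPoly_ne_zero h z
  have hG := cofiberPoly_ne_zero h z
  have hm := ramIdx_pos h OnePoint.infty
  have hm' : ramIdx φ OnePoint.infty = ratDegree φ - (fiberPoly φ z).natDegree := rfl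
  have hlt : (fiberPoly φ z).natDegree < ratDegree φ := by omega
  have hd := natDegree_cofiberPoly hlt
  set F := fiberPoly φ z
  set G := cofiberPoly φ z
  have hle : (derivative F * G - F * derivative G).natDegree ≤ F.natDegree + G.natDegree - 1 := by
    by_cases hF0 : F.natDegree = 0
    · rw [natDegree_eq_zero] at hF0
      obtain ⟨a, ha⟩ := hF0
      rw [← ha]
      simp only [derivative_C, zero_mul, zero_sub, natDegree_neg, natDegree_C, zero_add]
      exact (natDegree_C_mul_le _ _).trans (natDegree_derivative_le _)
    · refine (natDegree_sub_le _ _).trans (max_le ?_ ?_)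
      · refine natDegree_mul_le.trans ?_
        have := natDegree_derivative_le F
        omega
      · refine natDegree_mul_le.trans ?_
        have := natDegree_derivative_le G
        omega
  -- The leading terms of the two products do not cancel, since the degrees of `F` and `G` differ.
  have hcoeff :
      (derivative F * G - F * derivative G).coeff (F.natDegree + G.natDegree - 1) ≠ 0 := by
    have h1 : (derivative F * G).coeff (F.natDegree + G.natDegree - 1) =
        F.natDegree * F.leadingCoeff * G.leadingCoeff := by
      by_cases hF0 : F.natDegree = 0
      · have := derivative_eq_zero.2 hF0
        rw [this, hF0]; simp
      · have e : F.natDegree + G.natDegree - 1 = (F.natDegree - 1) + G.natDegree := by omega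
        rw [e, coeff_mul_add_eq_of_natDegree_le (natDegree_derivative_le F) le_rfl,
          coeff_derivative, Nat.sub_add_cancel (Nat.one_le_iff_ne_zero.2 hF0)]
        have : ((F.natDegree - 1 : ℕ) : ℂ) + 1 = F.natDegree := by
          exact_mod_cast Nat.sub_add_cancel (Nat.one_le_iff_ne_zero.2 hF0)
        rw [this]; simp only [leadingCoeff]; ring
    have h2 : (F * derivative G).coeff (F.natDegree + G.natDegree - 1) =
        G.natDegree * F.leadingCoeff * G.leadingCoeff := by
      have e : F.natDegree + G.natDegree - 1 = F.natDegree + (G.natDegree - 1) := by omega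
      rw [e, coeff_mul_add_eq_of_natDegree_le le_rfl (natDegree_derivative_le G),
          coeff_derivative, Nat.sub_add_cancel (by omega)]
      have : ((G.natDegree - 1 : ℕ) : ℂ) + 1 = G.natDegree := by
        exact_mod_cast Nat.sub_add_cancel (show 1 ≤ G.natDegree by omega)
      rw [this]; simp only [leadingCoeff]; ring
    rw [coeff_sub, h1, h2, ← sub_mul, ← sub_mul]
    refine mul_ne_zero (mul_ne_zero (sub_ne_zero.2 ?_) (leadingCoeff_ne_zero.2 hF))
      (leadingCoeff_ne_zero.2 hG)
    exact_mod_cast (by omega : F.natDegree ≠ G.natDegree)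
  have hdeg : (wronsk φ).natDegree = F.natDegree + G.natDegree - 1 := by
    rw [hW, natDegree_C_mul hu]
    exact le_antisymm hle (le_natDegree_of_ne_zero hcoeff)
  omega

theorem wronsk_ne_zero (h : Nonconst φ) : wronsk φ ≠ 0 := by
  intro h0
  have := h.ratD_ne_zero
  rw [ratD_apply, ratDeriv] at this
  change algebraMap ℂ[X] (RatFunc ℂ) (wronsk φ) / _ ≠ 0 at this
  rw [h0, map_zero, zero_div] at this
  exact this rfl

/-- The Riemann–Hurwitz formula for maps of the projective line to itself. -/
theorem riemannHurwitz (h : Nonconst φ) (U : Finset (OnePoint ℂ))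
    (hU : ∀ s ∉ U, ramIdx φ s = 1) : ∑ s ∈ U, (ramIdx φ s - 1) + 2 = 2 * ratDegree φ := by
  classical
  set R := (wronsk φ).roots.toFinset.map coeEmb with hR
  have hinf : OnePoint.infty ∉ R := by simp [hR, coeEmb_apply]
  have hR' : ∀ s ∉ insert OnePoint.infty R, ramIdx φ s = 1 := by
    intro s hs
    induction s using OnePoint.rec with
    | infty => exact absurd (Finset.mem_insert_self _ _) hs
    | coe c =>
      rw [← rootMultiplicity_wronsk h, Nat.add_eq_right, rootMultiplicity_eq_zero]
      intro h0
      refine hs (Finset.mem_insert_of_mem (Finset.mem_map_of_mem _ ?_))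
      rw [Multiset.mem_toFinset, mem_roots (wronsk_ne_zero h)]
      exact h0
  have h1 : ∑ s ∈ U, (ramIdx φ s - 1) = ∑ s ∈ insert OnePoint.infty R, (ramIdx φ s - 1) := by
    rw [Finset.sum_subset (s₂ := U ∪ insert OnePoint.infty R) Finset.subset_union_left
      fun s _ hs => by rw [hU s hs, Nat.sub_self],
      ← Finset.sum_subset (s₁ := insert OnePoint.infty R) (s₂ := U ∪ insert OnePoint.infty R)
        Finset.subset_union_right fun s _ hs => by rw [hR' s hs, Nat.sub_self]]
  rw [h1, Finset.sum_insert hinf, hR, Finset.sum_map]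
  have h2 : ∑ x ∈ (wronsk φ).roots.toFinset, (ramIdx φ (coeEmb x) - 1) = (wronsk φ).natDegree := by
    rw [← IsAlgClosed.card_roots_eq_natDegree, ← Multiset.toFinset_sum_count_eq]
    refine Finset.sum_congr rfl fun x _ => ?_
    rw [count_roots]
    have := rootMultiplicity_wronsk h x
    simp only [coeEmb_apply]
    omega
  rw [h2]
  have h3 := natDegree_wronsk h
  have h4 := ramIdx_pos h OnePoint.infty
  omega

theorem finite_ramified (h : Nonconst φ) :
    ∃ U : Finset (OnePoint ℂ), ∀ s, s ∈ U ↔ ramIdx φ s ≠ 1 := by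
  classical
  refine ⟨(insert OnePoint.infty ((wronsk φ).roots.toFinset.map
    coeEmb)).filter (fun s => ramIdx φ s ≠ 1), fun s => ?_⟩
  rw [Finset.mem_filter]
  refine ⟨fun hs => hs.2, fun hs => ⟨?_, hs⟩⟩
  induction s using OnePoint.rec with
  | infty => exact Finset.mem_insert_self _ _
  | coe c =>
    refine Finset.mem_insert_of_mem (Finset.mem_map_of_mem _ ?_)
    rw [Multiset.mem_toFinset, mem_roots (wronsk_ne_zero h)]
    by_contra h0
    have := rootMultiplicity_wronsk h c
    rw [rootMultiplicity_eq_zero h0] at this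
    exact hs this.symm

end

/-! ### Reading off images and branching indices -/

theorem exists_num_denom_eq {φ : RatFunc ℂ} {p q : ℂ[X]} (hpq : IsCoprime p q) (hq : q ≠ 0)
    (h : φ = algebraMap ℂ[X] (RatFunc ℂ) p / algebraMap ℂ[X] (RatFunc ℂ) q) :
    ∃ u : ℂ, u ≠ 0 ∧ φ.num = C u * p ∧ φ.denom = C u * q := by
  have key : φ.num * q = p * φ.denom := (RatFunc.num_mul_eq_mul_denom_iff hq).2 h
  obtain ⟨r, hr⟩ : q ∣ φ.denom := hpq.symm.dvd_of_dvd_mul_left (Dvd.intro_left _ key)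
  have hn : φ.num = p * r := by
    refine mul_right_cancel₀ hq ?_
    rw [key, hr]; ring
  have hu : IsUnit r := (RatFunc.isCoprime_num_denom φ).isUnit_of_dvd' ⟨p, by rw [hn]; ring⟩
    ⟨q, by rw [hr]; ring⟩
  obtain ⟨u, hu0, rfl⟩ := Polynomial.isUnit_iff.1 hu
  exact ⟨u, hu0.ne_zero, by rw [hn, mul_comm], by rw [hr, mul_comm]⟩

theorem ratDegree_of_eq_div {φ : RatFunc ℂ} {p q : ℂ[X]} (hpq : IsCoprime p q) (hq : q ≠ 0)
    (h : φ = algebraMap ℂ[X] (RatFunc ℂ) p / algebraMap ℂ[X] (RatFunc ℂ) q) :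
    ratDegree φ = max p.natDegree q.natDegree := by
  obtain ⟨u, hu, h1, h2⟩ := exists_num_denom_eq hpq hq h
  rw [ratDegree, h1, h2, natDegree_C_mul hu, natDegree_C_mul hu]

theorem ratDegree_algebraMap (p : ℂ[X]) :
    ratDegree (algebraMap ℂ[X] (RatFunc ℂ) p) = p.natDegree := by
  simp [ratDegree]

theorem img_coe_eq {φ : RatFunc ℂ} (h : Nonconst φ) {c d : ℂ}
    (hc : φ.num.eval c = d * φ.denom.eval c) : img φ c = d := by
  rw [← fiberMult_pos_iff h]
  refine (rootMultiplicity_pos (fiberPoly_ne_zero h _)).2 ?_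
  simp [IsRoot, fiberPoly_coe, hc]

theorem img_algebraMap_coe {p : ℂ[X]} (hp : 0 < p.natDegree) (c : ℂ) :
    img (algebraMap ℂ[X] (RatFunc ℂ) p) c = (p.eval c : ℂ) := by
  refine img_coe_eq (nonconst_iff.2 (by rwa [ratDegree_algebraMap])) ?_
  simp

theorem img_algebraMap_infty {p : ℂ[X]} (hp : 0 < p.natDegree) :
    img (algebraMap ℂ[X] (RatFunc ℂ) p) OnePoint.infty = OnePoint.infty := by
  have h : Nonconst (algebraMap ℂ[X] (RatFunc ℂ) p) :=
    nonconst_iff.2 (by rwa [ratDegree_algebraMap])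
  rw [← fiberMult_pos_iff h]
  change 0 < ratDegree _ - natDegree (RatFunc.denom _)
  simpa [ratDegree_algebraMap] using hp

theorem X_inv_eq : (RatFunc.X⁻¹ : RatFunc ℂ) =
    algebraMap ℂ[X] (RatFunc ℂ) 1 / algebraMap ℂ[X] (RatFunc ℂ) X := by
  rw [map_one, RatFunc.algebraMap_X, one_div]

theorem ratDegree_X_inv : ratDegree (RatFunc.X⁻¹ : RatFunc ℂ) = 1 := by
  rw [ratDegree_of_eq_div isCoprime_one_left X_ne_zero X_inv_eq]; simp

theorem img_X_inv_zero : img (RatFunc.X⁻¹ : RatFunc ℂ) ((0 : ℂ) : OnePoint ℂ) = OnePoint.infty := by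
  obtain ⟨u, hu, h1, h2⟩ := exists_num_denom_eq isCoprime_one_left X_ne_zero X_inv_eq
  rw [← fiberMult_pos_iff nonconst_X_inv]
  refine (rootMultiplicity_pos (fiberPoly_ne_zero nonconst_X_inv _)).2 ?_
  rw [fiberPoly_infty, h2]; simp

theorem img_X_inv_infty :
    img (RatFunc.X⁻¹ : RatFunc ℂ) OnePoint.infty = ((0 : ℂ) : OnePoint ℂ) := by
  obtain ⟨u, hu, h1, h2⟩ := exists_num_denom_eq isCoprime_one_left X_ne_zero X_inv_eq
  rw [← fiberMult_pos_iff nonconst_X_inv]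
  change 0 < ratDegree _ - natDegree _
  rw [ratDegree_X_inv, fiberPoly_coe, h1]
  simp

theorem img_chart_zero (s : OnePoint ℂ) : img (chart s) ((0 : ℂ) : OnePoint ℂ) = s := by
  induction s using OnePoint.rec with
  | infty => exact img_X_inv_zero
  | coe c =>
    rw [chart_coe, ← RatFunc.algebraMap_X, ← RatFunc.algebraMap_C, ← map_add, img_algebraMap_coe]
    · simp
    · simp

theorem X_sub_C_pow_dvd_fiberPoly (φ : RatFunc ℂ) {c : ℂ} {z : OnePoint ℂ} {m : ℕ}
    (hz : img φ c = z) (hm : m ≤ ramIdx φ c) : (X - C c) ^ m ∣ fiberPoly φ z := by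
  subst hz
  exact (pow_dvd_pow _ hm).trans (pow_rootMultiplicity_dvd _ c)

theorem natDegree_fiberPoly_add {φ : RatFunc ℂ} {z : OnePoint ℂ}
    (hz : img φ OnePoint.infty = z) :
    (fiberPoly φ z).natDegree + ramIdx φ OnePoint.infty = ratDegree φ := by
  subst hz
  have := natDegree_fiberPoly_le φ (img φ OnePoint.infty)
  change _ + (ratDegree φ - _) = _
  omega

/-! ### Fractional-linear transformations -/

section

variable {M N : RatFunc ℂ}

theorem IsMoebius.nonconst (h : IsMoebius M) : Nonconst M :=
  nonconst_iff.2 (by rw [h]; exact one_pos)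

theorem isMoebius_X : IsMoebius RatFunc.X := by simp [IsMoebius, ratDegree]

theorem isMoebius_chart (s : OnePoint ℂ) : IsMoebius (chart s) := by
  induction s using OnePoint.rec with
  | infty => exact ratDegree_X_inv
  | coe c =>
    rw [IsMoebius, chart_coe, ← RatFunc.algebraMap_X, ← RatFunc.algebraMap_C, ← map_add,
      ratDegree_algebraMap]
    simp

theorem IsMoebius.comp (hM : IsMoebius M) (hN : IsMoebius N) : IsMoebius (ratComp M N) := by
  rw [IsMoebius, ratDegree_comp hM.nonconst hN.nonconst, hM, hN]

theorem IsMoebius.ramIdx (h : IsMoebius M) (s : OnePoint ℂ) : ramIdx M s = 1 :=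
  le_antisymm ((ramIdx_le h.nonconst s).trans h.le) (ramIdx_pos h.nonconst s)

theorem IsMoebius.ramAt (h : IsMoebius M) (s : OnePoint ℂ) : RamAt M s (img M s) 1 := by
  have := ramAt_ramIdx h.nonconst s
  rwa [h.ramIdx] at this

theorem IsMoebius.bijective (h : IsMoebius M) : Function.Bijective (img M) := by
  refine ⟨fun s t hst => ?_, fun z => fib_nonempty h.nonconst z⟩
  have h1 := sum_fib h.nonconst (img M s)
  simp only [h.ramIdx, Finset.sum_const, smul_eq_mul, mul_one] at h1
  rw [h] at h1
  exact Finset.card_le_one.1 h1.le _ ((mem_fib h.nonconst).2 rfl) _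
    ((mem_fib h.nonconst).2 hst.symm)

theorem IsMoebius.ramIdx_comp_left {φ : RatFunc ℂ} (h : IsMoebius M) (hφ : Nonconst φ)
    (s : OnePoint ℂ) : HeunPullback.ramIdx (ratComp M φ) s = HeunPullback.ramIdx φ s := by
  rw [HeunPullback.ramIdx_comp h.nonconst hφ, h.ramIdx, mul_one]

theorem IsMoebius.ramIdx_comp_right {φ : RatFunc ℂ} (h : IsMoebius M) (hφ : Nonconst φ)
    (s : OnePoint ℂ) :
    HeunPullback.ramIdx (ratComp φ M) s = HeunPullback.ramIdx φ (img M s) := by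
  rw [HeunPullback.ramIdx_comp hφ h.nonconst, h.ramIdx, one_mul]

/-- There is a fractional-linear transformation that carries `0`, `1`, `∞` to given points. -/
theorem exists_moebius {s₀ s₁ s₂ : OnePoint ℂ} (h01 : s₀ ≠ s₁) (h02 : s₀ ≠ s₂) (h12 : s₁ ≠ s₂) :
    ∃ M, IsMoebius M ∧ img M ((0 : ℂ) : OnePoint ℂ) = s₀ ∧ img M ((1 : ℂ) : OnePoint ℂ) = s₁ ∧
      img M OnePoint.infty = s₂ := by
  have hi : IsMoebius (RatFunc.X⁻¹ : RatFunc ℂ) := ratDegree_X_inv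
  obtain ⟨N, hN⟩ : ∃ N, N = ratComp (chart s₂) RatFunc.X⁻¹ := ⟨_, rfl⟩
  have hNM : IsMoebius N := by rw [hN]; exact (isMoebius_chart s₂).comp hi
  have hN2 : img N OnePoint.infty = s₂ := by
    rw [hN, img_comp (nonconst_chart s₂) nonconst_X_inv, img_X_inv_infty, img_chart_zero]
  obtain ⟨y₀, hy₀⟩ := hNM.bijective.2 s₀
  obtain ⟨y₁, hy₁⟩ := hNM.bijective.2 s₁
  have hne₀ : y₀ ≠ OnePoint.infty := by rintro rfl; exact h02 (hy₀.symm.trans hN2)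
  have hne₁ : y₁ ≠ OnePoint.infty := by rintro rfl; exact h12 (hy₁.symm.trans hN2)
  obtain ⟨c₀, rfl⟩ := OnePoint.ne_infty_iff_exists.1 hne₀
  obtain ⟨c₁, rfl⟩ := OnePoint.ne_infty_iff_exists.1 hne₁
  have hc : c₁ - c₀ ≠ 0 := by
    intro h
    rw [sub_eq_zero] at h
    rw [h, hy₀] at hy₁
    exact h01 hy₁
  have hdeg : (C (c₁ - c₀) * X + C c₀ : ℂ[X]).natDegree = 1 := natDegree_linear hc
  have hL : IsMoebius (algebraMap ℂ[X] (RatFunc ℂ) (C (c₁ - c₀) * X + C c₀)) := by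
    rw [IsMoebius, ratDegree_algebraMap, hdeg]
  refine ⟨ratComp N (algebraMap ℂ[X] (RatFunc ℂ) (C (c₁ - c₀) * X + C c₀)), hNM.comp hL, ?_, ?_, ?_⟩
  · rw [img_comp hNM.nonconst hL.nonconst, img_algebraMap_coe (by rw [hdeg]; exact one_pos)]
    simpa using hy₀
  · rw [img_comp hNM.nonconst hL.nonconst, img_algebraMap_coe (by rw [hdeg]; exact one_pos)]
    simpa using hy₁
  · rw [img_comp hNM.nonconst hL.nonconst, img_algebraMap_infty (by rw [hdeg]; exact one_pos), hN2]

theorem num_eval_eq {φ : RatFunc ℂ} {c d : ℂ} (h : Nonconst φ) (hc : img φ c = (d : OnePoint ℂ)) :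
    φ.num.eval c = d * φ.denom.eval c := by
  have h1 := (fiberMult_pos_iff h).2 hc
  have h2 := (rootMultiplicity_pos (fiberPoly_ne_zero h _)).1 h1
  simpa [IsRoot, fiberPoly_coe, sub_eq_zero] using h2

/-- If `φ` has only one pole and this lies at `∞`, then `φ` is a polynomial. -/
theorem denom_eq_one_of_infty {φ : RatFunc ℂ} (h : img φ OnePoint.infty = OnePoint.infty)
    (h1 : ratDegree φ ≤ ramIdx φ OnePoint.infty) : φ.denom = 1 := by
  have h2 := natDegree_fiberPoly_add h
  have h3 : φ.denom.natDegree = 0 := by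
    rw [fiberPoly_infty] at h2; omega
  exact (RatFunc.monic_denom φ).natDegree_eq_zero.1 h3

theorem eq_X_of_fixes (h : IsMoebius N) (h0 : img N ((0 : ℂ) : OnePoint ℂ) = ((0 : ℂ) : OnePoint ℂ))
    (h1 : img N ((1 : ℂ) : OnePoint ℂ) = ((1 : ℂ) : OnePoint ℂ))
    (hi : img N OnePoint.infty = OnePoint.infty) : N = RatFunc.X := by
  have hd : N.denom = 1 := denom_eq_one_of_infty hi (by rw [h.ramIdx]; exact h.le)
  have e0 := num_eval_eq h.nonconst h0
  have e1 := num_eval_eq h.nonconst h1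
  have hn : N.num.natDegree ≤ 1 := (le_max_left _ _).trans h.le
  rw [hd] at e0 e1
  rw [eq_X_add_C_of_natDegree_le_one hn] at e0 e1
  simp only [eval_add, eval_mul, eval_C, eval_X, mul_zero, zero_add, mul_one,
    eval_one] at e0 e1
  rw [← RatFunc.num_div_denom N, hd, eq_X_add_C_of_natDegree_le_one hn, e0]
  rw [e0, add_zero] at e1
  simp [e1]

/-- Fractional-linear functions have an inverse for the composition. -/
theorem IsMoebius.exists_inverse (h : IsMoebius M) :
    ∃ N, IsMoebius N ∧ ratComp M N = RatFunc.X ∧ ratComp N M = RatFunc.X := by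
  have right : ∀ {M : RatFunc ℂ}, IsMoebius M → ∃ N, IsMoebius N ∧ ratComp M N = RatFunc.X := by
    intro M h
    obtain ⟨s₀, hs₀⟩ := h.bijective.2 ((0 : ℂ) : OnePoint ℂ)
    obtain ⟨s₁, hs₁⟩ := h.bijective.2 ((1 : ℂ) : OnePoint ℂ)
    obtain ⟨s₂, hs₂⟩ := h.bijective.2 OnePoint.infty
    have h01 : s₀ ≠ s₁ := by
      rintro rfl; rw [hs₀, OnePoint.coe_eq_coe] at hs₁; exact zero_ne_one hs₁
    have h02 : s₀ ≠ s₂ := by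
      rintro rfl; rw [hs₀] at hs₂; exact OnePoint.coe_ne_infty _ hs₂
    have h12 : s₁ ≠ s₂ := by
      rintro rfl; rw [hs₁] at hs₂; exact OnePoint.coe_ne_infty _ hs₂
    obtain ⟨N, hN, h0, h1, h2⟩ := exists_moebius h01 h02 h12
    refine ⟨N, hN, eq_X_of_fixes (h.comp hN) ?_ ?_ ?_⟩
    · rw [img_comp h.nonconst hN.nonconst, h0, hs₀]
    · rw [img_comp h.nonconst hN.nonconst, h1, hs₁]
    · rw [img_comp h.nonconst hN.nonconst, h2, hs₂]
  obtain ⟨N, hN, hMN⟩ := right h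
  obtain ⟨L, hL, hNL⟩ := right hN
  refine ⟨N, hN, hMN, ?_⟩
  have : M = L := by
    rw [← ratComp_X_right M, ← hNL, ← ratComp_assoc M hN.nonconst hL.nonconst, hMN, ratComp_X_left]
  rw [this, hNL]

theorem IsMoebius.regAt_pullInv_iff {A : RatFunc ℂ} {s : OnePoint ℂ} (h : IsMoebius M) :
    RegAt (pullInv A M) s ↔ RegAt A (img M s) :=
  (h.ramAt s).regAt_pullInv_iff h.nonconst

theorem IsMoebius.coeffAt_pullInv {A : RatFunc ℂ} {s : OnePoint ℂ} {a : ℂ} (h : IsMoebius M)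
    (hA : CoeffAt A (img M s) a) : CoeffAt (pullInv A M) s a := by
  simpa using hA.pullInv h.nonconst (h.ramAt s)

end

/-! ### Relevant singularities -/

theorem ratD_X_inv : ratD (RatFunc.X⁻¹ : RatFunc ℂ) = -(RatFunc.X⁻¹) ^ 2 := by
  rw [Derivation.leibniz_inv, ratD_X]; simp

theorem ratD_ratD_X_inv : ratD (ratD (RatFunc.X⁻¹ : RatFunc ℂ)) / ratD RatFunc.X⁻¹ =
    -(2 / RatFunc.X) := by
  have hX : (RatFunc.X : RatFunc ℂ) ≠ 0 := RatFunc.X_ne_zero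
  rw [ratD_X_inv, map_neg, pow_two, ratD_mul, ratD_X_inv]
  field_simp
  ring

theorem pullInv_X_inv (A : RatFunc ℂ) :
    pullInv A RatFunc.X⁻¹ = RatFunc.X⁻¹ ^ 4 * ratComp A RatFunc.X⁻¹ := by
  have hX : (RatFunc.X : RatFunc ℂ) ≠ 0 := RatFunc.X_ne_zero
  have h2 : ratD (2 / RatFunc.X : RatFunc ℂ) = -(2 / RatFunc.X ^ 2) := by
    rw [div_eq_mul_inv, ratD_two_mul, ratD_X_inv]; field_simp
  rw [pullInv, ratD_ratD_X_inv, map_neg, h2, ratD_X_inv]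
  field_simp
  ring

theorem ratD_chart_coe (c : ℂ) : ratD (chart c) = 1 := by
  rw [chart_coe, map_add, ratD_X, ratD_C, add_zero]

theorem pullInv_chart_coe (A : RatFunc ℂ) (c : ℂ) : pullInv A (chart c) = ratComp A (chart c) := by
  rw [pullInv, ratD_chart_coe]; simp

theorem eval_denom_ne_zero_iff (f : RatFunc ℂ) (c : ℂ) :
    f.denom.eval c ≠ 0 ↔ Reg (ratComp f (chart c)) := by
  obtain ⟨T, hTX, hT⟩ := (nonconst_chart c).exists_hom
  have hv : HasVal (T RatFunc.X) c := by simpa [hTX, chart_coe] using hasVal_X.add (hasVal_C c)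
  have hn := hasVal_algHom_algebraMap hv f.num
  have hd := hasVal_algHom_algebraMap hv f.denom
  rw [hT]
  constructor
  · intro h
    rw [← RatFunc.num_div_denom f, map_div₀]
    exact (hn.div hd h).reg
  · intro h h0
    have hn0 : f.num.eval c ≠ 0 := by
      intro hn0
      obtain ⟨a, b, hab⟩ := RatFunc.isCoprime_num_denom f
      have := congrArg (eval c) hab
      simp [hn0, h0] at this
    have h1 := hd.div hn hn0
    rw [h0, zero_div, ← map_div₀, ← inv_div, RatFunc.num_div_denom, map_inv₀] at h1
    refine not_reg_of_hasVal_inv ?_ h1 h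
    rw [Ne, map_eq_zero]
    rintro rfl
    simp at hn0

theorem eval_denom_zero_ne_zero_iff (f : RatFunc ℂ) : f.denom.eval 0 ≠ 0 ↔ Reg f := by
  rw [eval_denom_ne_zero_iff, chart_coe, map_zero, add_zero, ratComp_X_right]

theorem LinearODE.reg_normalInv {E : LinearODE} (hP : Reg E.P) (hQ : Reg E.Q) :
    Reg E.normalInv :=
  (hQ.sub ((hP.pow 2).div_ofNat 4)).sub (hP.ratD.div_ofNat 2)

theorem LinearODE.IsRegularAt.regAt {E : LinearODE} {s : OnePoint ℂ} (h : E.IsRegularAt s) :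
    RegAt E.normalInv s := by
  induction s using OnePoint.rec with
  | infty =>
    have h' : (E.substitute RatFunc.X⁻¹).P.denom.eval 0 ≠ 0 ∧
      (E.substitute RatFunc.X⁻¹).Q.denom.eval 0 ≠ 0 := h
    rw [RegAt, chart_infty, ← LinearODE.normalInv_substitute _ nonconst_X_inv]
    exact reg_normalInv ((eval_denom_zero_ne_zero_iff _).1 h'.1)
      ((eval_denom_zero_ne_zero_iff _).1 h'.2)
  | coe c =>
    have h' : E.P.denom.eval c ≠ 0 ∧ E.Q.denom.eval c ≠ 0 := h
    rw [eval_denom_ne_zero_iff, eval_denom_ne_zero_iff] at h'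
    rw [RegAt, ← LinearODE.normalInv_substitute _ (nonconst_chart c)]
    refine reg_normalInv ?_ ?_
    · simp only [substitute, ← ratD_apply, ratD_chart_coe]
      simpa using h'.1
    · simp only [substitute, ← ratD_apply, ratD_chart_coe]
      simpa using h'.2

/-- A point is a relevant singularity exactly if it is a singularity of the invariant. -/
theorem LinearODE.isRelevantAt_iff {E : LinearODE} (hE : IsRadicalLogDeriv E.P) (s : OnePoint ℂ) :
    E.IsRelevantAt s ↔ ¬ RegAt E.normalInv s := by
  constructor
  · intro h hr
    induction s using OnePoint.rec with
    | infty =>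
      have hX : (RatFunc.X : RatFunc ℂ) ≠ 0 := RatFunc.X_ne_zero
      have hw : IsRadicalLogDeriv (E.P / 2 - 1 / RatFunc.X) := by
        refine hE.div_two.sub ?_
        have := isRadicalLogDeriv_C_div 1 0
        rwa [map_one, map_zero, sub_zero] at this
      refine h _ hw ?_
      -- With this prefactor the pulled-back equation has no first order term.
      have hP : ((E.twist (E.P / 2 - 1 / RatFunc.X)).substitute RatFunc.X⁻¹).P = 0 := by
        obtain ⟨T, hTX, hT⟩ := nonconst_X_inv.exists_hom
        have : (E.twist (E.P / 2 - 1 / RatFunc.X)).P = 2 / RatFunc.X := by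
          simp only [twist]; ring
        simp only [substitute, ← ratD_apply, this, ratD_ratD_X_inv]
        rw [hT, map_div₀, hTX, map_ofNat, ratD_X_inv]
        field_simp
        ring
      have hQ := LinearODE.normalInv_substitute (E.twist (E.P / 2 - 1 / RatFunc.X)) nonconst_X_inv
      rw [LinearODE.normalInv_twist, normalInv, hP] at hQ
      have hQ' : ((E.twist (E.P / 2 - 1 / RatFunc.X)).substitute RatFunc.X⁻¹).Q =
          pullInv E.normalInv RatFunc.X⁻¹ := by
        rw [← hQ]; simp
      change eval 0 _ ≠ 0 ∧ eval 0 _ ≠ 0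
      rw [eval_denom_zero_ne_zero_iff, eval_denom_zero_ne_zero_iff, hP, hQ']
      exact ⟨hasVal_zero.reg, hr⟩
    | coe c =>
      -- The prefactor with the logarithmic derivative `P / 2` leads to the normal form.
      refine h _ hE.div_two ?_
      have hP : (E.twist (E.P / 2)).P = 0 := by simp only [twist]; ring
      have hQ := E.normalInv_twist (E.P / 2)
      rw [normalInv, hP] at hQ
      have hQ' : (E.twist (E.P / 2)).Q = E.normalInv := by rw [← hQ]; simp
      change eval c _ ≠ 0 ∧ eval c _ ≠ 0
      rw [hP, hQ', eval_denom_ne_zero_iff E.normalInv, ← pullInv_chart_coe]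
      exact ⟨by simp, hr⟩
  · intro h w _ hr
    have := hr.regAt
    rw [LinearODE.normalInv_twist] at this
    exact h this

/-! ### Local data of the hypergeometric equation -/

/-- The invariant of the hypergeometric equation in terms of the squares of the exponent
differences at `0`, `1`, `∞`. -/
def hypInv (u v w : ℂ) : RatFunc ℂ :=
  (RatFunc.C (1 - u) / RatFunc.X ^ 2 + RatFunc.C (1 - v) / (RatFunc.X - 1) ^ 2 +
    RatFunc.C (u + v - w - 1) / (RatFunc.X * (RatFunc.X - 1))) / 4

theorem X_sub_C_ne_zero' (c : ℂ) : (RatFunc.X - RatFunc.C c : RatFunc ℂ) ≠ 0 :=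
  nonconst_X.sub_C_ne_zero c

theorem X_sub_one_ne_zero : (RatFunc.X - 1 : RatFunc ℂ) ≠ 0 := by
  simpa using X_sub_C_ne_zero' 1

theorem X_add_C_ne_zero' (c : ℂ) : (RatFunc.X + RatFunc.C c : RatFunc ℂ) ≠ 0 := by
  simpa using X_sub_C_ne_zero' (-c)

theorem ratD_C_div (a : ℂ) (f : RatFunc ℂ) :
    ratD (RatFunc.C a / f) = -(RatFunc.C a * ratD f) / f ^ 2 := by
  rw [ratD_div, ratD_C]; ring

theorem normalInv_hypergeometric (p : Fin 3 → ℂ) : (hypergeometric p).normalInv =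
    hypInv (expDiff p 0 ^ 2) (expDiff p 1 ^ 2) (expDiff p 2 ^ 2) := by
  have hX : (RatFunc.X : RatFunc ℂ) ≠ 0 := RatFunc.X_ne_zero
  have hX1 := X_sub_one_ne_zero
  simp only [LinearODE.normalInv, hypergeometric, map_add ratD, ratD_C_div, ratD_X,
    map_sub ratD, Derivation.map_one_eq_zero, sub_zero]
  simp only [hypInv, expDiff, map_add, map_sub, map_mul, map_one, map_pow, Matrix.cons_val_zero,
    Matrix.cons_val_one, Matrix.cons_val]
  field_simp
  ring

section

variable (u v w : ℂ)

theorem pullInv_hypInv_coe (c : ℂ) : pullInv (hypInv u v w) (chart c) =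
    (RatFunc.C (1 - u) / (RatFunc.X + RatFunc.C c) ^ 2 +
      RatFunc.C (1 - v) / (RatFunc.X + RatFunc.C (c - 1)) ^ 2 +
    RatFunc.C (u + v - w - 1) /
      ((RatFunc.X + RatFunc.C c) * (RatFunc.X + RatFunc.C (c - 1)))) / 4 := by
  obtain ⟨T, hTX, hT⟩ := (nonconst_chart c).exists_hom
  rw [pullInv_chart_coe, hT, hypInv]
  simp only [map_div₀, map_add, map_mul, map_pow, map_sub T, algHom_C, hTX, map_one, map_ofNat,
    chart_coe, map_sub RatFunc.C c 1]
  ring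

theorem pullInv_hypInv_infty : pullInv (hypInv u v w) (chart OnePoint.infty) =
    (RatFunc.C (1 - u) / RatFunc.X ^ 2 +
      RatFunc.C (1 - v) / (RatFunc.X ^ 2 * (1 - RatFunc.X) ^ 2) +
    RatFunc.C (u + v - w - 1) / (RatFunc.X ^ 2 * (1 - RatFunc.X))) / 4 := by
  obtain ⟨T, hTX, hT⟩ := nonconst_X_inv.exists_hom
  have hX : (RatFunc.X : RatFunc ℂ) ≠ 0 := RatFunc.X_ne_zero
  have hX1 : (1 - RatFunc.X : RatFunc ℂ) ≠ 0 := by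
    rw [← neg_sub]; exact neg_ne_zero.2 X_sub_one_ne_zero
  rw [chart_infty, pullInv_X_inv, hT, hypInv]
  simp only [map_div₀, map_add, map_mul, map_pow, map_sub T, algHom_C, hTX, map_one, map_ofNat]
  have : (RatFunc.X⁻¹ - 1 : RatFunc ℂ) = (1 - RatFunc.X) / RatFunc.X := by field_simp
  rw [this]
  field_simp

theorem hasVal_X_add_C (c : ℂ) : HasVal (RatFunc.X + RatFunc.C c) c := by
  simpa using hasVal_X.add (hasVal_C c)

theorem reg_C_div_X_add_C (a : ℂ) {c : ℂ} (hc : c ≠ 0) :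
    Reg (RatFunc.C a / (RatFunc.X + RatFunc.C c)) :=
  ((hasVal_C a).div (hasVal_X_add_C c) hc).reg

theorem regAt_hypInv {c : ℂ} (h0 : c ≠ 0) (h1 : c ≠ 1) : RegAt (hypInv u v w) c := by
  rw [RegAt, pullInv_hypInv_coe]
  have h1' := sub_ne_zero.2 h1
  refine Reg.div_ofNat (Reg.add (Reg.add ?_ ?_) ?_) 4
  · exact ((hasVal_C _).div ((hasVal_X_add_C c).pow 2) (pow_ne_zero 2 h0)).reg
  · exact ((hasVal_C _).div ((hasVal_X_add_C _).pow 2) (pow_ne_zero 2 h1')).reg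
  · exact ((hasVal_C _).div ((hasVal_X_add_C _).mul (hasVal_X_add_C _)) (mul_ne_zero h0 h1')).reg

theorem coeffAt_hypInv_zero : CoeffAt (hypInv u v w) ((0 : ℂ) : OnePoint ℂ) ((1 - u) / 4) := by
  have hX : (RatFunc.X : RatFunc ℂ) ≠ 0 := RatFunc.X_ne_zero
  have hX1 := X_add_C_ne_zero' (-1)
  have h := (((hasVal_C (1 - u)).add ((hasVal_X.pow 2).mul ((hasVal_C (1 - v)).div
    ((hasVal_X_add_C (-1)).pow 2) (by norm_num)))).add (hasVal_X.mul
      ((hasVal_C (u + v - w - 1)).div (hasVal_X_add_C (-1)) (by norm_num)))).div (hasVal_ofNat 4)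
        (by norm_num)
  rw [CoeffAt, pullInv_hypInv_coe]
  convert h using 1
  · rw [zero_sub, map_zero, add_zero]
    field_simp
  · ring

theorem coeffAt_hypInv_one : CoeffAt (hypInv u v w) ((1 : ℂ) : OnePoint ℂ) ((1 - v) / 4) := by
  have hX : (RatFunc.X : RatFunc ℂ) ≠ 0 := RatFunc.X_ne_zero
  have hX1 := X_add_C_ne_zero' 1
  have h := (((hasVal_C (1 - v)).add ((hasVal_X.pow 2).mul ((hasVal_C (1 - u)).div
    ((hasVal_X_add_C 1).pow 2) (by norm_num)))).add (hasVal_X.mul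
      ((hasVal_C (u + v - w - 1)).div (hasVal_X_add_C 1) (by norm_num)))).div (hasVal_ofNat 4)
        (by norm_num)
  rw [CoeffAt, pullInv_hypInv_coe]
  convert h using 1
  · rw [sub_self, map_zero, add_zero]
    field_simp
    ring
  · ring

theorem hasVal_one_sub_X : HasVal (1 - RatFunc.X) 1 := by
  simpa using hasVal_one.sub hasVal_X

theorem coeffAt_hypInv_infty : CoeffAt (hypInv u v w) OnePoint.infty ((1 - w) / 4) := by
  have hX : (RatFunc.X : RatFunc ℂ) ≠ 0 := RatFunc.X_ne_zero
  have hX1 := hasVal_one_sub_X.ne_zero one_ne_zero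
  have h := (((hasVal_C (1 - u)).add ((hasVal_C (1 - v)).div
    (hasVal_one_sub_X.pow 2) (by norm_num))).add
      ((hasVal_C (u + v - w - 1)).div hasVal_one_sub_X (by norm_num))).div (hasVal_ofNat 4)
        (by norm_num)
  rw [CoeffAt, pullInv_hypInv_infty]
  convert h using 1
  · field_simp
  · ring

/-- The residue at `0` of the invariant, if the exponent difference there is `±1`. -/
theorem eq_of_regAt_hypInv_zero (h : RegAt (hypInv u v w) ((0 : ℂ) : OnePoint ℂ)) (hu : u = 1) :
    v = w := by
  have hX : (RatFunc.X : RatFunc ℂ) ≠ 0 := RatFunc.X_ne_zero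
  have hX1 := X_add_C_ne_zero' (-1)
  subst hu
  have h1 := ((hasVal_X.mul ((hasVal_C (1 - v)).div
    ((hasVal_X_add_C (-1)).pow 2) (by norm_num))).add
      ((hasVal_C (1 + v - w - 1)).div (hasVal_X_add_C (-1)) (by norm_num))).div (hasVal_ofNat 4)
        (by norm_num)
  have h2 := Reg.hasVal_X_mul h
  rw [pullInv_hypInv_coe] at h2
  have h3 := h2.unique (b := (0 * ((1 - v) / (-1) ^ 2) + (1 + v - w - 1) / -1) / 4) (by
    convert h1 using 1
    rw [zero_sub, map_zero, add_zero, sub_self, map_zero]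
    field_simp
    ring)
  linear_combination (4 : ℂ) * h3

theorem eq_of_regAt_hypInv_one (h : RegAt (hypInv u v w) ((1 : ℂ) : OnePoint ℂ)) (hv : v = 1) :
    u = w := by
  have hX : (RatFunc.X : RatFunc ℂ) ≠ 0 := RatFunc.X_ne_zero
  have hX1 := X_add_C_ne_zero' 1
  subst hv
  have h1 := ((hasVal_X.mul ((hasVal_C (1 - u)).div
    ((hasVal_X_add_C 1).pow 2) (by norm_num))).add
      ((hasVal_C (u + 1 - w - 1)).div (hasVal_X_add_C 1) (by norm_num))).div (hasVal_ofNat 4)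
        (by norm_num)
  have h2 := Reg.hasVal_X_mul h
  rw [pullInv_hypInv_coe] at h2
  have h3 := h2.unique (b := (0 * ((1 - u) / 1 ^ 2) + (u + 1 - w - 1) / 1) / 4) (by
    convert h1 using 1
    rw [sub_self, map_zero, add_zero]
    field_simp
    ring)
  linear_combination (-4 : ℂ) * h3

theorem eq_of_regAt_hypInv_infty (h : RegAt (hypInv u v w) OnePoint.infty) (hw : w = 1) :
    u = v := by
  have hX : (RatFunc.X : RatFunc ℂ) ≠ 0 := RatFunc.X_ne_zero
  have hX1 := hasVal_one_sub_X.ne_zero one_ne_zero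
  subst hw
  have h1 := (((hasVal_C (u - v)).add (hasVal_X.mul (hasVal_C (1 - u)))).div
    (hasVal_one_sub_X.pow 2) (by norm_num)).div (hasVal_ofNat 4) (by norm_num)
  have h2 := Reg.hasVal_X_mul h
  rw [pullInv_hypInv_infty] at h2
  have h3 := h2.unique (b := (u - v + 0 * (1 - u)) / 1 ^ 2 / 4) (by
    convert h1 using 1
    simp only [map_sub, map_add, map_one]
    field_simp
    ring)
  linear_combination (-4 : ℂ) * h3

end

theorem coeffAt_hypergeometric (p : Fin 3 → ℂ) (j : Fin 3) :
    CoeffAt (hypergeometric p).normalInv (singPt j) ((1 - expDiff p j ^ 2) / 4) := by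
  rw [normalInv_hypergeometric]
  fin_cases j
  · exact coeffAt_hypInv_zero _ _ _
  · exact coeffAt_hypInv_one _ _ _
  · exact coeffAt_hypInv_infty _ _ _

theorem regAt_hypergeometric (p : Fin 3 → ℂ) {z : OnePoint ℂ} (hz : ∀ j, z ≠ singPt j) :
    RegAt (hypergeometric p).normalInv z := by
  induction z using OnePoint.rec with
  | infty => exact absurd rfl (hz 2)
  | coe c =>
    rw [normalInv_hypergeometric]
    refine regAt_hypInv _ _ _ ?_ ?_
    · rintro rfl; exact hz 0 rfl
    · rintro rfl; exact hz 1 rfl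

/-- A point with the exponent difference `±1` is logarithmic, unless the other two exponent
differences agree up to sign. -/
theorem sq_eq_of_regAt (p : Fin 3 → ℂ) {j : Fin 3} (hj : expDiff p j ^ 2 = 1)
    (h : RegAt (hypergeometric p).normalInv (singPt j)) :
    ∃ i i', i ≠ i' ∧ i ≠ j ∧ i' ≠ j ∧ expDiff p i ^ 2 = expDiff p i' ^ 2 := by
  rw [normalInv_hypergeometric] at h
  fin_cases j
  · exact ⟨1, 2, by decide, by decide, by decide, eq_of_regAt_hypInv_zero _ _ _ h hj⟩
  · exact ⟨0, 2, by decide, by decide, by decide, eq_of_regAt_hypInv_one _ _ _ h hj⟩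
  · exact ⟨0, 1, by decide, by decide, by decide, eq_of_regAt_hypInv_infty _ _ _ h hj⟩

theorem singPt_injective : Function.Injective singPt := by
  intro i j hij
  fin_cases i <;> fin_cases j <;> first | rfl | (exfalso; revert hij; simp [singPt])

/-! ### Local data of the Heun equation -/

theorem LinearODE.hasVal_normalInv {E : LinearODE} {c k : ℂ} (hP : HasVal (RatFunc.X * E.P) c)
    (hQ : HasVal (RatFunc.X ^ 2 * E.Q) k) :
    HasVal (RatFunc.X ^ 2 * E.normalInv) (k - c ^ 2 / 4 + c / 2) := by
  have h1 : RatFunc.X ^ 2 * E.normalInv = RatFunc.X ^ 2 * E.Q - (RatFunc.X * E.P) ^ 2 / 4 +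
      RatFunc.X * E.P / 2 - RatFunc.X * ratD (RatFunc.X * E.P) / 2 := by
    rw [ratD_mul, ratD_X, normalInv]; ring
  have h2 : HasVal (RatFunc.X * ratD (RatFunc.X * E.P) / 2) (0 / 2) :=
    hP.reg.ratD.hasVal_X_mul.div (hasVal_ofNat 2) two_ne_zero
  rw [h1]
  have := ((hQ.sub ((hP.pow 2).div (hasVal_ofNat 4) (by norm_num))).add
    (hP.div (hasVal_ofNat 2) two_ne_zero)).sub h2
  simpa using this

theorem coeffAt_of_substitute {E : LinearODE} {s : OnePoint ℂ} {c k : ℂ}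
    (hP : HasVal (RatFunc.X * (E.substitute (chart s)).P) c)
    (hQ : HasVal (RatFunc.X ^ 2 * (E.substitute (chart s)).Q) k) :
    CoeffAt E.normalInv s (k - c ^ 2 / 4 + c / 2) := by
  rw [CoeffAt, ← LinearODE.normalInv_substitute _ (nonconst_chart s)]
  exact LinearODE.hasVal_normalInv hP hQ

namespace HeunParams

variable (h : HeunParams)

theorem substitute_coe_P (s : ℂ) : (h.equation.substitute (chart s)).P =
    RatFunc.C h.c / (RatFunc.X + RatFunc.C s) + RatFunc.C h.d / (RatFunc.X + RatFunc.C (s - 1)) +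
      RatFunc.C (h.a + h.b - h.c - h.d + 1) / (RatFunc.X + RatFunc.C (s - h.t)) := by
  obtain ⟨T, hTX, hT⟩ := (nonconst_chart s).exists_hom
  simp only [LinearODE.substitute, ← ratD_apply, ratD_chart_coe, hT, equation]
  simp only [map_div₀, map_add T, map_sub T, algHom_C, hTX, map_one, chart_coe,
    Derivation.map_one_eq_zero, map_sub RatFunc.C s]
  ring

theorem substitute_coe_Q (s : ℂ) : (h.equation.substitute (chart s)).Q =
    (RatFunc.C (h.a * h.b) * (RatFunc.X + RatFunc.C s) - RatFunc.C h.q) /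
      ((RatFunc.X + RatFunc.C s) * (RatFunc.X + RatFunc.C (s - 1)) *
        (RatFunc.X + RatFunc.C (s - h.t))) := by
  obtain ⟨T, hTX, hT⟩ := (nonconst_chart s).exists_hom
  simp only [LinearODE.substitute, ← ratD_apply, ratD_chart_coe, hT, equation]
  simp only [map_div₀, map_mul T, map_sub T, algHom_C, hTX, map_one, chart_coe,
    map_sub RatFunc.C s]
  ring

theorem regAt {s : ℂ} (h0 : s ≠ 0) (h1 : s ≠ 1) (ht : s ≠ h.t) :
    RegAt h.equation.normalInv s := by
  rw [RegAt, ← LinearODE.normalInv_substitute _ (nonconst_chart _)]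
  have h1' := sub_ne_zero.2 h1
  have ht' := sub_ne_zero.2 ht
  refine LinearODE.reg_normalInv ?_ ?_
  · rw [substitute_coe_P]
    exact ((reg_C_div_X_add_C _ h0).add (reg_C_div_X_add_C _ h1')).add (reg_C_div_X_add_C _ ht')
  · rw [substitute_coe_Q]
    exact ((((hasVal_C _).mul (hasVal_X_add_C _)).sub (hasVal_C _)).div
      (((hasVal_X_add_C _).mul (hasVal_X_add_C _)).mul (hasVal_X_add_C _))
      (mul_ne_zero (mul_ne_zero h0 h1') ht')).reg

theorem coeffAt_zero :
    CoeffAt h.equation.normalInv ((0 : ℂ) : OnePoint ℂ) ((1 - (1 - h.c) ^ 2) / 4) := by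
  have hX : (RatFunc.X : RatFunc ℂ) ≠ 0 := RatFunc.X_ne_zero
  have h1 : (0 : ℂ) - 1 ≠ 0 := by norm_num
  have ht : (0 : ℂ) - h.t ≠ 0 := sub_ne_zero.2 h.t_ne_zero.symm
  have := coeffAt_of_substitute (E := h.equation) (s := (0 : ℂ)) (c := h.c + 0) (k := 0) ?_ ?_
  · convert this using 1; ring
  · rw [substitute_coe_P, map_zero, add_zero]
    convert (hasVal_C h.c).add (((reg_C_div_X_add_C h.d h1).add (reg_C_div_X_add_C
      (h.a + h.b - h.c - h.d + 1) ht)).hasVal_X_mul) using 1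
    field_simp
    ring
  · rw [substitute_coe_Q, map_zero, add_zero]
    have h2 := (((hasVal_C (h.a * h.b)).mul hasVal_X).sub (hasVal_C h.q)).div
      ((hasVal_X_add_C (0 - 1)).mul (hasVal_X_add_C (0 - h.t))) (mul_ne_zero h1 ht)
    convert h2.reg.hasVal_X_mul using 1
    field_simp

theorem coeffAt_one :
    CoeffAt h.equation.normalInv ((1 : ℂ) : OnePoint ℂ) ((1 - (1 - h.d) ^ 2) / 4) := by
  have hX : (RatFunc.X : RatFunc ℂ) ≠ 0 := RatFunc.X_ne_zero
  have h1 : (1 : ℂ) ≠ 0 := one_ne_zero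
  have ht : (1 : ℂ) - h.t ≠ 0 := sub_ne_zero.2 h.t_ne_one.symm
  have := coeffAt_of_substitute (E := h.equation) (s := (1 : ℂ)) (c := h.d + 0) (k := 0) ?_ ?_
  · convert this using 1; ring
  · rw [substitute_coe_P, sub_self, map_zero, add_zero]
    convert (hasVal_C h.d).add (((reg_C_div_X_add_C h.c h1).add (reg_C_div_X_add_C
      (h.a + h.b - h.c - h.d + 1) ht)).hasVal_X_mul) using 1
    field_simp
    ring
  · rw [substitute_coe_Q, sub_self, map_zero, add_zero]
    have h2 := (((hasVal_C (h.a * h.b)).mul (hasVal_X_add_C 1)).sub (hasVal_C h.q)).div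
      ((hasVal_X_add_C 1).mul (hasVal_X_add_C (1 - h.t))) (mul_ne_zero h1 ht)
    convert h2.reg.hasVal_X_mul using 1
    field_simp

theorem coeffAt_t : CoeffAt h.equation.normalInv (h.t : OnePoint ℂ)
    ((1 - (h.c + h.d - h.a - h.b) ^ 2) / 4) := by
  have hX : (RatFunc.X : RatFunc ℂ) ≠ 0 := RatFunc.X_ne_zero
  have h0 : h.t ≠ 0 := h.t_ne_zero
  have h1 : h.t - 1 ≠ 0 := sub_ne_zero.2 h.t_ne_one
  have := coeffAt_of_substitute (E := h.equation) (s := h.t)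
    (c := h.a + h.b - h.c - h.d + 1 + 0) (k := 0) ?_ ?_
  · convert this using 1; ring
  · rw [substitute_coe_P, sub_self, map_zero, add_zero]
    convert (hasVal_C (h.a + h.b - h.c - h.d + 1)).add (((reg_C_div_X_add_C h.c h0).add
      (reg_C_div_X_add_C h.d h1)).hasVal_X_mul) using 1
    field_simp
    ring
  · rw [substitute_coe_Q, sub_self, map_zero, add_zero]
    have h2 := (((hasVal_C (h.a * h.b)).mul (hasVal_X_add_C h.t)).sub (hasVal_C h.q)).div
      ((hasVal_X_add_C h.t).mul (hasVal_X_add_C (h.t - 1))) (mul_ne_zero h0 h1)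
    convert h2.reg.hasVal_X_mul using 1
    field_simp

theorem coeffAt_infty :
    CoeffAt h.equation.normalInv OnePoint.infty ((1 - (h.a - h.b) ^ 2) / 4) := by
  have hX : (RatFunc.X : RatFunc ℂ) ≠ 0 := RatFunc.X_ne_zero
  have hX1 := hasVal_one_sub_X.ne_zero one_ne_zero
  have hvt : HasVal (1 - RatFunc.C h.t * RatFunc.X) (1 - h.t * 0) :=
    hasVal_one.sub ((hasVal_C h.t).mul hasVal_X)
  have hXt := hvt.ne_zero (by norm_num)
  obtain ⟨T, hTX, hT⟩ := nonconst_X_inv.exists_hom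
  have e1 : (RatFunc.X⁻¹ - 1 : RatFunc ℂ) = (1 - RatFunc.X) / RatFunc.X := by field_simp
  have et : (RatFunc.X⁻¹ - RatFunc.C h.t : RatFunc ℂ) =
      (1 - RatFunc.C h.t * RatFunc.X) / RatFunc.X := by field_simp
  have := coeffAt_of_substitute (E := h.equation) (s := OnePoint.infty)
    (c := 2 - (h.c + h.d / 1 + (h.a + h.b - h.c - h.d + 1) / (1 - h.t * 0)))
    (k := (h.a * h.b - h.q * 0) / (1 * (1 - h.t * 0))) ?_ ?_
  · convert this using 1; ring
  · rw [chart_infty]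
    simp only [LinearODE.substitute, ← ratD_apply, ratD_ratD_X_inv, hT, equation]
    simp only [map_div₀, map_add T, map_sub T, algHom_C, hTX, map_one, ratD_X_inv, e1, et]
    convert (hasVal_ofNat 2).sub (((hasVal_C h.c).add ((hasVal_C h.d).div hasVal_one_sub_X
      (by norm_num))).add ((hasVal_C (h.a + h.b - h.c - h.d + 1)).div hvt (by norm_num))) using 1
    field_simp
    ring
  · rw [chart_infty]
    simp only [LinearODE.substitute, ← ratD_apply, hT, equation]
    simp only [map_div₀, map_mul T, map_sub T, algHom_C, hTX, map_one, ratD_X_inv, e1, et]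
    convert ((hasVal_C (h.a * h.b)).sub ((hasVal_C h.q).mul hasVal_X)).div
      (hasVal_one_sub_X.mul hvt) (by norm_num) using 1
    field_simp

end HeunParams

/-! ### The singularities of a pull-back of the hypergeometric equation -/

open Classical in
/-- The square of the exponent difference of the hypergeometric equation at `z`; it is `1` at
nonsingular points. -/
def hypExpSq (p : Fin 3 → ℂ) (z : OnePoint ℂ) : ℂ :=
  if h : ∃ j, z = singPt j then expDiff p h.choose ^ 2 else 1

theorem hypExpSq_singPt (p : Fin 3 → ℂ) (j : Fin 3) : hypExpSq p (singPt j) = expDiff p j ^ 2 := by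
  have h : ∃ i, singPt j = singPt i := ⟨j, rfl⟩
  rw [hypExpSq, dif_pos h, ← singPt_injective h.choose_spec]

theorem hypExpSq_of_ne (p : Fin 3 → ℂ) {z : OnePoint ℂ} (h : ∀ j, z ≠ singPt j) :
    hypExpSq p z = 1 := by
  rw [hypExpSq, dif_neg]
  rintro ⟨j, hj⟩
  exact h j hj

/-- The square of the exponent difference at `s` of the pull-back along `φ`. -/
def pullExpSq (p : Fin 3 → ℂ) (φ : RatFunc ℂ) (s : OnePoint ℂ) : ℂ :=
  ramIdx φ s ^ 2 * hypExpSq p (img φ s)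

/-- The exponent differences of the pull-back, at all points. -/
theorem coeffAt_pullInv (p : Fin 3 → ℂ) {φ : RatFunc ℂ} (hφ : Nonconst φ) (s : OnePoint ℂ) :
    CoeffAt (pullInv (hypergeometric p).normalInv φ) s ((1 - pullExpSq p φ s) / 4) := by
  have h : CoeffAt (hypergeometric p).normalInv (img φ s) ((1 - hypExpSq p (img φ s)) / 4) := by
    by_cases h : ∃ j, img φ s = singPt j
    · obtain ⟨j, hj⟩ := h
      rw [hj, hypExpSq_singPt]
      exact coeffAt_hypergeometric p j
    · push Not at h
      rw [hypExpSq_of_ne p h, sub_self, zero_div]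
      exact (regAt_hypergeometric p h).coeffAt
  convert h.pullInv hφ (ramAt_ramIdx hφ s) using 1
  rw [pullExpSq]; ring

/-- Above nonsingular points, the singularities of the pull-back are the branching points. -/
theorem regAt_pullInv_of_off (p : Fin 3 → ℂ) {φ : RatFunc ℂ} (hφ : Nonconst φ) {s : OnePoint ℂ}
    (hs : ∀ j, img φ s ≠ singPt j) :
    RegAt (pullInv (hypergeometric p).normalInv φ) s ↔ ramIdx φ s = 1 := by
  constructor
  · intro h
    have h1 := (coeffAt_pullInv p hφ s).unique h.coeffAt
    rw [pullExpSq, hypExpSq_of_ne p hs] at h1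
    have h2 : ((ramIdx φ s ^ 2 : ℕ) : ℂ) = (1 : ℕ) := by push_cast; linear_combination -4 * h1
    have h3 := Nat.cast_injective h2
    nlinarith
  · intro h
    have := ramAt_ramIdx hφ s
    rw [h] at this
    exact (this.regAt_pullInv_iff hφ).2 (regAt_hypergeometric p hs)

/-- The points above the singular points form no singularity if the exponent difference is `±1/k`,
with `k ≥ 2`, and the branching index is `k`. -/
theorem regAt_pullInv_of_exceptional (p : Fin 3 → ℂ) {φ : RatFunc ℂ} (hφ : Nonconst φ)
    {s : OnePoint ℂ} {j : Fin 3} (hs : img φ s = singPt j) (h1 : ramIdx φ s ≠ 1)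
    (he : (ramIdx φ s * expDiff p j) ^ 2 = 1) :
    RegAt (pullInv (hypergeometric p).normalInv φ) s := by
  have h := ramAt_ramIdx hφ s
  have hm : (ramIdx φ s : ℂ) ≠ 0 := Nat.cast_ne_zero.2 (ramIdx_pos hφ s).ne'
  refine CoeffAt.regAt_pullInv hφ h ?_ fun h0 => absurd h0 h1
  rw [hs]
  convert coeffAt_hypergeometric p j using 3
  rw [mul_pow] at he
  rw [div_eq_iff (pow_ne_zero 2 hm), mul_comm, he]

/-- The conditions on the exponent differences under which the points of the fibres of a covering of
degree `d` that are not singular are exactly the points with the branching index `k` above the point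
number `j₀`.  The value `k = 0` means that all points of the fibres are singular. -/
structure Controlled (p : Fin 3 → ℂ) (d : ℕ) (j₀ : Fin 3) (k : ℕ) : Prop where
  ne_one : k ≠ 1
  sq_eq : k ≠ 0 → (k * expDiff p j₀) ^ 2 = 1
  of_sq_eq : ∀ j m, 1 ≤ m → m ≤ d → (m * expDiff p j) ^ 2 = 1 → j = j₀ ∧ m = k ∨
    m = 1 ∧ ∀ i i', i ≠ i' → i ≠ j → i' ≠ j → expDiff p i ^ 2 ≠ expDiff p i' ^ 2

theorem Controlled.regAt_iff {p : Fin 3 → ℂ} {φ : RatFunc ℂ} {j₀ : Fin 3} {k : ℕ}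
    (hp : Controlled p (ratDegree φ) j₀ k) (hφ : Nonconst φ) {s : OnePoint ℂ} {j : Fin 3}
    (hs : img φ s = singPt j) :
    RegAt (pullInv (hypergeometric p).normalInv φ) s ↔ j = j₀ ∧ ramIdx φ s = k := by
  have hpos := ramIdx_pos hφ s
  constructor
  · intro h
    have h1 := (coeffAt_pullInv p hφ s).unique h.coeffAt
    rw [pullExpSq, hs, hypExpSq_singPt] at h1
    rcases hp.of_sq_eq j (ramIdx φ s) hpos (ramIdx_le hφ s) (by linear_combination -4 * h1) with
      h2 | ⟨h2, h3⟩
    · exact h2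
    · have h4 := ramAt_ramIdx hφ s
      rw [h2, hs] at h4
      rw [h4.regAt_pullInv_iff hφ] at h
      obtain ⟨i, i', hii, hi, hi', he⟩ := sq_eq_of_regAt p (j := j)
        (by rw [h2] at h1; push_cast at h1; linear_combination -4 * h1) h
      exact absurd he (h3 i i' hii hi hi')
  · rintro ⟨rfl, hk⟩
    refine regAt_pullInv_of_exceptional p hφ hs (hk ▸ hp.ne_one) ?_
    rw [hk]
    exact hp.sq_eq (by omega)

section

variable (φ : RatFunc ℂ) (j₀ : Fin 3) (k : ℕ)

open Classical in
/-- The points above `0`, `1`, `∞` other than those with the branching index `k` above the point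
number `j₀`. -/
def nonExc : Finset (OnePoint ℂ) :=
  Finset.univ.biUnion fun j => (fib φ (singPt j)).filter fun s => ¬ (j = j₀ ∧ ramIdx φ s = k)

variable {φ j₀ k}

theorem mem_nonExc (hφ : Nonconst φ) {s : OnePoint ℂ} :
    s ∈ nonExc φ j₀ k ↔ ∃ j, img φ s = singPt j ∧ ¬ (j = j₀ ∧ ramIdx φ s = k) := by
  simp [nonExc, mem_fib hφ]

theorem disjoint_fib (hφ : Nonconst φ) {i j : Fin 3} (hij : i ≠ j) :
    Disjoint (fib φ (singPt i)) (fib φ (singPt j)) := by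
  rw [Finset.disjoint_left]
  intro s hi hj
  rw [mem_fib hφ] at hi hj
  exact hij (singPt_injective (hi.symm.trans hj))

open Classical in
theorem sum_nonExc {α : Type*} [AddCommMonoid α] (hφ : Nonconst φ) (f : OnePoint ℂ → α) :
    ∑ s ∈ nonExc φ j₀ k, f s =
      ∑ j, ∑ s ∈ (fib φ (singPt j)).filter (fun s => ¬ (j = j₀ ∧ ramIdx φ s = k)), f s :=
  Finset.sum_biUnion fun _ _ _ _ hij =>
    Finset.disjoint_filter_filter (disjoint_fib hφ hij)

theorem map_eq_sum_singleton {α β : Type*} (s : Finset α) (f : α → β) :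
    s.val.map f = ∑ a ∈ s, ({f a} : Multiset β) := by
  rw [Finset.sum, ← Multiset.sum_map_singleton (s.val.map f), Multiset.map_map]
  rfl

theorem map_filter_fib (hφ : Nonconst φ) (p : Fin 3 → ℂ) (j : Fin 3) (P : ℕ → Prop)
    [DecidablePred P] :
    ((fib φ (singPt j)).filter (fun s => P (ramIdx φ s))).val.map (pullExpSq p φ) =
      ((fiberPartition φ (singPt j)).filter P).map fun m : ℕ => (m * expDiff p j) ^ 2 := by
  rw [fiberPartition_eq_map_ramIdx hφ, Multiset.filter_map, Multiset.map_map, Finset.filter_val]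
  refine Multiset.map_congr rfl fun s hs => ?_
  have hs' : s ∈ fib φ (singPt j) := (Multiset.mem_filter.1 hs).1
  rw [mem_fib hφ] at hs'
  rw [pullExpSq, hs', hypExpSq_singPt, Function.comp_apply, mul_pow]

/-- The exponent differences at the points above `0`, `1`, `∞`, in terms of the branching
pattern. -/
theorem map_nonExc (hφ : Nonconst φ) (p : Fin 3 → ℂ) :
    (nonExc φ j₀ k).val.map (pullExpSq p φ) =
      ∑ j, ((fiberPartition φ (singPt j)).filter fun m => ¬ (j = j₀ ∧ m = k)).map
        fun m : ℕ => (m * expDiff p j) ^ 2 := by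
  rw [map_eq_sum_singleton, sum_nonExc hφ]
  refine Finset.sum_congr rfl fun j _ => ?_
  rw [← map_eq_sum_singleton]
  exact map_filter_fib hφ p j fun m => ¬ (j = j₀ ∧ m = k)

theorem sum_fib_sub_one (hφ : Nonconst φ) (z : OnePoint ℂ) :
    ∑ s ∈ fib φ z, (ramIdx φ s - 1) + (fib φ z).card = ratDegree φ := by
  rw [← sum_fib hφ z, Finset.card_eq_sum_ones, ← Finset.sum_add_distrib]
  exact Finset.sum_congr rfl fun s _ => Nat.sub_add_cancel (ramIdx_pos hφ s)

/-- The Riemann–Hurwitz formula in terms of the three fibres. -/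
theorem exists_off (hφ : Nonconst φ) : ∃ U : Finset (OnePoint ℂ),
    (∀ s, s ∈ U ↔ (∀ j, img φ s ≠ singPt j) ∧ ramIdx φ s ≠ 1) ∧
    ∑ j, (fib φ (singPt j)).card = ratDegree φ + 2 + ∑ s ∈ U, (ramIdx φ s - 1) := by
  classical
  obtain ⟨R, hR⟩ := finite_ramified hφ
  refine ⟨R.filter fun s => ∀ j, img φ s ≠ singPt j, fun s => ?_, ?_⟩
  · rw [Finset.mem_filter, hR, and_comm]
  set U := R.filter fun s => ∀ j, img φ s ≠ singPt j with hU
  have hd : Disjoint (Finset.univ.biUnion fun j => fib φ (singPt j)) U := by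
    rw [Finset.disjoint_left]
    intro s hs hs'
    rw [Finset.mem_biUnion] at hs
    obtain ⟨j, -, hj⟩ := hs
    exact (Finset.mem_filter.1 hs').2 j ((mem_fib hφ).1 hj)
  have h := riemannHurwitz hφ ((Finset.univ.biUnion fun j => fib φ (singPt j)) ∪ U) ?_
  · rw [Finset.sum_union hd, Finset.sum_biUnion fun _ _ _ _ hij => disjoint_fib hφ hij] at h
    have h0 := sum_fib_sub_one hφ (singPt 0)
    have h1 := sum_fib_sub_one hφ (singPt 1)
    have h2 := sum_fib_sub_one hφ (singPt 2)
    rw [Fin.sum_univ_three] at h ⊢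
    omega
  · intro s hs
    by_contra h1
    refine hs (Finset.mem_union.2 ?_)
    by_cases h2 : ∃ j, img φ s = singPt j
    · obtain ⟨j, hj⟩ := h2
      exact Or.inl (Finset.mem_biUnion.2 ⟨j, Finset.mem_univ _, (mem_fib hφ).2 hj⟩)
    · push Not at h2
      exact Or.inr (Finset.mem_filter.2 ⟨(hR s).2 h1, h2⟩)

end

/-! ### The singularities of a Heun equation and its pull-back data -/

theorem eqUpToSign_iff {A B : Multiset ℂ} :
    EqUpToSign A B ↔ A.map (fun x => x ^ 2) = B.map fun x => x ^ 2 := by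
  rw [EqUpToSign, ← Multiset.rel_eq, Multiset.rel_map]
  simp only [sq_eq_sq_iff_eq_or_eq_neg]

namespace HeunParams

variable (h : HeunParams)

/-- The singular points of a Heun equation. -/
def singPts : Finset (OnePoint ℂ) :=
  ⟨{((0 : ℂ) : OnePoint ℂ), ((1 : ℂ) : OnePoint ℂ), (h.t : OnePoint ℂ), OnePoint.infty}, by
    have h0 := h.t_ne_zero
    have h1 := h.t_ne_one
    simp [h0.symm, h1.symm]⟩

theorem mem_singPts {s : OnePoint ℂ} : s ∈ h.singPts ↔ s = ((0 : ℂ) : OnePoint ℂ) ∨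
    s = ((1 : ℂ) : OnePoint ℂ) ∨ s = (h.t : OnePoint ℂ) ∨ s = OnePoint.infty := by
  rw [← Finset.mem_val]
  simp [singPts]

theorem card_singPts : h.singPts.card = 4 := rfl

theorem regAt_of_notMem {s : OnePoint ℂ} (hs : s ∉ h.singPts) : RegAt h.equation.normalInv s := by
  rw [mem_singPts] at hs
  push Not at hs
  induction s using OnePoint.rec with
  | infty => exact absurd rfl hs.2.2.2
  | coe c =>
    simp only [ne_eq, OnePoint.coe_eq_coe] at hs
    exact h.regAt hs.1 hs.2.1 hs.2.2.1

theorem hasFourSingularities_iff :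
    h.HasFourSingularities ↔ ∀ s ∈ h.singPts, ¬ RegAt h.equation.normalInv s := by
  simp only [HasFourSingularities, LinearODE.isRelevantAt_iff h.isRadicalLogDeriv, mem_singPts,
    forall_eq_or_imp, forall_eq]

theorem expDiffs_map_sq {f : OnePoint ℂ → ℂ}
    (hf : ∀ s, CoeffAt h.equation.normalInv s ((1 - f s) / 4)) :
    h.expDiffs.map (fun x => x ^ 2) = h.singPts.val.map f := by
  have e0 := (hf _).unique h.coeffAt_zero
  have e1 := (hf _).unique h.coeffAt_one
  have et := (hf _).unique h.coeffAt_t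
  have ei := (hf _).unique h.coeffAt_infty
  have e0' : f ((0 : ℂ) : OnePoint ℂ) = (1 - h.c) ^ 2 := by linear_combination -4 * e0
  have e1' : f ((1 : ℂ) : OnePoint ℂ) = (1 - h.d) ^ 2 := by linear_combination -4 * e1
  have et' : f (h.t : OnePoint ℂ) = (h.c + h.d - h.a - h.b) ^ 2 := by linear_combination -4 * et
  have ei' : f OnePoint.infty = (h.a - h.b) ^ 2 := by linear_combination -4 * ei
  simp [expDiffs, singPts, e0', e1', et', ei']

/-- If no exponent difference is `±1`, then all four points are relevant singularities. -/
theorem hasFourSingularities_of_sq_ne_one (hh : ∀ x ∈ h.expDiffs.map (fun x => x ^ 2), x ≠ 1) :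
    h.HasFourSingularities := by
  simp only [expDiffs, Multiset.insert_eq_cons, Multiset.map_cons, Multiset.map_singleton,
    Multiset.mem_cons, Multiset.mem_singleton, forall_eq_or_imp, forall_eq] at hh
  have key : ∀ {s : OnePoint ℂ} {x : ℂ}, CoeffAt h.equation.normalInv s ((1 - x) / 4) → x ≠ 1 →
      ¬ RegAt h.equation.normalInv s := fun hc hx hr =>
    hx (by linear_combination -4 * hc.unique hr.coeffAt)
  rw [hasFourSingularities_iff]
  intro s hs
  rw [mem_singPts] at hs
  rcases hs with rfl | rfl | rfl | rfl
  · exact key h.coeffAt_zero hh.1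
  · exact key h.coeffAt_one hh.2.1
  · exact key h.coeffAt_t hh.2.2.1
  · exact key h.coeffAt_infty hh.2.2.2

end HeunParams

/-- In a pull-back transformation to a non-degenerate Heun equation, the singularities of the
pulled-back equation are four points, with the exponent differences of the Heun equation. -/
theorem exists_singularities {p : Fin 3 → ℂ} {φ : RatFunc ℂ} {h : HeunParams}
    (hh : h.HasFourSingularities) (hpb : PullsBackTo p φ h) :
    ∃ T : Finset (OnePoint ℂ), T.card = 4 ∧
      (∀ s, s ∈ T ↔ ¬ RegAt (pullInv (hypergeometric p).normalInv φ) s) ∧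
      h.expDiffs.map (fun x => x ^ 2) = T.val.map (pullExpSq p φ) := by
  obtain ⟨hφ, M, hM, heq⟩ := (pullsBackTo_iff p φ h).1 hpb
  have hbij := hM.bijective
  refine ⟨h.singPts.map ⟨img M, hbij.1⟩, ?_, fun s => ?_, ?_⟩
  · rw [Finset.card_map, h.card_singPts]
  · obtain ⟨x, rfl⟩ := hbij.2 s
    rw [← hM.regAt_pullInv_iff, heq]
    have : img M x ∈ h.singPts.map ⟨img M, hbij.1⟩ ↔ x ∈ h.singPts :=
      Finset.mem_map' ⟨img M, hbij.1⟩
    rw [this]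
    exact ⟨fun hx => h.hasFourSingularities_iff.1 hh x hx,
      fun hx => by_contra fun hx' => hx (h.regAt_of_notMem hx')⟩
  · rw [Finset.map_val, Multiset.map_map]
    refine h.expDiffs_map_sq fun s => ?_
    rw [← heq]
    exact hM.coeffAt_pullInv (coeffAt_pullInv p hφ _)

/-! ### Construction of Heun equations -/

/-- The accessory parameter `q` enters the invariant linearly, and without effect on the exponent
differences. -/
theorem HeunParams.normalInv_update_q (h : HeunParams) (q : ℂ) :
    ({ h with q := q } : HeunParams).equation.normalInv = h.equation.normalInv +
      RatFunc.C (h.q - q) / (RatFunc.X * (RatFunc.X - 1) * (RatFunc.X - RatFunc.C h.t)) := by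
  simp only [LinearODE.normalInv, HeunParams.equation, map_sub RatFunc.C h.q]
  ring

theorem eq_algebraMap_of_reg {f : RatFunc ℂ} (h : ∀ c : ℂ, Reg (ratComp f (chart c))) :
    f = algebraMap ℂ[X] (RatFunc ℂ) f.num := by
  have h1 : f.denom = 1 := by
    refine (RatFunc.monic_denom f).natDegree_eq_zero.1 ?_
    by_contra h0
    obtain ⟨c, hc⟩ := IsAlgClosed.exists_root f.denom
      (fun hd => h0 (natDegree_eq_zero_iff_degree_le_zero.2 hd.le))
    exact (eval_denom_ne_zero_iff f c).2 (h c) hc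
  conv_lhs => rw [← RatFunc.num_div_denom f, h1, map_one, div_one]

/-- A projective connection with four double poles comes from a Heun equation. -/
theorem exists_heun {A : RatFunc ℂ} {t e₀ e₁ e₂ e₃ : ℂ} (t0 : t ≠ 0) (t1 : t ≠ 1)
    (hreg : ∀ c : ℂ, c ≠ 0 → c ≠ 1 → c ≠ t → RegAt A c)
    (h0 : CoeffAt A ((0 : ℂ) : OnePoint ℂ) ((1 - e₀ ^ 2) / 4))
    (h1 : CoeffAt A ((1 : ℂ) : OnePoint ℂ) ((1 - e₁ ^ 2) / 4))
    (ht : CoeffAt A (t : OnePoint ℂ) ((1 - e₂ ^ 2) / 4))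
    (hi : CoeffAt A OnePoint.infty ((1 - e₃ ^ 2) / 4)) :
    ∃ h : HeunParams, h.t = t ∧ h.equation.normalInv = A ∧
      h.expDiffs = {e₀, e₁, e₂, e₃} := by
  -- A Heun equation with the required exponent differences; its accessory parameter is adjusted at
  -- the end.
  obtain ⟨h, hh⟩ : ∃ h : HeunParams, h = ⟨t, 0, (2 - e₀ - e₁ - e₂ + e₃) / 2,
    (2 - e₀ - e₁ - e₂ - e₃) / 2, 1 - e₀, 1 - e₁, t0, t1⟩ := ⟨_, rfl⟩
  have hX : (RatFunc.X : RatFunc ℂ) ≠ 0 := RatFunc.X_ne_zero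
  have hX1 := X_sub_one_ne_zero
  have hXt := X_sub_C_ne_zero' t
  have htt : h.t = t := by rw [hh]
  have hexp : h.expDiffs = {e₀, e₁, e₂, e₃} := by
    rw [hh]; simp only [HeunParams.expDiffs]
    congr 1
    · ring
    · congr 1
      · ring
      · congr 1
        · ring
        · congr 1; ring
  have k0 := h.coeffAt_zero
  have k1 := h.coeffAt_one
  have kt := h.coeffAt_t
  have ki := h.coeffAt_infty
  rw [htt] at kt
  have g0 : 1 - h.c = e₀ := by rw [hh]; ring
  have g1 : 1 - h.d = e₁ := by rw [hh]; ring
  have gt : h.c + h.d - h.a - h.b = e₂ := by rw [hh]; ring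
  have gi : h.a - h.b = e₃ := by rw [hh]; ring
  rw [g0] at k0
  rw [g1] at k1
  rw [gt] at kt
  rw [gi] at ki
  obtain ⟨D, hD⟩ : ∃ D, D = A - h.equation.normalInv := ⟨_, rfl⟩
  have simple : ∀ {c a : ℂ}, CoeffAt A (c : OnePoint ℂ) a →
      CoeffAt h.equation.normalInv (c : OnePoint ℂ) a → Reg (RatFunc.X * ratComp D (chart c)) := by
    intro c a h1 h2
    obtain ⟨T, hTX, hT⟩ := (nonconst_chart c).exists_hom
    rw [CoeffAt, pullInv_chart_coe, hT] at h1 h2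
    have h3 := h1.sub h2
    rw [sub_self, ← mul_sub, ← map_sub, ← hD, pow_two, mul_assoc] at h3
    obtain ⟨g, hg, hg'⟩ := h3.exists_eq_X_mul
    rw [hT, mul_left_cancel₀ hX hg']
    exact hg
  have hf : ∀ c : ℂ, Reg (ratComp (RatFunc.X * (RatFunc.X - 1) * (RatFunc.X - RatFunc.C t) * D)
      (chart c)) := by
    intro c
    obtain ⟨T, hTX, hT⟩ := (nonconst_chart c).exists_hom
    have hTr : ∀ b, Reg (T (RatFunc.X - RatFunc.C b)) := fun b => by
      rw [map_sub, algHom_C, hTX, chart_coe]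
      exact (reg_X.add (reg_C c)).sub (reg_C b)
    have hT0 : ∀ b, c = b → T (RatFunc.X - RatFunc.C b) = RatFunc.X := fun b hb => by
      rw [map_sub, algHom_C, hTX, chart_coe, hb, add_sub_cancel_right]
    have hTr0 := hTr 0
    have hTr1 := hTr 1
    have hTrt := hTr t
    have hT00 := hT0 0
    have hT01 := hT0 1
    rw [map_zero, sub_zero] at hTr0 hT00
    rw [map_one] at hTr1 hT01
    rw [hT, map_mul, map_mul, map_mul, ← hT D]
    by_cases c0 : c = 0
    · rw [hT00 c0]
      subst c0
      have := (hTr1.mul hTrt).mul (simple h0 k0)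
      convert this using 1; ring
    by_cases c1 : c = 1
    · rw [hT01 c1]
      subst c1
      have := (hTr0.mul hTrt).mul (simple h1 k1)
      convert this using 1; ring
    by_cases ct : c = t
    · rw [hT0 t ct]
      subst ct
      have := (hTr0.mul hTr1).mul (simple ht kt)
      convert this using 1; ring
    · refine ((hTr0.mul hTr1).mul hTrt).mul ?_
      have r1 := hreg c c0 c1 ct
      have r2 := h.regAt c0 c1 (by rwa [htt])
      rw [RegAt, pullInv_chart_coe, hT] at r1 r2
      rw [hT, hD, map_sub]
      exact r1.sub r2
  have hpoly := eq_algebraMap_of_reg hf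
  set f := RatFunc.X * (RatFunc.X - 1) * (RatFunc.X - RatFunc.C t) * D with hfdef
  -- The behaviour at `∞` shows that the polynomial `f` is constant.
  have hdeg : f.num.natDegree = 0 := by
    by_contra hn
    obtain ⟨T, hTX, hT⟩ := nonconst_X_inv.exists_hom
    rw [CoeffAt, chart_infty, pullInv_X_inv, hT] at hi ki
    have h3 := hi.sub ki
    rw [sub_self, ← mul_sub, ← mul_sub, ← map_sub, ← hD] at h3
    have hvt : HasVal (1 - RatFunc.C t * RatFunc.X) (1 - t * 0) :=
      hasVal_one.sub ((hasVal_C t).mul hasVal_X)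
    have h4 : RatFunc.X * T f = (1 - RatFunc.X) * (1 - RatFunc.C t * RatFunc.X) *
        (RatFunc.X ^ 2 * (RatFunc.X⁻¹ ^ 4 * T D)) := by
      rw [hfdef]
      simp only [map_mul, map_sub, map_one, hTX, algHom_C]
      field_simp
    have h5 := (hasVal_one_sub_X.mul hvt).mul h3
    rw [← h4] at h5
    have h6 := algHom_X_inv hTX f.num
    rw [← hpoly] at h6
    obtain ⟨n, hn'⟩ := Nat.exists_eq_succ_of_ne_zero hn
    have h7 := h5.mul (hasVal_X.pow n)
    have h8 : RatFunc.X * T f * RatFunc.X ^ n = algebraMap ℂ[X] (RatFunc ℂ) f.num.reverse := by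
      rw [← h6, hn', Nat.succ_eq_add_one, pow_succ]; ring
    rw [h8] at h7
    have h9 := h7.unique (hasVal_algebraMap f.num.reverse)
    rw [← coeff_zero_eq_eval_zero, coeff_zero_reverse] at h9
    have : f.num.leadingCoeff ≠ 0 := by
      rw [leadingCoeff_ne_zero]; rintro h0; rw [h0] at hn; simp at hn
    exact this (by rw [← h9]; ring)
  rw [natDegree_eq_zero] at hdeg
  obtain ⟨κ, hκ⟩ := hdeg
  rw [← hκ, RatFunc.algebraMap_C] at hpoly
  refine ⟨{ h with q := -κ }, htt, ?_, hexp⟩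
  have hq : h.q = 0 := by rw [hh]
  rw [HeunParams.normalInv_update_q, hq, htt, zero_sub, neg_neg, ← hpoly, hfdef, hD]
  field_simp
  ring

/-- A pull-back with exactly four singularities is a Heun equation. -/
theorem exists_pullsBackTo {p : Fin 3 → ℂ} {φ : RatFunc ℂ} (hφ : Nonconst φ)
    {T : Finset (OnePoint ℂ)} (hT : T.card = 4)
    (hreg : ∀ s ∉ T, RegAt (pullInv (hypergeometric p).normalInv φ) s) :
    ∃ h : HeunParams, PullsBackTo p φ h ∧
      h.expDiffs.map (fun x => x ^ 2) = T.val.map (pullExpSq p φ) := by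
  classical
  obtain ⟨s₀, T', hs₀, rfl, hT'⟩ := Finset.card_eq_succ_iff_cons.1 hT
  obtain ⟨s₁, s₂, s₃, h12, h13, h23, rfl⟩ := Finset.card_eq_three.1 hT'
  simp only [Finset.mem_insert, Finset.mem_singleton, not_or] at hs₀
  obtain ⟨h01, h02, h03⟩ := hs₀
  obtain ⟨M, hM, m0, m1, mi⟩ := exists_moebius h01 h03 h13
  have hbij := hM.bijective
  obtain ⟨y, hy⟩ := hbij.2 s₂
  have hne : y ≠ OnePoint.infty := by rintro rfl; exact h23 (hy.symm.trans mi)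
  obtain ⟨t, rfl⟩ := OnePoint.ne_infty_iff_exists.1 hne
  have t0 : t ≠ 0 := by rintro rfl; exact h02 (m0.symm.trans hy)
  have t1 : t ≠ 1 := by rintro rfl; exact h12 (m1.symm.trans hy)
  have hsqrt : ∀ s, ∃ e : ℂ, e ^ 2 = pullExpSq p φ s := fun s =>
    IsAlgClosed.exists_pow_nat_eq _ two_pos
  choose e he using hsqrt
  have hc : ∀ x, CoeffAt (pullInv (pullInv (hypergeometric p).normalInv φ) M) x
      ((1 - e (img M x) ^ 2) / 4) := fun x => by
    rw [he]; exact hM.coeffAt_pullInv (coeffAt_pullInv p hφ _)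
  obtain ⟨h, -, heq, hexp⟩ := exists_heun t0 t1 (fun c c0 c1 ct => by
    rw [hM.regAt_pullInv_iff]
    refine hreg _ fun hmem => ?_
    rw [Finset.mem_cons, Finset.mem_insert, Finset.mem_insert, Finset.mem_singleton, ← m0, ← m1,
      ← mi, ← hy, hbij.1.eq_iff, hbij.1.eq_iff, hbij.1.eq_iff, hbij.1.eq_iff] at hmem
    simp only [OnePoint.coe_eq_coe, OnePoint.coe_ne_infty] at hmem
    tauto) (hc _) (hc _) (hc _) (hc _)
  refine ⟨h, (pullsBackTo_iff p φ h).2 ⟨hφ, M, hM, heq.symm⟩, ?_⟩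
  rw [hexp, m0, m1, hy, mi, Finset.cons_val, Finset.insert_val_of_notMem (by simp [h12, h13]),
    Finset.insert_val_of_notMem (by simp [h23])]
  simp [he]

/-! ### The possible branching patterns -/

theorem fiberPartition_of_const {φ : RatFunc ℂ} (h : ¬ Nonconst φ) (z : OnePoint ℂ) :
    fiberPartition φ z = 0 := by
  rw [nonconst_iff, not_lt, Nat.le_zero] at h
  have h1 : (fiberPoly φ z).natDegree = 0 := Nat.le_zero.1 (h ▸ natDegree_fiberPoly_le φ z)
  obtain ⟨c, hc⟩ := natDegree_eq_zero.1 h1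
  simp [fiberPartition, ← hc, h]

theorem zero_notMem_fiberPartition (φ : RatFunc ℂ) (z : OnePoint ℂ) : 0 ∉ fiberPartition φ z := by
  by_cases h : Nonconst φ
  · rw [fiberPartition_eq_map_ramIdx h, Multiset.mem_map]
    rintro ⟨s, -, hs⟩
    exact (ramIdx_pos h s).ne' hs
  · rw [fiberPartition_of_const h]; simp

theorem count_fiberPartition {φ : RatFunc ℂ} (h : Nonconst φ) (z : OnePoint ℂ) (k : ℕ) :
    (fiberPartition φ z).count k = ((fib φ z).filter fun s => ramIdx φ s = k).card := by
  rw [fiberPartition_eq_map_ramIdx h, Multiset.count_map]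
  simp only [eq_comm (a := k)]
  rfl

theorem mul_count_le {A : Multiset ℕ} (k : ℕ) : k * A.count k ≤ A.sum := by
  obtain ⟨B, hB⟩ := Multiset.le_iff_exists_add.1 (Multiset.le_count_iff_replicate_le.1 le_rfl :
    Multiset.replicate (A.count k) k ≤ A)
  conv_rhs => rw [hB]
  rw [Multiset.sum_add, Multiset.sum_replicate, smul_eq_mul, mul_comm]
  exact Nat.le_add_right _ _

theorem card_nonExc_add {φ : RatFunc ℂ} (hφ : Nonconst φ) (j₀ : Fin 3) (k : ℕ) :
    (nonExc φ j₀ k).card + (fiberPartition φ (singPt j₀)).count k =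
      ∑ j, (fib φ (singPt j)).card := by
  have h1 : (fiberPartition φ (singPt j₀)).count k =
      ∑ j, ((fib φ (singPt j)).filter fun s => j = j₀ ∧ ramIdx φ s = k).card := by
    rw [Finset.sum_eq_single j₀, count_fiberPartition hφ]
    · simp
    · intro j _ hj; simp [hj]
    · simp
  rw [Finset.card_eq_sum_ones, sum_nonExc hφ, h1, ← Finset.sum_add_distrib]
  refine Finset.sum_congr rfl fun j _ => ?_
  rw [← Finset.card_eq_sum_ones, add_comm]
  exact Finset.card_filter_add_card_filter_not _

/-- The counting of singular points.  There are no branching points outside of the three fibres, and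
the degree is determined by the number of points of the fibres that are not singular. -/
theorem Controlled.pattern {p : Fin 3 → ℂ} {φ : RatFunc ℂ} {h : HeunParams} {j₀ : Fin 3} {k : ℕ}
    (hp : Controlled p (ratDegree φ) j₀ k) (hh : h.HasFourSingularities)
    (hpb : PullsBackTo p φ h) :
    ∑ j, Multiset.card (fiberPartition φ (singPt j)) = ratDegree φ + 2 ∧
      ratDegree φ = (fiberPartition φ (singPt j₀)).count k + 2 ∧
      h.expDiffs.map (fun x => x ^ 2) =
        ∑ j, ((fiberPartition φ (singPt j)).filter fun m => ¬ (j = j₀ ∧ m = k)).map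
          fun m : ℕ => (m * expDiff p j) ^ 2 := by
  classical
  have hφ : Nonconst φ := ((pullsBackTo_iff p φ h).1 hpb).1
  have hd := nonconst_iff.1 hφ
  obtain ⟨T, hT4, hT, hexp⟩ := exists_singularities hh hpb
  obtain ⟨U, hU, hRH⟩ := exists_off hφ
  have hTU : T = nonExc φ j₀ k ∪ U := by
    ext s
    rw [hT, Finset.mem_union, mem_nonExc hφ, hU]
    by_cases hs : ∃ j, img φ s = singPt j
    · obtain ⟨j, hj⟩ := hs
      rw [hp.regAt_iff hφ hj]
      constructor
      · exact fun h1 => Or.inl ⟨j, hj, h1⟩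
      · rintro (⟨i, hi, h1⟩ | ⟨h1, -⟩)
        · rwa [singPt_injective (hj.symm.trans hi)]
        · exact absurd hj (h1 j)
    · push Not at hs
      rw [regAt_pullInv_of_off p hφ hs]
      constructor
      · exact fun h1 => Or.inr ⟨hs, h1⟩
      · rintro (⟨i, hi, -⟩ | ⟨-, h1⟩)
        · exact absurd hi (hs i)
        · exact h1
  have hdisj : Disjoint (nonExc φ j₀ k) U := by
    rw [Finset.disjoint_left]
    intro s hs hs'
    obtain ⟨j, hj, -⟩ := (mem_nonExc hφ).1 hs
    exact ((hU s).1 hs').1 j hj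
  have hcard := card_nonExc_add hφ j₀ k
  have hle : U.card ≤ ∑ s ∈ U, (ramIdx φ s - 1) := by
    rw [Finset.card_eq_sum_ones]
    refine Finset.sum_le_sum fun s hs => ?_
    have := ((hU s).1 hs).2
    have := ramIdx_pos hφ s
    omega
  have hkn := mul_count_le (A := fiberPartition φ (singPt j₀)) k
  rw [sum_fiberPartition hφ] at hkn
  -- The Riemann–Hurwitz formula gives `d + 2 #U ≤ 2 + n`, where `n` is the number of points with
  -- the branching index `k ≥ 2`.  Since `2 n ≤ d`, there is no room for points in `U`.
  have hkn' : 2 * (fiberPartition φ (singPt j₀)).count k ≤ ratDegree φ := by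
    obtain rfl | hk := Nat.eq_zero_or_pos k
    · rw [Multiset.count_eq_zero_of_notMem (zero_notMem_fiberPartition _ _)]; omega
    · have := hp.ne_one
      exact (Nat.mul_le_mul_right _ (by omega)).trans hkn
  have h4 := hT4
  rw [hTU, Finset.card_union_of_disjoint hdisj] at h4
  have hU0 : U = ∅ := by
    by_contra hne
    have := Finset.card_pos.2 (Finset.nonempty_iff_ne_empty.2 hne)
    omega
  rw [hU0, Finset.sum_empty, add_zero] at hRH
  rw [hU0, Finset.card_empty] at h4
  simp only [card_fiberPartition]
  refine ⟨hRH, by omega, ?_⟩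
  rw [hexp, hTU, hU0, Finset.union_empty]
  exact map_nonExc hφ p

theorem multiset_eq_cons_of_sum {A : Multiset ℕ} {n : ℕ} (h0 : 0 ∉ A) (hs : A.sum = n + 1) :
    ∃ a B, A = a ::ₘ B ∧ 1 ≤ a ∧ a ≤ n + 1 ∧ 0 ∉ B ∧ B.sum = n + 1 - a := by
  obtain ⟨a, ha⟩ : ∃ a, a ∈ A := Multiset.exists_mem_of_ne_zero (by rintro rfl; simp at hs)
  obtain ⟨B, rfl⟩ := Multiset.exists_cons_of_mem ha
  rw [Multiset.mem_cons, not_or] at h0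
  rw [Multiset.sum_cons] at hs
  exact ⟨a, B, rfl, by omega, by omega, h0.2, by omega⟩

theorem multiset_eq_of_sum_zero {A : Multiset ℕ} (h0 : 0 ∉ A) (hs : A.sum = 0) : A = 0 :=
  Multiset.eq_zero_of_forall_notMem fun a ha =>
    h0 ((Multiset.sum_eq_zero_iff.1 hs a ha) ▸ ha)

theorem multiset_eq_of_sum_one {A : Multiset ℕ} (h0 : 0 ∉ A) (hs : A.sum = 1) : A = {1} := by
  obtain ⟨a, B, rfl, h1, h2, hB, hsB⟩ := multiset_eq_cons_of_sum h0 hs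
  interval_cases a
  rw [multiset_eq_of_sum_zero hB hsB]; rfl

theorem multiset_eq_of_sum_two {A : Multiset ℕ} (h0 : 0 ∉ A) (hs : A.sum = 2) :
    A = {2} ∨ A = {1, 1} := by
  obtain ⟨a, B, rfl, h1, h2, hB, hsB⟩ := multiset_eq_cons_of_sum h0 hs
  interval_cases a
  · rw [multiset_eq_of_sum_one hB hsB]; decide
  · rw [multiset_eq_of_sum_zero hB hsB]; decide

theorem multiset_eq_of_sum_three {A : Multiset ℕ} (h0 : 0 ∉ A) (hs : A.sum = 3) :
    A = {3} ∨ A = {2, 1} ∨ A = {1, 1, 1} := by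
  obtain ⟨a, B, rfl, h1, h2, hB, hsB⟩ := multiset_eq_cons_of_sum h0 hs
  interval_cases a
  · rcases multiset_eq_of_sum_two hB hsB with rfl | rfl <;> decide
  · rw [multiset_eq_of_sum_one hB hsB]; decide
  · rw [multiset_eq_of_sum_zero hB hsB]; decide

theorem multiset_eq_of_sum_four {A : Multiset ℕ} (h0 : 0 ∉ A) (hs : A.sum = 4) :
    A = {4} ∨ A = {3, 1} ∨ A = {2, 2} ∨ A = {2, 1, 1} ∨ A = {1, 1, 1, 1} := by
  obtain ⟨a, B, rfl, h1, h2, hB, hsB⟩ := multiset_eq_cons_of_sum h0 hs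
  interval_cases a
  · rcases multiset_eq_of_sum_three hB hsB with rfl | rfl | rfl <;> decide
  · rcases multiset_eq_of_sum_two hB hsB with rfl | rfl <;> decide
  · rw [multiset_eq_of_sum_one hB hsB]; decide
  · rw [multiset_eq_of_sum_zero hB hsB]; decide

theorem sum_comp_perm {α : Type*} [AddCommMonoid α] (σ : Equiv.Perm (Fin 3)) (f : Fin 3 → α) :
    ∑ j, f j = f (σ 0) + f (σ 1) + f (σ 2) := by
  rw [← Equiv.sum_comp σ, Fin.sum_univ_three]

/-- A covering of degree two with four points in the three fibres has the quadratic pattern. -/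
theorem pattern_quadratic {A : Fin 3 → Multiset ℕ} (h0 : ∀ j, 0 ∉ A j) (hs : ∀ j, (A j).sum = 2)
    (hc : ∑ j, Multiset.card (A j) = 4) :
    ∃ σ : Equiv.Perm (Fin 3), ∀ j, A (σ j) = quadraticPattern j := by
  have key : ∀ i, A i = {1, 1} → (∀ j, j ≠ i → A j = {2}) →
      ∃ σ : Equiv.Perm (Fin 3), ∀ j, A (σ j) = quadraticPattern j := by
    intro i hi hj
    refine ⟨Equiv.swap 1 i, fun j => ?_⟩
    fin_cases j
    · exact hj _ fun h => by
        have := (Equiv.swap (1 : Fin 3) i).injective (h.trans (Equiv.swap_apply_left 1 i).symm)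
        exact absurd this (by decide)
    · change A (Equiv.swap 1 i 1) = {1, 1}
      rw [Equiv.swap_apply_left, hi]
    · exact hj _ fun h => by
        have := (Equiv.swap (1 : Fin 3) i).injective (h.trans (Equiv.swap_apply_left 1 i).symm)
        exact absurd this (by decide)
  rw [Fin.sum_univ_three] at hc
  rcases multiset_eq_of_sum_two (h0 0) (hs 0) with e0 | e0 <;>
  rcases multiset_eq_of_sum_two (h0 1) (hs 1) with e1 | e1 <;>
  rcases multiset_eq_of_sum_two (h0 2) (hs 2) with e2 | e2 <;>
  simp only [e0, e1, e2, Multiset.card_singleton, Multiset.card_pair] at hc <;>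
  first
  | omega
  | exact key 0 e0 fun j hj => by fin_cases j <;> first | exact absurd rfl hj | assumption
  | exact key 1 e1 fun j hj => by fin_cases j <;> first | exact absurd rfl hj | assumption
  | exact key 2 e2 fun j hj => by fin_cases j <;> first | exact absurd rfl hj | assumption

theorem exists_perm_zero (j₀ : Fin 3) : ∃ σ σ' : Equiv.Perm (Fin 3),
    σ 0 = j₀ ∧ σ' 0 = j₀ ∧ σ' 1 = σ 2 ∧ σ' 2 = σ 1 := by
  refine ⟨Equiv.swap 0 j₀, Equiv.swap 0 j₀ * Equiv.swap 1 2, Equiv.swap_apply_left _ _, ?_, ?_, ?_⟩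
  · exact Equiv.swap_apply_left 0 j₀
  · rw [Equiv.Perm.mul_apply, Equiv.swap_apply_left]
  · rw [Equiv.Perm.mul_apply, Equiv.swap_apply_right]

/-- The list of patterns. If `n > 0` is the number of points with branching index `k ≥ 2` above the
first point, then `k n ≤ d = n + 2` leaves the cases `k = 2`, `n ≤ 2` and `k = 3`, `n = 1`. -/
theorem pattern_table {A : Fin 3 → Multiset ℕ} {d k : ℕ} {j₀ : Fin 3} (h0 : ∀ j, 0 ∉ A j)
    (hs : ∀ j, (A j).sum = d) (hc : ∑ j, Multiset.card (A j) = d + 2) (hk : k ≠ 1)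
    (hd : d = (A j₀).count k + 2) (hn : (A j₀).count k ≠ 0) :
    ∃ r ∈ table, r.k = k ∧ r.deg = d ∧
      ∃ σ : Equiv.Perm (Fin 3), σ 0 = j₀ ∧ ∀ j, A (σ j) = r.pattern j := by
  obtain ⟨σ, σ', h1, h2, h3, h4⟩ := exists_perm_zero j₀
  have row : ∀ {A₀ A₁ A₂ : Multiset ℕ} {κ δ : ℕ} {f : ℂ → ℂ → Multiset ℂ} {c : Composition},
      (⟨κ, f, δ, ![A₀, A₁, A₂], c⟩ : TableRow) ∈ table → κ = k → δ = d → A j₀ = A₀ →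
      (A (σ 1) = A₁ ∧ A (σ 2) = A₂ ∨ A (σ 1) = A₂ ∧ A (σ 2) = A₁) →
      ∃ r ∈ table, r.k = k ∧ r.deg = d ∧
        ∃ σ : Equiv.Perm (Fin 3), σ 0 = j₀ ∧ ∀ j, A (σ j) = r.pattern j := by
    rintro A₀ A₁ A₂ κ δ f c hmem hκ hδ e0 (⟨e1, e2⟩ | ⟨e1, e2⟩)
    · refine ⟨_, hmem, hκ, hδ, σ, h1, fun j => ?_⟩
      fin_cases j
      · change A (σ 0) = A₀; rw [h1, e0]
      · exact e1
      · exact e2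
    · refine ⟨_, hmem, hκ, hδ, σ', h2, fun j => ?_⟩
      fin_cases j
      · change A (σ' 0) = A₀; rw [h2, e0]
      · change A (σ' 1) = A₁; rw [h3, e2]
      · change A (σ' 2) = A₂; rw [h4, e1]
  have hk0 : k ≠ 0 := by
    rintro rfl
    exact hn (Multiset.count_eq_zero_of_notMem (h0 j₀))
  have hkn := mul_count_le (A := A j₀) k
  rw [hs] at hkn
  rw [sum_comp_perm σ, h1] at hc
  obtain ⟨n, hn'⟩ : ∃ n, n = (A j₀).count k := ⟨_, rfl⟩
  rw [← hn'] at hd hn hkn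
  have hk3 : k ≤ 3 := by
    by_contra hk3
    have : 4 * n ≤ k * n := Nat.mul_le_mul_right _ (by omega)
    omega
  have hn2 : n ≤ 2 := by
    have : 2 * n ≤ k * n := Nat.mul_le_mul_right _ (by omega)
    omega
  have t0 := h0 j₀
  have t1 := h0 (σ 1)
  have t2 := h0 (σ 2)
  have u0 := hs j₀
  have u1 := hs (σ 1)
  have u2 := hs (σ 2)
  have hmem : ∀ (i : ℕ) (hi : i < 7), table[i] ∈ table := fun i hi => List.getElem_mem hi
  generalize A j₀ = A₀ at *
  generalize A (σ 1) = A₁ at *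
  generalize A (σ 2) = A₂ at *
  interval_cases k
  · exact absurd rfl hk0
  · exact absurd rfl hk
  · interval_cases n
    · exact absurd rfl hn
    · obtain rfl : d = 3 := hd
      rcases multiset_eq_of_sum_three t0 u0 with rfl | rfl | rfl
      · exact absurd hn' (by decide)
      · rcases multiset_eq_of_sum_three t1 u1 with rfl | rfl | rfl <;>
        rcases multiset_eq_of_sum_three t2 u2 with rfl | rfl | rfl <;>
        first
        | exact absurd hc (by decide)
        | exact row (hmem 0 (by decide)) rfl rfl rfl (Or.inl ⟨rfl, rfl⟩)
        | exact row (hmem 0 (by decide)) rfl rfl rfl (Or.inr ⟨rfl, rfl⟩)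
      · exact absurd hn' (by decide)
    · obtain rfl : d = 4 := hd
      rcases multiset_eq_of_sum_four t0 u0 with rfl | rfl | rfl | rfl | rfl
      · exact absurd hn' (by decide)
      · exact absurd hn' (by decide)
      · rcases multiset_eq_of_sum_four t1 u1 with rfl | rfl | rfl | rfl | rfl <;>
        rcases multiset_eq_of_sum_four t2 u2 with rfl | rfl | rfl | rfl | rfl <;>
        first
        | exact absurd hc (by decide)
        | exact row (hmem 1 (by decide)) rfl rfl rfl (Or.inl ⟨rfl, rfl⟩)
        | exact row (hmem 1 (by decide)) rfl rfl rfl (Or.inr ⟨rfl, rfl⟩)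
        | exact row (hmem 2 (by decide)) rfl rfl rfl (Or.inl ⟨rfl, rfl⟩)
        | exact row (hmem 3 (by decide)) rfl rfl rfl (Or.inl ⟨rfl, rfl⟩)
        | exact row (hmem 3 (by decide)) rfl rfl rfl (Or.inr ⟨rfl, rfl⟩)
        | exact row (hmem 4 (by decide)) rfl rfl rfl (Or.inl ⟨rfl, rfl⟩)
      · exact absurd hn' (by decide)
      · exact absurd hn' (by decide)
  · obtain rfl : n = 1 := by omega
    obtain rfl : d = 3 := hd
    rcases multiset_eq_of_sum_three t0 u0 with rfl | rfl | rfl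
    · rcases multiset_eq_of_sum_three t1 u1 with rfl | rfl | rfl <;>
      rcases multiset_eq_of_sum_three t2 u2 with rfl | rfl | rfl <;>
      first
      | exact absurd hc (by decide)
      | exact row (hmem 5 (by decide)) rfl rfl rfl (Or.inl ⟨rfl, rfl⟩)
      | exact row (hmem 6 (by decide)) rfl rfl rfl (Or.inl ⟨rfl, rfl⟩)
      | exact row (hmem 6 (by decide)) rfl rfl rfl (Or.inr ⟨rfl, rfl⟩)
    · exact absurd hn' (by decide)
    · exact absurd hn' (by decide)

/-! ### Exponent differences of the pulled-back equations -/

theorem quadratic_diffs (e : Fin 3 → ℂ) :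
    ∑ j, ((quadraticPattern j).filter fun m => ¬ (j = 0 ∧ m = 0)).map
      (fun m : ℕ => (m * e j) ^ 2) = (quadraticDiffs (e 0) (e 1) (e 2)).map fun x => x ^ 2 := by
  rw [Fin.sum_univ_three]
  simp [quadraticPattern, quadraticDiffs, Multiset.filter_singleton,
    ← Multiset.singleton_add, add_assoc]

theorem table_diffs {r : TableRow} (hr : r ∈ table) (e : Fin 3 → ℂ) (he : (r.k * e 0) ^ 2 = 1) :
    ∑ j, ((r.pattern j).filter fun m => ¬ (j = 0 ∧ m = r.k)).map
      (fun m : ℕ => (m * e j) ^ 2) = (r.heunDiffs (e 1) (e 2)).map fun x => x ^ 2 := by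
  rw [Fin.sum_univ_three]
  simp only [table, List.mem_cons, List.not_mem_nil, or_false] at hr
  rcases hr with rfl | rfl | rfl | rfl | rfl | rfl | rfl
  case inl =>
    have h2 : (2⁻¹ : ℂ) ^ 2 = e 0 ^ 2 := by
      push_cast at he; linear_combination -(1 / 4 : ℂ) * he
    simp [← h2, Multiset.filter_singleton, ← Multiset.singleton_add, add_assoc]
    abel
  all_goals
    simp [Multiset.filter_singleton, ← Multiset.singleton_add, add_assoc]
    try abel

/-- The pull-back transformations to non-degenerate Heun equations for controlled exponent
differences. -/
theorem Controlled.classification {p : Fin 3 → ℂ} {φ : RatFunc ℂ} {h : HeunParams} {j₀ : Fin 3}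
    {k : ℕ} (hp : Controlled p (ratDegree φ) j₀ k) (hh : h.HasFourSingularities)
    (hpb : PullsBackTo p φ h) :
    (ratDegree φ = 2 ∧ ∃ σ, HasPattern φ σ quadraticPattern ∧
      EqUpToSign h.expDiffs
        (quadraticDiffs (expDiff p (σ 0)) (expDiff p (σ 1)) (expDiff p (σ 2)))) ∨
    k ≠ 0 ∧ ∃ r ∈ table, r.k = k ∧ ∃ σ : Equiv.Perm (Fin 3), σ 0 = j₀ ∧ ratDegree φ = r.deg ∧
      HasPattern φ σ r.pattern ∧
      EqUpToSign h.expDiffs (r.heunDiffs (expDiff p (σ 1)) (expDiff p (σ 2))) := by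
  have hφ : Nonconst φ := ((pullsBackTo_iff p φ h).1 hpb).1
  obtain ⟨hc, hd, he⟩ := hp.pattern hh hpb
  have h0 : ∀ j, 0 ∉ fiberPartition φ (singPt j) := fun j => zero_notMem_fiberPartition φ _
  by_cases hn : (fiberPartition φ (singPt j₀)).count k = 0
  · rw [hn, zero_add] at hd
    obtain ⟨σ, hσ⟩ := pattern_quadratic h0 (fun j => (sum_fiberPartition hφ _).trans hd)
      (by rw [hc, hd])
    refine Or.inl ⟨hd, σ, hσ, eqUpToSign_iff.2 ?_⟩
    rw [he]
    have key := quadratic_diffs fun i => expDiff p (σ i)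
    rw [← key, ← Equiv.sum_comp σ]
    refine Finset.sum_congr rfl fun i _ => ?_
    rw [← hσ i]
    congr 1
    refine Multiset.filter_congr fun m hm => ?_
    have hm0 : m ≠ 0 := fun h1 => h0 _ (h1 ▸ hm)
    have hmk : ¬ (σ i = j₀ ∧ m = k) := by
      rintro ⟨rfl, rfl⟩
      exact Multiset.count_ne_zero.2 hm hn
    simp [hm0, hmk]
  · have hk : k ≠ 0 := by
      rintro rfl
      exact hn (Multiset.count_eq_zero_of_notMem (h0 j₀))
    obtain ⟨r, hr, hrk, hrd, σ, hσ0, hσ⟩ := pattern_table h0 (fun j => sum_fiberPartition hφ _) hc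
      hp.ne_one hd hn
    refine Or.inr ⟨hk, r, hr, hrk, σ, hσ0, hrd.symm, hσ, eqUpToSign_iff.2 ?_⟩
    have key := table_diffs hr (fun i => expDiff p (σ i)) (by
      rw [hrk, hσ0]; exact hp.sq_eq hk)
    rw [he, ← key, ← Equiv.sum_comp σ]
    refine Finset.sum_congr rfl fun i _ => ?_
    rw [hσ i, hrk, ← hσ0]
    simp only [σ.injective.eq_iff]

/-! ### The transformations along the coverings of a given pattern -/

/-- The local exponent differences of the hypergeometric equation as polynomials in the
parameters. -/
def expDiffPoly : Fin 3 → MvPolynomial (Fin 3) ℂ :=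
  ![1 - MvPolynomial.X 2, MvPolynomial.X 2 - MvPolynomial.X 0 - MvPolynomial.X 1,
    MvPolynomial.X 0 - MvPolynomial.X 1]

@[simp]
theorem eval_expDiffPoly (p : Fin 3 → ℂ) (j : Fin 3) :
    MvPolynomial.eval p (expDiffPoly j) = expDiff p j := by
  fin_cases j <;> simp [expDiffPoly, expDiff]

theorem exists_expDiff_eq (e : Fin 3 → ℂ) : ∃ p, expDiff p = e := by
  refine ⟨![(1 - e 0 - e 1 + e 2) / 2, (1 - e 0 - e 1 - e 2) / 2, 1 - e 0], ?_⟩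
  ext j
  fin_cases j <;> simp [expDiff] <;> ring

theorem nonconst_of_hasPattern {φ : RatFunc ℂ} {σ : Equiv.Perm (Fin 3)} {A : Fin 3 → Multiset ℕ}
    (hφ : HasPattern φ σ A) (j : Fin 3) (hA : (A j).sum ≠ 0) : Nonconst φ := by
  by_contra h
  rw [← hφ j, fiberPartition_of_const h] at hA
  exact hA rfl

theorem ratDegree_of_hasPattern {φ : RatFunc ℂ} {σ : Equiv.Perm (Fin 3)} {A : Fin 3 → Multiset ℕ}
    (hφ : HasPattern φ σ A) (j : Fin 3) (hA : (A j).sum ≠ 0) : ratDegree φ = (A j).sum := by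
  rw [← hφ j, sum_fiberPartition (nonconst_of_hasPattern hφ j hA)]

/-- The numerical conditions on a branching pattern of degree `d` under which there are no further
branching points, and four points remain besides those with the branching index `k` above the first
point. -/
structure Admissible (A : Fin 3 → Multiset ℕ) (d k : ℕ) : Prop where
  pos : 0 < d
  sum_eq : ∀ j, (A j).sum = d
  sum_card : ∑ j, Multiset.card (A j) = d + 2
  count_eq : d = (A 0).count k + 2
  ne_one : k ≠ 1

theorem admissible_quadraticPattern : Admissible quadraticPattern 2 0 :=
  ⟨by decide, by decide, by decide, by decide, by decide⟩

theorem admissible_of_mem_table {r : TableRow} (hr : r ∈ table) :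
    Admissible r.pattern r.deg r.k := by
  simp only [table, List.mem_cons, List.not_mem_nil, or_false] at hr
  rcases hr with rfl | rfl | rfl | rfl | rfl | rfl | rfl <;>
  exact ⟨by decide, by decide, by decide, by decide, by decide⟩

section

variable {φ : RatFunc ℂ} {σ : Equiv.Perm (Fin 3)} {A : Fin 3 → Multiset ℕ} {d k : ℕ}

theorem Admissible.nonconst (hA : Admissible A d k) (hφ : HasPattern φ σ A) : Nonconst φ :=
  nonconst_of_hasPattern hφ 0 (by rw [hA.sum_eq]; exact hA.pos.ne')

theorem Admissible.ratDegree_eq (hA : Admissible A d k) (hφ : HasPattern φ σ A) :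
    ratDegree φ = d := by
  rw [ratDegree_of_hasPattern hφ 0 (by rw [hA.sum_eq]; exact hA.pos.ne'), hA.sum_eq]

/-- A covering with an admissible branching pattern does not ramify outside of the three fibres. -/
theorem Admissible.ramIdx_eq_one (hA : Admissible A d k) (hφ : HasPattern φ σ A) {s : OnePoint ℂ}
    (hs : ∀ j, img φ s ≠ singPt j) : ramIdx φ s = 1 := by
  have hn := hA.nonconst hφ
  obtain ⟨U, hU, hRH⟩ := exists_off hn
  by_contra h
  have hsU := (hU s).2 ⟨hs, h⟩
  have h1 := Finset.single_le_sum (f := fun s => ramIdx φ s - 1) (fun _ _ => Nat.zero_le _) hsU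
  have h2 := ramIdx_pos hn s
  simp only [← card_fiberPartition] at hRH
  rw [← Equiv.sum_comp σ, Finset.sum_congr rfl fun j _ => congrArg Multiset.card (hφ j),
    hA.sum_card, hA.ratDegree_eq hφ] at hRH
  omega

/-- The squares of the exponent differences of the pull-back. -/
def pullExpSqs (σ : Equiv.Perm (Fin 3)) (A : Fin 3 → Multiset ℕ) (k : ℕ) (p : Fin 3 → ℂ) :
    Multiset ℂ :=
  ∑ j, ((A j).filter fun m => ¬ (j = 0 ∧ m = k)).map fun m : ℕ => (m * expDiff p (σ j)) ^ 2

/-- The pull-back of a hypergeometric equation along a covering with an admissible pattern has at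
most four singularities, and is a Heun equation. -/
theorem Admissible.exists_pullsBackTo (hA : Admissible A d k) (hφ : HasPattern φ σ A)
    {p : Fin 3 → ℂ} (hp : k ≠ 0 → (k * expDiff p (σ 0)) ^ 2 = 1) :
    ∃ h : HeunParams, PullsBackTo p φ h ∧
      h.expDiffs.map (fun x => x ^ 2) = pullExpSqs σ A k p := by
  have hn := hA.nonconst hφ
  have hT : (nonExc φ (σ 0) k).card = 4 := by
    have h1 := card_nonExc_add hn (σ 0) k
    simp only [← card_fiberPartition] at h1
    rw [← Equiv.sum_comp σ, Finset.sum_congr rfl fun j _ => congrArg Multiset.card (hφ j),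
      hA.sum_card, hφ 0] at h1
    have := hA.count_eq
    omega
  obtain ⟨h, hpb, hexp⟩ := HeunPullback.exists_pullsBackTo (p := p) hn hT fun s hs => by
    by_cases hj : ∃ j, img φ s = singPt j
    · obtain ⟨j, hj⟩ := hj
      rw [mem_nonExc hn] at hs
      push Not at hs
      obtain ⟨rfl, hk⟩ := hs j hj
      refine regAt_pullInv_of_exceptional p hn hj (hk ▸ hA.ne_one) ?_
      rw [hk]
      exact hp (hk ▸ (ramIdx_pos hn s).ne')
    · push Not at hj
      exact (regAt_pullInv_of_off p hn hj).2 (hA.ramIdx_eq_one hφ hj)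
  refine ⟨h, hpb, ?_⟩
  rw [hexp, map_nonExc hn, ← Equiv.sum_comp σ]
  refine Finset.sum_congr rfl fun j _ => ?_
  rw [hφ j]
  simp only [σ.injective.eq_iff]

/-- The pull-backs are non-degenerate for generic parameters, since the exponent differences at the
four remaining points differ from `±1` in general. The point of `W` whose free exponent differences
are `5` shows that this is not excluded on `W`: the number `5 m` is never `±1`. -/
theorem Admissible.genericOn (hA : Admissible A d k) (hφ : HasPattern φ σ A)
    {W : Set (Fin 3 → ℂ)} (hW : ∀ p ∈ W, k ≠ 0 → (k * expDiff p (σ 0)) ^ 2 = 1)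
    (hpt : ∃ p ∈ W, expDiff p (σ 1) = 5 ∧ expDiff p (σ 2) = 5 ∧ (k = 0 → expDiff p (σ 0) = 5)) :
    GenericOn W fun p => ∃ h : HeunParams, h.HasFourSingularities ∧ PullsBackTo p φ h := by
  obtain ⟨F, hF⟩ : ∃ F : MvPolynomial (Fin 3) ℂ, ∀ p, MvPolynomial.eval p F ≠ 0 ↔
      ∀ x ∈ pullExpSqs σ A k p, x ≠ 1 := by
    refine ⟨∏ j, (((A j).filter fun m => ¬ (j = 0 ∧ m = k)).map fun m : ℕ =>
      ((m : MvPolynomial (Fin 3) ℂ) * expDiffPoly (σ j)) ^ 2 - 1).prod, fun p => ?_⟩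
    rw [map_prod, Finset.prod_ne_zero_iff]
    simp only [map_multiset_prod, Multiset.map_map, ne_eq, Multiset.prod_eq_zero_iff, pullExpSqs,
      Multiset.mem_sum, Multiset.mem_map, Function.comp_apply, map_sub, map_pow, map_mul,
      map_natCast, eval_expDiffPoly, map_one, sub_eq_zero]
    constructor
    · rintro h x ⟨j, hj, m, hm, rfl⟩ h1
      exact h j hj ⟨m, hm, h1⟩
    · rintro h j hj ⟨m, hm, h1⟩
      exact h _ ⟨j, hj, m, hm, rfl⟩ h1
  have h5 : ∀ m : ℕ, ((m : ℂ) * 5) ^ 2 ≠ 1 := fun m h => by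
    have : (m * 5) ^ 2 = 1 := by exact_mod_cast h
    have h1 : m * 5 = 1 := by nlinarith
    omega
  refine ⟨F, ?_, fun p hp hpF => ?_⟩
  · obtain ⟨p, hp, h1, h2, h0⟩ := hpt
    refine ⟨p, hp, (hF p).2 fun x hx => ?_⟩
    simp only [pullExpSqs, Multiset.mem_sum, Multiset.mem_map, Multiset.mem_filter] at hx
    obtain ⟨j, -, m, ⟨hm, hmk⟩, rfl⟩ := hx
    fin_cases j
    · by_cases hk : k = 0
      · change ((m : ℂ) * expDiff p (σ 0)) ^ 2 ≠ 1
        rw [h0 hk]; exact h5 m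
      · intro h3
        change ((m : ℂ) * expDiff p (σ 0)) ^ 2 = 1 at h3
        have h4 := hW p hp hk
        have he : expDiff p (σ 0) ^ 2 ≠ 0 := fun he => by
          rw [mul_pow, he, mul_zero] at h4; exact zero_ne_one h4
        rw [← h4, mul_pow, mul_pow] at h3
        have h6 := mul_right_cancel₀ he h3
        have h7 : m ^ 2 = k ^ 2 := by exact_mod_cast h6
        exact hmk ⟨rfl, Nat.pow_left_injective two_ne_zero h7⟩
    · change ((m : ℂ) * expDiff p (σ 1)) ^ 2 ≠ 1
      rw [h1]; exact h5 m
    · change ((m : ℂ) * expDiff p (σ 2)) ^ 2 ≠ 1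
      rw [h2]; exact h5 m
  · obtain ⟨h, hpb, hexp⟩ := hA.exists_pullsBackTo hφ (hW p hp)
    exact ⟨h, h.hasFourSingularities_of_sq_ne_one (hexp ▸ (hF p).1 hpF), hpb⟩

end

/-- The quadratic transformations exist for all hypergeometric equations, with a non-degenerate
result for generic parameters. -/
theorem quadratic_transformations {φ : RatFunc ℂ} {σ : Equiv.Perm (Fin 3)}
    (hφ : HasPattern φ σ quadraticPattern) :
    (∀ p, ∃ h : HeunParams, PullsBackTo p φ h ∧ EqUpToSign h.expDiffs
      (quadraticDiffs (expDiff p (σ 0)) (expDiff p (σ 1)) (expDiff p (σ 2)))) ∧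
    GenericOn Set.univ fun p => ∃ h : HeunParams, h.HasFourSingularities ∧ PullsBackTo p φ h := by
  refine ⟨fun p => ?_, ?_⟩
  · obtain ⟨h, hpb, hexp⟩ := admissible_quadraticPattern.exists_pullsBackTo hφ (p := p) (by simp)
    refine ⟨h, hpb, eqUpToSign_iff.2 ?_⟩
    rw [hexp]
    exact quadratic_diffs fun i => expDiff p (σ i)
  · refine admissible_quadraticPattern.genericOn hφ (by simp) ?_
    obtain ⟨p, hp⟩ := exists_expDiff_eq fun _ => 5
    exact ⟨p, trivial, by simp [hp]⟩

theorem sq_of_mem_fixedExpDiff {k : ℕ} (hk : k ≠ 0) {j : Fin 3} {s : ℤˣ} {p : Fin 3 → ℂ}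
    (hp : p ∈ fixedExpDiff j ((s : ℤ) / (k : ℂ))) : (k * expDiff p j) ^ 2 = 1 := by
  have hk' : (k : ℂ) ≠ 0 := Nat.cast_ne_zero.2 hk
  have hp' : expDiff p j = (s : ℤ) / (k : ℂ) := hp
  rw [hp', mul_div_cancel₀ _ hk']
  rcases Int.units_eq_one_or s with rfl | rfl <;> simp

/-- The coverings of the table transform the hypergeometric equations of the respective planes to
Heun equations. -/
theorem table_transformations {r : TableRow} (hr : r ∈ table) {φ : RatFunc ℂ}
    {σ : Equiv.Perm (Fin 3)} (hφ : HasPattern φ σ r.pattern) (s : ℤˣ) :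
    (∀ p ∈ fixedExpDiff (σ 0) ((s : ℤ) / (r.k : ℂ)), ∃ h : HeunParams, PullsBackTo p φ h ∧
      EqUpToSign h.expDiffs (r.heunDiffs (expDiff p (σ 1)) (expDiff p (σ 2)))) ∧
    GenericOn (fixedExpDiff (σ 0) ((s : ℤ) / (r.k : ℂ))) fun p =>
      ∃ h : HeunParams, h.HasFourSingularities ∧ PullsBackTo p φ h := by
  have hA := admissible_of_mem_table hr
  have hk0 : r.k ≠ 0 := by
    simp only [table, List.mem_cons, List.not_mem_nil, or_false] at hr
    rcases hr with rfl | rfl | rfl | rfl | rfl | rfl | rfl <;> simp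
  refine ⟨fun p hp => ?_, hA.genericOn hφ (fun p hp _ => sq_of_mem_fixedExpDiff hk0 hp) ?_⟩
  · have hp' := sq_of_mem_fixedExpDiff hk0 hp
    obtain ⟨h, hpb, hexp⟩ := hA.exists_pullsBackTo hφ fun _ => hp'
    refine ⟨h, hpb, eqUpToSign_iff.2 ?_⟩
    rw [hexp]
    exact table_diffs hr (fun i => expDiff p (σ i)) hp'
  · obtain ⟨p, hp⟩ := exists_expDiff_eq fun i => if i = σ 0 then (s : ℤ) / (r.k : ℂ) else 5
    exact ⟨p, by simp [fixedExpDiff, hp], by simp [hp], by simp [hp], fun h => absurd h hk0⟩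

/-! ### Branching patterns and fractional-linear transformations -/

section

variable {φ M : RatFunc ℂ} {z : OnePoint ℂ}

theorem fiberPartition_comp_right (hφ : Nonconst φ) (hM : IsMoebius M) (z : OnePoint ℂ) :
    fiberPartition (ratComp φ M) z = fiberPartition φ z := by
  rw [fiberPartition_eq_map_ramIdx (hφ.comp hM.nonconst), fiberPartition_eq_map_ramIdx hφ]
  have h : fib φ z = (fib (ratComp φ M) z).map ⟨img M, hM.bijective.1⟩ := by
    ext s
    obtain ⟨x, rfl⟩ := hM.bijective.2 s
    rw [mem_fib hφ, ← img_comp hφ hM.nonconst, ← mem_fib (hφ.comp hM.nonconst)]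
    exact (Finset.mem_map' ⟨img M, hM.bijective.1⟩).symm
  rw [h, Finset.map_val, Multiset.map_map]
  exact Multiset.map_congr rfl fun s _ => hM.ramIdx_comp_right hφ s

theorem fiberPartition_comp_left (hφ : Nonconst φ) (hM : IsMoebius M) (z : OnePoint ℂ) :
    fiberPartition (ratComp M φ) (img M z) = fiberPartition φ z := by
  rw [fiberPartition_eq_map_ramIdx (hM.nonconst.comp hφ), fiberPartition_eq_map_ramIdx hφ]
  have h : fib (ratComp M φ) (img M z) = fib φ z := by
    ext s
    rw [mem_fib hφ, mem_fib (hM.nonconst.comp hφ), img_comp hM.nonconst hφ,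
      hM.bijective.1.eq_iff]
  rw [h]
  exact Multiset.map_congr rfl fun s _ => hM.ramIdx_comp_left hφ s

theorem exists_of_mem_fiberPartition (hφ : Nonconst φ) {m : ℕ} (hm : m ∈ fiberPartition φ z) :
    ∃ s, img φ s = z ∧ ramIdx φ s = m := by
  rw [fiberPartition_eq_map_ramIdx hφ, Multiset.mem_map] at hm
  obtain ⟨s, hs, rfl⟩ := hm
  exact ⟨s, (mem_fib hφ).1 hs, rfl⟩

theorem exists_pair_of_fiberPartition (hφ : Nonconst φ) {m : ℕ}
    (hm : fiberPartition φ z = {m, m}) :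
    ∃ s t, s ≠ t ∧ img φ s = z ∧ img φ t = z ∧ ramIdx φ s = m ∧ ramIdx φ t = m := by
  classical
  have h2 : (fib φ z).card = 2 := by rw [← card_fiberPartition, hm]; rfl
  obtain ⟨s, t, hst, h⟩ := Finset.card_eq_two.1 h2
  have key : ∀ x ∈ fib φ z, img φ x = z ∧ ramIdx φ x = m := fun x hx => by
    refine ⟨(mem_fib hφ).1 hx, ?_⟩
    have : ramIdx φ x ∈ fiberPartition φ z := by
      rw [fiberPartition_eq_map_ramIdx hφ]; exact Multiset.mem_map_of_mem _ hx
    rw [hm] at this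
    simpa using this
  have hs := key s (by simp [h])
  have ht := key t (by simp [h])
  exact ⟨s, t, hst, hs.1, ht.1, hs.2, ht.2⟩

/-- The branching data of a fibre are complete when they exhaust the degree. -/
theorem fiberPartition_eq_of_list (hφ : Nonconst φ) (L : List (OnePoint ℂ × ℕ))
    (hL : (L.map Prod.fst).Nodup) (hm : ∀ x ∈ L, 0 < x.2 ∧ x.2 ≤ fiberMult φ z x.1)
    (hs : (L.map Prod.snd).sum = ratDegree φ) : fiberPartition φ z = ↑(L.map Prod.snd) := by
  classical
  have hsub : (L.map Prod.fst).toFinset ⊆ fib φ z := by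
    intro s hs
    rw [List.mem_toFinset, List.mem_map] at hs
    obtain ⟨x, hx, rfl⟩ := hs
    rw [mem_fib hφ, ← fiberMult_pos_iff hφ]
    exact (hm x hx).1.trans_le (hm x hx).2
  have hsum : ∑ s ∈ fib φ z, fiberMult φ z s = ratDegree φ := by
    rw [← sum_fib hφ z]
    exact Finset.sum_congr rfl fun s hs => fiberMult_of_img_eq ((mem_fib hφ).1 hs)
  have hsumL : ∑ s ∈ (L.map Prod.fst).toFinset, fiberMult φ z s =
      (L.map fun x => fiberMult φ z x.1).sum := by
    rw [List.sum_toFinset _ hL, List.map_map]; rfl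
  have hle : (L.map Prod.snd).sum ≤ (L.map fun x => fiberMult φ z x.1).sum :=
    List.sum_le_sum fun x hx => (hm x hx).2
  have hfib : (L.map Prod.fst).toFinset = fib φ z := by
    by_contra hne
    obtain ⟨s, hs1, hs2⟩ := Finset.exists_of_ssubset (hsub.ssubset_of_ne hne)
    have h1 := Finset.sum_lt_sum_of_subset (f := fiberMult φ z) hsub hs1 hs2
      ((fiberMult_pos_iff hφ).2 ((mem_fib hφ).1 hs1)) fun _ _ _ => Nat.zero_le _
    omega
  have heq : ∀ x ∈ L, fiberMult φ z x.1 = x.2 := by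
    by_contra! hne
    obtain ⟨x, hx, hne⟩ := hne
    have h1 : (L.map Prod.snd).sum < (L.map fun x => fiberMult φ z x.1).sum :=
      List.sum_lt_sum _ _ (fun x hx => (hm x hx).2) ⟨x, hx, (hm x hx).2.lt_of_ne hne.symm⟩
    rw [← hsumL, hfib] at h1
    omega
  rw [fiberPartition_eq_map, ← hfib, List.toFinset_val, hL.dedup, Multiset.map_coe, List.map_map]
  congr 1
  exact List.map_congr_left heq

theorem exists_moebius_perm (σ : Equiv.Perm (Fin 3)) :
    ∃ μ, IsMoebius μ ∧ ∀ j, img μ (singPt j) = singPt (σ j) := by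
  have h : ∀ i j, i ≠ j → singPt (σ i) ≠ singPt (σ j) := fun i j hij h =>
    hij (σ.injective (singPt_injective h))
  obtain ⟨μ, hμ, h0, h1, h2⟩ := exists_moebius (h 0 1 (by decide)) (h 0 2 (by decide))
    (h 1 2 (by decide))
  refine ⟨μ, hμ, fun j => ?_⟩
  fin_cases j
  · exact h0
  · exact h1
  · exact h2

end

/-- `φ₀` is the covering with the branching pattern `A 0 = A 1 = A 2` above `0`, `1`, `∞`, up to
fractional-linear transformations. -/
structure IsNormalForm (φ₀ : RatFunc ℂ) (A : Fin 3 → Multiset ℕ) : Prop where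
  nonconst : Nonconst φ₀
  hasPattern : HasPattern φ₀ 1 A
  exists_eq : ∀ φ, Nonconst φ → HasPattern φ 1 A → ∃ M, IsMoebius M ∧ ratComp φ M = φ₀

section

variable {φ₀ φ M : RatFunc ℂ} {A : Fin 3 → Multiset ℕ}

theorem IsNormalForm.nonconst_of_hasPattern (h : IsNormalForm φ₀ A) {σ : Equiv.Perm (Fin 3)}
    (hφ : HasPattern φ σ A) : Nonconst φ := by
  refine HeunPullback.nonconst_of_hasPattern hφ 0 ?_
  rw [← h.hasPattern, sum_fiberPartition h.nonconst]
  exact (nonconst_iff.1 h.nonconst).ne'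

theorem img_X (s : OnePoint ℂ) : img RatFunc.X s = s := by
  refine isMoebius_X.bijective.1 ?_
  rw [← img_comp nonconst_X nonconst_X, ratComp_X_left]

theorem HasPattern.comp_inverse {σ : Equiv.Perm (Fin 3)} {μ ν : RatFunc ℂ} (hφ : HasPattern φ σ A)
    (hn : Nonconst φ) (hμ : IsMoebius μ) (hμσ : ∀ j, img μ (singPt j) = singPt (σ j))
    (hν : IsMoebius ν) (hνμ : ratComp ν μ = RatFunc.X) : HasPattern (ratComp ν φ) 1 A := fun j => by
  have : img ν (singPt (σ j)) = singPt j := by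
    rw [← hμσ, ← img_comp hν.nonconst hμ.nonconst, hνμ, img_X]
  rw [← hφ j, Equiv.Perm.one_apply, ← this, fiberPartition_comp_left hn hν]

/-- Every covering with a permuted branching pattern is obtained from the normal form by
fractional-linear transformations on both sides. -/
theorem IsNormalForm.exists_eq_comp (h : IsNormalForm φ₀ A) {σ : Equiv.Perm (Fin 3)}
    {μ : RatFunc ℂ} (hμ : IsMoebius μ) (hμσ : ∀ j, img μ (singPt j) = singPt (σ j))
    (hφ : HasPattern φ σ A) :
    ∃ N, IsMoebius N ∧ φ = ratComp μ (ratComp φ₀ N) := by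
  have hn := h.nonconst_of_hasPattern hφ
  obtain ⟨ν, hν, hμν, hνμ⟩ := hμ.exists_inverse
  obtain ⟨M, hM, hM'⟩ := h.exists_eq _ (hν.nonconst.comp hn)
    (hφ.comp_inverse hn hμ hμσ hν hνμ)
  obtain ⟨N, hN, hMN, -⟩ := hM.exists_inverse
  refine ⟨N, hN, ?_⟩
  rw [← hM', ratComp_assoc _ hM.nonconst hN.nonconst, hMN, ratComp_X_right,
    ← ratComp_assoc _ hν.nonconst hn, hμν, ratComp_X_left]

theorem IsNormalForm.uniqueCovering (h : IsNormalForm φ₀ A) (σ : Equiv.Perm (Fin 3)) :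
    UniqueCovering σ A := by
  obtain ⟨μ, hμ, hμσ⟩ := exists_moebius_perm σ
  refine ⟨⟨ratComp μ φ₀, fun j => ?_⟩, fun φ ψ hφ hψ => ?_⟩
  · rw [← hμσ, fiberPartition_comp_left h.nonconst hμ]
    exact h.hasPattern j
  · obtain ⟨N, hN, rfl⟩ := h.exists_eq_comp hμ hμσ hφ
    obtain ⟨L, hL, rfl⟩ := h.exists_eq_comp hμ hμσ hψ
    obtain ⟨N', hN', hNN', -⟩ := hN.exists_inverse
    refine ⟨ratComp N' L, hN'.comp hL, ?_⟩
    rw [ratComp_assoc _ (h.nonconst.comp hN.nonconst) (hN'.comp hL).nonconst,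
      ratComp_assoc _ hN.nonconst (hN'.comp hL).nonconst,
      ← ratComp_assoc N hN'.nonconst hL.nonconst, hNN', ratComp_X_left]

end

/-! ### Coverings with given fibres -/

/-- The point `x.1` has multiplicity at least `x.2` as a zero of the polynomial `F`, considered as a
form of degree `d`. -/
def HasZero (d : ℕ) (F : ℂ[X]) (x : OnePoint ℂ × ℕ) : Prop :=
  x.1.elim (F.natDegree + x.2 ≤ d) fun a => (X - C a) ^ x.2 ∣ F

theorem hasZero_infty {d m : ℕ} {F : ℂ[X]} :
    HasZero d F (OnePoint.infty, m) ↔ F.natDegree + m ≤ d := Iff.rfl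

theorem hasZero_coe {d m : ℕ} {F : ℂ[X]} {a : ℂ} :
    HasZero d F ((a : OnePoint ℂ), m) ↔ (X - C a) ^ m ∣ F := Iff.rfl

theorem hasZero_coe_one {d : ℕ} {F : ℂ[X]} {a : ℂ} :
    HasZero d F ((a : OnePoint ℂ), 1) ↔ F.eval a = 0 := by
  rw [hasZero_coe, pow_one, dvd_iff_isRoot]; rfl

/-- The quotient of two polynomials as a rational function. -/
def quot (p q : ℂ[X]) : RatFunc ℂ := algebraMap ℂ[X] (RatFunc ℂ) p / algebraMap ℂ[X] (RatFunc ℂ) q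

section

variable {p q : ℂ[X]} {d : ℕ}

theorem ratDegree_quot (hpq : IsCoprime p q) (hq : q ≠ 0)
    (hd : max p.natDegree q.natDegree = d) : ratDegree (quot p q) = d :=
  (ratDegree_of_eq_div hpq hq rfl).trans hd

theorem nonconst_quot (hpq : IsCoprime p q) (hq : q ≠ 0) (hd : max p.natDegree q.natDegree = d)
    (h0 : 0 < d) : Nonconst (quot p q) := by
  rw [nonconst_iff, ratDegree_quot hpq hq hd]; exact h0

theorem fiberPartition_quot (hpq : IsCoprime p q) (hq : q ≠ 0)
    (hd : max p.natDegree q.natDegree = d) (h0 : 0 < d) {z : OnePoint ℂ} {F : ℂ[X]}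
    (hF : z.elim q (fun c => p - C c * q) = F) (L : List (OnePoint ℂ × ℕ))
    (hL : (L.map Prod.fst).Nodup) (hm : ∀ x ∈ L, 0 < x.2 ∧ HasZero d F x)
    (hs : (L.map Prod.snd).sum = d) : fiberPartition (quot p q) z = ↑(L.map Prod.snd) := by
  have hn := nonconst_quot hpq hq hd h0
  have hdeg : ratDegree (quot p q) = d := ratDegree_quot hpq hq hd
  obtain ⟨u, hu, h1, h2⟩ := exists_num_denom_eq hpq hq (rfl : quot p q = _)
  have hfib : fiberPoly (quot p q) z = C u * F := by
    rw [← hF]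
    induction z using OnePoint.rec with
    | infty => exact h2
    | coe c =>
      rw [fiberPoly_coe, h1, h2]
      change _ = C u * (p - C c * q)
      ring
  refine fiberPartition_eq_of_list hn L hL (fun x hx => ⟨(hm x hx).1, ?_⟩) (hs.trans hdeg.symm)
  obtain ⟨s, m⟩ := x
  have hx' := (hm _ hx).2
  induction s using OnePoint.rec with
  | infty =>
    rw [hasZero_infty] at hx'
    change m ≤ ratDegree _ - (fiberPoly _ z).natDegree
    rw [hfib, natDegree_C_mul hu, hdeg]
    omega
  | coe a =>
    change m ≤ (fiberPoly _ z).rootMultiplicity a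
    rw [le_rootMultiplicity_iff (fiberPoly_ne_zero hn z), hfib]
    exact (hasZero_coe.1 hx').mul_left _

theorem hasPattern_quot (hpq : IsCoprime p q) (hq : q ≠ 0)
    (hd : max p.natDegree q.natDegree = d) (h0 : 0 < d) {F : ℂ[X]} (hF : p - q = F)
    (L₀ L₁ L₂ : List (OnePoint ℂ × ℕ))
    (hL₀ : (L₀.map Prod.fst).Nodup) (hL₁ : (L₁.map Prod.fst).Nodup) (hL₂ : (L₂.map Prod.fst).Nodup)
    (hm₀ : ∀ x ∈ L₀, 0 < x.2 ∧ HasZero d p x) (hm₁ : ∀ x ∈ L₁, 0 < x.2 ∧ HasZero d F x)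
    (hm₂ : ∀ x ∈ L₂, 0 < x.2 ∧ HasZero d q x) (hs₀ : (L₀.map Prod.snd).sum = d)
    (hs₁ : (L₁.map Prod.snd).sum = d) (hs₂ : (L₂.map Prod.snd).sum = d) :
    HasPattern (quot p q) 1 ![↑(L₀.map Prod.snd), ↑(L₁.map Prod.snd), ↑(L₂.map Prod.snd)] := by
  intro j
  fin_cases j
  · refine fiberPartition_quot hpq hq hd h0 (z := ((0 : ℂ) : OnePoint ℂ)) ?_ L₀ hL₀ hm₀ hs₀
    change p - C 0 * q = p
    simp
  · refine fiberPartition_quot hpq hq hd h0 (z := ((1 : ℂ) : OnePoint ℂ)) ?_ L₁ hL₁ hm₁ hs₁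
    change p - C 1 * q = F
    rw [← hF]; simp
  · exact fiberPartition_quot hpq hq hd h0 (z := OnePoint.infty) rfl L₂ hL₂ hm₂ hs₂

end

theorem isCoprime_X_sub_C {p : ℂ[X]} {r : ℂ} (h : p.eval r ≠ 0) : IsCoprime p (X - C r) := by
  refine ((irreducible_X_sub_C r).coprime_iff_not_dvd.2 fun h1 => h ?_).symm
  exact dvd_iff_isRoot.1 h1

theorem exists_eq_mul_of_monic_dvd {p n : ℂ[X]} {e : ℕ} (hp : p.Monic) (h : p ∣ n)
    (hd : n.natDegree ≤ p.natDegree + e) : ∃ G, G.natDegree ≤ e ∧ n = p * G := by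
  obtain ⟨G, rfl⟩ := h
  refine ⟨G, ?_, rfl⟩
  by_cases hG : G = 0
  · simp [hG]
  · rw [hp.natDegree_mul' hG] at hd; omega

theorem exists_eq_mul_C_of_monic_dvd {p n : ℂ[X]} (hp : p.Monic) (h : p ∣ n)
    (hd : n.natDegree ≤ p.natDegree) : ∃ c, n = p * C c := by
  obtain ⟨G, hG, rfl⟩ := exists_eq_mul_of_monic_dvd (e := 0) hp h hd
  exact ⟨G.coeff 0, by rw [← eq_C_of_natDegree_le_zero hG]⟩

theorem sq_mul_sq_dvd {n : ℂ[X]} {a b : ℂ} (hab : a ≠ b) (ha : (X - C a) ^ 2 ∣ n)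
    (hb : (X - C b) ^ 2 ∣ n) : (X - C a) ^ 2 * (X - C b) ^ 2 ∣ n :=
  ((isCoprime_X_sub_C (by simpa [sub_eq_zero] using hab.symm)).pow).mul_dvd ha hb

theorem eval_derivative_of_sq_dvd {n : ℂ[X]} {a : ℂ} (h : (X - C a) ^ 2 ∣ n) :
    n.eval a = 0 ∧ (derivative n).eval a = 0 := by
  obtain ⟨G, rfl⟩ := h
  constructor <;> simp [derivative_mul, derivative_pow]

section

variable {φ : RatFunc ℂ}

theorem fiberPoly_singPt_zero (φ : RatFunc ℂ) : fiberPoly φ (singPt 0) = φ.num := by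
  change φ.num - C 0 * φ.denom = _
  simp

theorem fiberPoly_singPt_one (φ : RatFunc ℂ) : fiberPoly φ (singPt 1) = φ.num - φ.denom := by
  change φ.num - C 1 * φ.denom = _
  simp

theorem ne_of_img_ne {s t : OnePoint ℂ} {i j : Fin 3} (hs : img φ s = singPt i)
    (ht : img φ t = singPt j) (hij : i ≠ j) : s ≠ t := by
  rintro rfl
  exact hij (singPt_injective (hs.symm.trans ht))

/-- Three points can be moved to `0`, `1`, `∞`. -/
theorem exists_normalization (hφ : Nonconst φ) {s₀ s₁ s₂ : OnePoint ℂ} (h01 : s₀ ≠ s₁)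
    (h02 : s₀ ≠ s₂) (h12 : s₁ ≠ s₂) : ∃ M ψ, IsMoebius M ∧ ratComp φ M = ψ ∧ Nonconst ψ ∧
      ratDegree ψ = ratDegree φ ∧ (∀ z, fiberPartition ψ z = fiberPartition φ z) ∧
      (img ψ ((0 : ℂ) : OnePoint ℂ) = img φ s₀ ∧ ramIdx ψ ((0 : ℂ) : OnePoint ℂ) = ramIdx φ s₀) ∧
      (img ψ ((1 : ℂ) : OnePoint ℂ) = img φ s₁ ∧ ramIdx ψ ((1 : ℂ) : OnePoint ℂ) = ramIdx φ s₁) ∧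
      img ψ OnePoint.infty = img φ s₂ ∧ ramIdx ψ OnePoint.infty = ramIdx φ s₂ := by
  obtain ⟨M, hM, h0, h1, h2⟩ := exists_moebius h01 h02 h12
  have hn := hφ.comp hM.nonconst
  refine ⟨M, _, hM, rfl, hn, ?_, fiberPartition_comp_right hφ hM, ?_, ?_, ?_⟩
  · rw [ratDegree_comp hφ hM.nonconst, hM, mul_one]
  all_goals
    rw [img_comp hφ hM.nonconst, hM.ramIdx_comp_right hφ]
    simp only [h0, h1, h2, and_self]

end

/-! ### The normal forms of the coverings -/

/-- The function `x²`. -/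
theorem quadratic_hasPattern : HasPattern (quot (X ^ 2) 1) 1 quadraticPattern := by
  refine hasPattern_quot (d := 2) isCoprime_one_right one_ne_zero (by simp) two_pos
    (F := X ^ 2 - 1) rfl [(((0 : ℂ) : OnePoint ℂ), 2)]
    [(((1 : ℂ) : OnePoint ℂ), 1), (((-1 : ℂ) : OnePoint ℂ), 1)] [(OnePoint.infty, 2)]
    ?_ ?_ ?_ ?_ ?_ ?_ rfl rfl rfl
  · simp
  · simp; norm_num
  · simp
  · simp [hasZero_coe]
  · simp [hasZero_coe_one]
  · simp [hasZero_infty]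

/-- The polynomial `x² (3 - 2x)`; here `φ - 1 = -(x - 1)² (2x + 1)`. -/
theorem table_zero_hasPattern :
    HasPattern (quot (C (-2) * X ^ 3 + C 3 * X ^ 2) 1) 1 ![{2, 1}, {2, 1}, {3}] := by
  refine hasPattern_quot (d := 3) isCoprime_one_right one_ne_zero ?_ three_pos
    (F := (X - C 1) ^ 2 * (C (-2) * X - C 1)) ?_
    [(((0 : ℂ) : OnePoint ℂ), 2), (((3 / 2 : ℂ) : OnePoint ℂ), 1)]
    [(((1 : ℂ) : OnePoint ℂ), 2), (((-1 / 2 : ℂ) : OnePoint ℂ), 1)] [(OnePoint.infty, 3)]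
    ?_ ?_ ?_ ?_ ?_ ?_ rfl rfl rfl
  · have : (C (-2) * X ^ 3 + C 3 * X ^ 2 : ℂ[X]).natDegree = 3 := by compute_degree!
    rw [this]; simp
  · refine Polynomial.funext fun t => ?_
    simp; ring
  · simp; norm_num
  · simp; norm_num
  · simp
  · simp only [List.forall_mem_cons, hasZero_coe_one, two_pos, one_pos, true_and]
    exact ⟨hasZero_coe.2 ⟨C (-2) * X + C 3, by simp; ring⟩, by simp; norm_num, by simp⟩
  · simp only [List.forall_mem_cons, hasZero_coe_one, two_pos, one_pos, true_and]
    exact ⟨hasZero_coe.2 (Dvd.intro _ rfl), by simp; norm_num, by simp⟩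
  · simp [hasZero_infty]

/-- The polynomial `16 x² (x - 1)²`, which is the square of `4 x (x - 1)`. -/
theorem table_one_hasPattern :
    HasPattern (quot (X ^ 2 * (X - C 1) ^ 2 * C 16) 1) 1 ![{2, 2}, {2, 1, 1}, {4}] := by
  obtain ⟨s, hs⟩ : ∃ s : ℂ, s ^ 2 = 2 := IsAlgClosed.exists_pow_nat_eq _ two_pos
  have hs0 : s ≠ 0 := by rintro rfl; norm_num at hs
  refine hasPattern_quot (d := 4) isCoprime_one_right one_ne_zero ?_ four_pos
    (F := (X - C (1 / 2)) ^ 2 * (C 16 * X ^ 2 - C 16 * X - C 4)) ?_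
    [(((0 : ℂ) : OnePoint ℂ), 2), (((1 : ℂ) : OnePoint ℂ), 2)]
    [(((1 / 2 : ℂ) : OnePoint ℂ), 2), (((1 / 2 + s / 2 : ℂ) : OnePoint ℂ), 1),
      (((1 / 2 - s / 2 : ℂ) : OnePoint ℂ), 1)] [(OnePoint.infty, 4)]
    ?_ ?_ ?_ ?_ ?_ ?_ rfl rfl rfl
  · have : (X ^ 2 * (X - C 1) ^ 2 * C 16 : ℂ[X]).natDegree = 4 := by
      rw [natDegree_mul_C (by norm_num), natDegree_mul (by simp)
        (pow_ne_zero _ (X_sub_C_ne_zero _)),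
        natDegree_X_pow, natDegree_pow, natDegree_X_sub_C]
    rw [this]; simp
  · refine Polynomial.funext fun t => ?_
    simp; ring
  · simp
  · simp [hs0]
    exact ⟨fun h => hs0 (by linear_combination 2 * h), fun h => hs0 (by linear_combination h)⟩
  · simp
  · simp only [List.forall_mem_cons, hasZero_coe, two_pos, true_and]
    exact ⟨⟨(X - C 1) ^ 2 * C 16, by simp; ring⟩, ⟨X ^ 2 * C 16, by ring⟩, by simp⟩
  · simp only [List.forall_mem_cons, hasZero_coe_one, two_pos, one_pos, true_and]
    refine ⟨hasZero_coe.2 (Dvd.intro _ rfl), ?_, ?_, by simp⟩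
    · simp
      right
      linear_combination 4 * hs
    · simp
      right
      linear_combination 4 * hs
  · simp [hasZero_infty]

/-- The function `(x² - 6x - 3)² / (64 x)`; here `φ - 1 = (x - 1)³ (x - 9) / (64 x)`. -/
theorem table_two_hasPattern :
    HasPattern (quot ((X ^ 2 - C 6 * X - C 3) ^ 2 * C (1 / 64)) (X - C 0)) 1
      ![{2, 2}, {3, 1}, {3, 1}] := by
  obtain ⟨s, hs⟩ : ∃ s : ℂ, s ^ 2 = 3 := IsAlgClosed.exists_pow_nat_eq _ two_pos
  have hs0 : s ≠ 0 := by rintro rfl; norm_num at hs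
  refine hasPattern_quot (d := 4) (isCoprime_X_sub_C ?_) (X_sub_C_ne_zero _) ?_ four_pos
    (F := (X - C 1) ^ 3 * (C (1 / 64) * (X - C 9))) ?_
    [(((3 + 2 * s : ℂ) : OnePoint ℂ), 2), (((3 - 2 * s : ℂ) : OnePoint ℂ), 2)]
    [(((1 : ℂ) : OnePoint ℂ), 3), (((9 : ℂ) : OnePoint ℂ), 1)]
    [(OnePoint.infty, 3), (((0 : ℂ) : OnePoint ℂ), 1)]
    ?_ ?_ ?_ ?_ ?_ ?_ rfl rfl rfl
  · simp
  · have h2 : (X ^ 2 - C 6 * X - C 3 : ℂ[X]).natDegree = 2 := by compute_degree!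
    have : ((X ^ 2 - C 6 * X - C 3) ^ 2 * C (1 / 64) : ℂ[X]).natDegree = 4 := by
      rw [natDegree_mul_C (by norm_num), natDegree_pow, h2]
    rw [this, natDegree_X_sub_C]; rfl
  · refine Polynomial.funext fun t => ?_
    simp; ring
  · simp
    exact fun h => hs0 (by linear_combination h / 4)
  · simp
  · simp
  · have hd : ∀ r : ℂ, r ^ 2 - 6 * r - 3 = 0 →
        (X - C r) ^ 2 ∣ (X ^ 2 - C 6 * X - C 3 : ℂ[X]) ^ 2 * C (1 / 64) := fun r hr =>
      (pow_dvd_pow_of_dvd (dvd_iff_isRoot.2 (by simpa [IsRoot] using hr)) 2).mul_right _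
    simp only [List.forall_mem_cons, hasZero_coe, two_pos, true_and]
    exact ⟨hd _ (by linear_combination 4 * hs), hd _ (by linear_combination 4 * hs), by simp⟩
  · simp only [List.forall_mem_cons, hasZero_coe_one, three_pos, one_pos, true_and]
    exact ⟨hasZero_coe.2 (Dvd.intro _ rfl), by simp, by simp⟩
  · simp only [List.forall_mem_cons, hasZero_infty, hasZero_coe_one, three_pos, one_pos, true_and]
    simp

/-- The function `-4 x² / (x² - 1)²`; here `φ - 1 = -(x² + 1)² / (x² - 1)²`. -/
theorem table_four_hasPattern :
    HasPattern (quot (X ^ 2 * C (-4)) ((X - C 1) ^ 2 * (X - C (-1)) ^ 2)) 1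
      ![{2, 2}, {2, 2}, {2, 2}] := by
  have hdeg : ((X - C 1) ^ 2 * (X - C (-1)) ^ 2 : ℂ[X]).natDegree = 4 := by
    rw [natDegree_mul (pow_ne_zero _ (X_sub_C_ne_zero _)) (pow_ne_zero _ (X_sub_C_ne_zero _)),
      natDegree_pow, natDegree_pow, natDegree_X_sub_C, natDegree_X_sub_C]
  have hdeg' : (X ^ 2 * C (-4) : ℂ[X]).natDegree = 2 := by
    rw [natDegree_mul_C (by norm_num), natDegree_X_pow]
  refine hasPattern_quot (d := 4)
    ((isCoprime_X_sub_C (by simp)).pow_right.mul_right (isCoprime_X_sub_C (by simp)).pow_right)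
    (mul_ne_zero (pow_ne_zero _ (X_sub_C_ne_zero _)) (pow_ne_zero _ (X_sub_C_ne_zero _))) ?_
    four_pos (F := (X - C Complex.I) ^ 2 * (-(X - C (-Complex.I)) ^ 2)) ?_
    [(((0 : ℂ) : OnePoint ℂ), 2), (OnePoint.infty, 2)]
    [(((Complex.I : ℂ) : OnePoint ℂ), 2), (((-Complex.I : ℂ) : OnePoint ℂ), 2)]
    [(((1 : ℂ) : OnePoint ℂ), 2), (((-1 : ℂ) : OnePoint ℂ), 2)]
    ?_ ?_ ?_ ?_ ?_ ?_ rfl rfl rfl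
  · rw [hdeg, hdeg']; rfl
  · refine Polynomial.funext fun t => ?_
    have := Complex.I_sq
    simp
    linear_combination (-2 * t ^ 2 + Complex.I ^ 2 - 1) * this
  · simp
  · simp
    exact fun h => Complex.I_ne_zero (by linear_combination h / 2)
  · simp
    norm_num
  · simp only [List.forall_mem_cons, hasZero_coe, hasZero_infty, two_pos, true_and, hdeg']
    exact ⟨⟨C (-4), by simp⟩, le_rfl, by simp⟩
  · simp only [List.forall_mem_cons, hasZero_coe, two_pos, true_and]
    exact ⟨Dvd.intro _ rfl, ⟨-(X - C Complex.I) ^ 2, by ring⟩, by simp⟩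
  · simp only [List.forall_mem_cons, hasZero_coe, two_pos, true_and]
    exact ⟨Dvd.intro _ rfl, Dvd.intro_left _ rfl, by simp⟩

/-- The function `x³ / (3x - 2)`; here `φ - 1 = (x - 1)² (x + 2) / (3x - 2)`. -/
theorem table_five_hasPattern :
    HasPattern (quot (X ^ 3 * C (1 / 3)) (X - C (2 / 3))) 1 ![{3}, {2, 1}, {2, 1}] := by
  have hdeg : (X ^ 3 * C (1 / 3) : ℂ[X]).natDegree = 3 := by
    rw [natDegree_mul_C (by norm_num), natDegree_X_pow]
  refine hasPattern_quot (d := 3) (isCoprime_X_sub_C (by simp)) (X_sub_C_ne_zero _) ?_ three_pos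
    (F := (X - C 1) ^ 2 * (C (1 / 3) * (X + C 2))) ?_
    [(((0 : ℂ) : OnePoint ℂ), 3)]
    [(((1 : ℂ) : OnePoint ℂ), 2), (((-2 : ℂ) : OnePoint ℂ), 1)]
    [(OnePoint.infty, 2), (((2 / 3 : ℂ) : OnePoint ℂ), 1)]
    ?_ ?_ ?_ ?_ ?_ ?_ rfl rfl rfl
  · rw [hdeg, natDegree_X_sub_C]; rfl
  · refine Polynomial.funext fun t => ?_
    simp; ring
  · simp
  · simp; norm_num
  · simp
  · simp [hasZero_coe]
  · simp only [List.forall_mem_cons, hasZero_coe_one, two_pos, one_pos, true_and]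
    exact ⟨hasZero_coe.2 (Dvd.intro _ rfl), by simp, by simp⟩
  · simp only [List.forall_mem_cons, hasZero_infty, hasZero_coe_one, two_pos, one_pos, true_and]
    simp

/-- The function `x³`. -/
theorem table_six_hasPattern :
    HasPattern (quot (X ^ 3) 1) 1 ![{3}, {1, 1, 1}, {3}] := by
  obtain ⟨s, hs⟩ : ∃ s : ℂ, s ^ 2 = -3 := IsAlgClosed.exists_pow_nat_eq _ two_pos
  have hs0 : s ≠ 0 := by rintro rfl; norm_num at hs
  have h9 : s ^ 2 ≠ 9 := by rw [hs]; norm_num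
  have hs3 : s ≠ 3 := by rintro rfl; norm_num at h9
  have hs3' : s ≠ -3 := by rintro rfl; norm_num at h9
  refine hasPattern_quot (d := 3) isCoprime_one_right one_ne_zero (by simp) three_pos
    (F := X ^ 3 - 1) rfl [(((0 : ℂ) : OnePoint ℂ), 3)]
    [(((1 : ℂ) : OnePoint ℂ), 1), (((-1 / 2 + s / 2 : ℂ) : OnePoint ℂ), 1),
      (((-1 / 2 - s / 2 : ℂ) : OnePoint ℂ), 1)] [(OnePoint.infty, 3)]
    ?_ ?_ ?_ ?_ ?_ ?_ rfl rfl rfl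
  · simp
  · simp
    exact ⟨⟨fun h => hs3 (by linear_combination -2 * h),
        fun h => hs3' (by linear_combination 2 * h)⟩,
      fun h => hs0 (by linear_combination h)⟩
  · simp
  · simp [hasZero_coe]
  · simp only [List.forall_mem_cons, hasZero_coe_one, one_pos, true_and]
    refine ⟨by simp, ?_, ?_, by simp⟩
    · simp
      linear_combination (-3 / 8 + s / 8) * hs
    · simp
      linear_combination (-3 / 8 - s / 8) * hs
  · simp [hasZero_infty]

/-! ### Uniqueness of the coverings -/

section

variable {φ : RatFunc ℂ}

theorem eq_quot {p q : ℂ[X]} (hp : φ.num = p) (hq : φ.denom = q) : φ = quot p q := by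
  rw [quot, ← hp, ← hq, RatFunc.num_div_denom]

theorem dvd_num {c : ℂ} {m : ℕ} (h : img φ c = singPt 0) (hm : ramIdx φ c = m) :
    (X - C c) ^ m ∣ φ.num := by
  rw [← fiberPoly_singPt_zero]
  exact X_sub_C_pow_dvd_fiberPoly φ h hm.ge

theorem dvd_num_sub_denom {c : ℂ} {m : ℕ} (h : img φ c = singPt 1) (hm : ramIdx φ c = m) :
    (X - C c) ^ m ∣ φ.num - φ.denom := by
  rw [← fiberPoly_singPt_one]
  exact X_sub_C_pow_dvd_fiberPoly φ h hm.ge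

theorem dvd_denom {c : ℂ} {m : ℕ} (h : img φ c = singPt 2) (hm : ramIdx φ c = m) :
    (X - C c) ^ m ∣ φ.denom :=
  X_sub_C_pow_dvd_fiberPoly φ h hm.ge

theorem natDegree_num_le (φ : RatFunc ℂ) : φ.num.natDegree ≤ ratDegree φ := le_max_left _ _

theorem natDegree_num_sub_denom_le (φ : RatFunc ℂ) :
    (φ.num - φ.denom).natDegree ≤ ratDegree φ := by
  rw [← fiberPoly_singPt_one]
  exact natDegree_fiberPoly_le φ _

theorem eq_mul_C_of_sq_dvd {n : ℂ[X]} {a b : ℂ} (hab : a ≠ b) (ha : (X - C a) ^ 2 ∣ n)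
    (hb : (X - C b) ^ 2 ∣ n) (hn : n.natDegree ≤ 4) :
    ∃ c, n = (X - C a) ^ 2 * (X - C b) ^ 2 * C c := by
  have hm : ((X - C a) ^ 2 * (X - C b) ^ 2).Monic :=
    ((monic_X_sub_C a).pow 2).mul ((monic_X_sub_C b).pow 2)
  refine exists_eq_mul_C_of_monic_dvd hm (sq_mul_sq_dvd hab ha hb) ?_
  rwa [((monic_X_sub_C a).pow 2).natDegree_mul ((monic_X_sub_C b).pow 2), natDegree_pow,
    natDegree_pow, natDegree_X_sub_C, natDegree_X_sub_C]

theorem eval_derivative_of_cube_dvd {n : ℂ[X]} {a : ℂ} (h : (X - C a) ^ 3 ∣ n) :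
    n.eval a = 0 ∧ (derivative n).eval a = 0 ∧ (derivative (derivative n)).eval a = 0 := by
  obtain ⟨G, rfl⟩ := h
  refine ⟨?_, ?_, ?_⟩ <;> simp [derivative_mul, derivative_pow]

theorem exists_coe_of_img_ne {s : OnePoint ℂ} {z : OnePoint ℂ} (hi : img φ OnePoint.infty ≠ z)
    (hs : img φ s = z) : ∃ c : ℂ, (c : OnePoint ℂ) = s := by
  refine OnePoint.ne_infty_iff_exists.1 ?_
  rintro rfl
  exact hi hs

/-- Two points of branching index two in a fibre that does not contain `∞`. -/
theorem exists_finite_pair (hφ : Nonconst φ) {z : OnePoint ℂ} (hz : fiberPartition φ z = {2, 2})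
    (hi : img φ OnePoint.infty ≠ z) :
    ∃ a b : ℂ, a ≠ b ∧ img φ a = z ∧ img φ b = z ∧ ramIdx φ a = 2 ∧ ramIdx φ b = 2 := by
  obtain ⟨s, t, hst, hs, ht, rs, rt⟩ := exists_pair_of_fiberPartition hφ hz
  obtain ⟨a, rfl⟩ := exists_coe_of_img_ne hi hs
  obtain ⟨b, rfl⟩ := exists_coe_of_img_ne hi ht
  exact ⟨a, b, fun h => hst (h ▸ rfl), hs, ht, rs, rt⟩

theorem singPt_ne {i j : Fin 3} (h : i ≠ j) : singPt i ≠ singPt j := singPt_injective.ne h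

end

/-- The double zero is placed at `0`, the double pole at `∞`, and a point above `1` at `1`. -/
theorem quadratic_isNormalForm : IsNormalForm (quot (X ^ 2) 1) quadraticPattern := by
  refine ⟨nonconst_of_hasPattern quadratic_hasPattern 0 (by decide), quadratic_hasPattern,
    fun φ hφ hA => ?_⟩
  have hd : ratDegree φ = 2 := ratDegree_of_hasPattern hA 0 (by decide)
  have e0 : fiberPartition φ (singPt 0) = {2} := hA 0
  have e1 : fiberPartition φ (singPt 1) = {1, 1} := hA 1
  have e2 : fiberPartition φ (singPt 2) = {2} := hA 2
  obtain ⟨s₀, i₀, r₀⟩ := exists_of_mem_fiberPartition hφ (z := singPt 0) (m := 2) (by simp [e0])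
  obtain ⟨s₁, i₁, -⟩ := exists_of_mem_fiberPartition hφ (z := singPt 1) (m := 1) (by simp [e1])
  obtain ⟨s₂, i₂, r₂⟩ := exists_of_mem_fiberPartition hφ (z := singPt 2) (m := 2) (by simp [e2])
  obtain ⟨M, ψ, hM, hψ, hn, hdeg, -, ⟨j0, k0⟩, ⟨j1, -⟩, j2, k2⟩ := exists_normalization hφ
    (ne_of_img_ne i₀ i₁ (by decide)) (ne_of_img_ne i₀ i₂ (by decide))
    (ne_of_img_ne i₁ i₂ (by decide))
  rw [i₀] at j0
  rw [i₁] at j1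
  rw [i₂] at j2
  refine ⟨M, hM, hψ.trans ?_⟩
  have hden : ψ.denom = 1 := denom_eq_one_of_infty j2 (by rw [k2, r₂, hdeg, hd])
  obtain ⟨c, hc⟩ := exists_eq_mul_C_of_monic_dvd ((monic_X_sub_C 0).pow 2)
    (dvd_num j0 (k0.trans r₀)) (by
      rw [natDegree_pow, natDegree_X_sub_C]; exact (natDegree_num_le ψ).trans (hdeg.trans hd).le)
  have h1 := num_eval_eq hn j1
  rw [hc, hden] at h1
  simp only [eval_mul, eval_pow, eval_sub, eval_X, eval_C, eval_one] at h1
  refine eq_quot ?_ hden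
  have : c = 1 := by linear_combination h1
  rw [hc, this]; simp

/-- The double zero is placed at `0`, the double point above `1` at `1`, and the triple pole at `∞`;
the conditions at `1` determine the remaining linear factor of the polynomial. -/
theorem table_zero_isNormalForm :
    IsNormalForm (quot (C (-2) * X ^ 3 + C 3 * X ^ 2) 1) ![{2, 1}, {2, 1}, {3}] := by
  refine ⟨nonconst_of_hasPattern table_zero_hasPattern 0 (by decide), table_zero_hasPattern,
    fun φ hφ hA => ?_⟩
  have hd : ratDegree φ = 3 := ratDegree_of_hasPattern hA 0 (by decide)
  have e0 : fiberPartition φ (singPt 0) = {2, 1} := hA 0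
  have e1 : fiberPartition φ (singPt 1) = {2, 1} := hA 1
  have e2 : fiberPartition φ (singPt 2) = {3} := hA 2
  obtain ⟨s₀, i₀, r₀⟩ := exists_of_mem_fiberPartition hφ (z := singPt 0) (m := 2) (by simp [e0])
  obtain ⟨s₁, i₁, r₁⟩ := exists_of_mem_fiberPartition hφ (z := singPt 1) (m := 2) (by simp [e1])
  obtain ⟨s₂, i₂, r₂⟩ := exists_of_mem_fiberPartition hφ (z := singPt 2) (m := 3) (by simp [e2])
  obtain ⟨M, ψ, hM, hψ, hn, hdeg, -, ⟨j0, k0⟩, ⟨j1, k1⟩, j2, k2⟩ := exists_normalization hφ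
    (ne_of_img_ne i₀ i₁ (by decide)) (ne_of_img_ne i₀ i₂ (by decide))
    (ne_of_img_ne i₁ i₂ (by decide))
  rw [i₀] at j0
  rw [i₁] at j1
  rw [i₂] at j2
  refine ⟨M, hM, hψ.trans ?_⟩
  have hden : ψ.denom = 1 := denom_eq_one_of_infty j2 (by rw [k2, r₂, hdeg, hd])
  obtain ⟨G, hG, hnum⟩ := exists_eq_mul_of_monic_dvd (e := 1) ((monic_X_sub_C 0).pow 2)
    (dvd_num j0 (k0.trans r₀)) (by
      rw [natDegree_pow, natDegree_X_sub_C]; exact (natDegree_num_le ψ).trans (hdeg.trans hd).le)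
  obtain ⟨h1, h2⟩ := eval_derivative_of_sq_dvd (dvd_num_sub_denom j1 (k1.trans r₁))
  rw [eq_X_add_C_of_natDegree_le_one hG] at hnum
  generalize G.coeff 1 = a at hnum
  generalize G.coeff 0 = b at hnum
  rw [hden, hnum] at h1 h2
  simp [derivative_mul, derivative_pow] at h1 h2
  refine eq_quot ?_ hden
  have ha : a = -2 := by linear_combination h2 - 2 * h1
  have hb : b = 3 := by linear_combination 3 * h1 - h2
  rw [hnum, ha, hb, C_0]
  ring

/-- The double zeros are placed at `0` and `1`, and the pole at `∞`; the double point above `1` then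
determines the leading coefficient. -/
theorem table_one_isNormalForm :
    IsNormalForm (quot (X ^ 2 * (X - C 1) ^ 2 * C 16) 1) ![{2, 2}, {2, 1, 1}, {4}] := by
  refine ⟨nonconst_of_hasPattern table_one_hasPattern 0 (by decide), table_one_hasPattern,
    fun φ hφ hA => ?_⟩
  have hd : ratDegree φ = 4 := ratDegree_of_hasPattern hA 0 (by decide)
  have e0 : fiberPartition φ (singPt 0) = {2, 2} := hA 0
  have e1 : fiberPartition φ (singPt 1) = {2, 1, 1} := hA 1
  have e2 : fiberPartition φ (singPt 2) = {4} := hA 2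
  obtain ⟨s₀, s₁, h01, i₀, i₁, r₀, r₁⟩ := exists_pair_of_fiberPartition hφ e0
  obtain ⟨s₂, i₂, r₂⟩ := exists_of_mem_fiberPartition hφ (z := singPt 2) (m := 4) (by simp [e2])
  obtain ⟨M, ψ, hM, hψ, hn, hdeg, hpart, ⟨j0, k0⟩, ⟨j1, k1⟩, j2, k2⟩ := exists_normalization hφ
    h01 (ne_of_img_ne i₀ i₂ (by decide)) (ne_of_img_ne i₁ i₂ (by decide))
  rw [i₀] at j0
  rw [i₁] at j1
  rw [i₂] at j2
  refine ⟨M, hM, hψ.trans ?_⟩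
  have hden : ψ.denom = 1 := denom_eq_one_of_infty j2 (by rw [k2, r₂, hdeg, hd])
  obtain ⟨c, hc⟩ := eq_mul_C_of_sq_dvd zero_ne_one (dvd_num j0 (k0.trans r₀))
    (dvd_num j1 (k1.trans r₁)) ((natDegree_num_le ψ).trans (hdeg.trans hd).le)
  obtain ⟨s, i, r⟩ := exists_of_mem_fiberPartition hn (z := singPt 1) (m := 2)
    (by simp [hpart, e1])
  obtain ⟨x, rfl⟩ := exists_coe_of_img_ne (by rw [j2]; exact singPt_ne (by decide)) i
  obtain ⟨h1, h2⟩ := eval_derivative_of_sq_dvd (dvd_num_sub_denom i r)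
  rw [hden, hc] at h1 h2
  simp [derivative_mul, derivative_pow] at h1 h2
  -- The double point above `1` lies symmetric to the double points above `0`.
  have hne : c * (x * (x - 1)) ≠ 0 := by
    intro h0
    have : (1 : ℂ) = 0 := by linear_combination (x * (x - 1)) * h0 - h1
    exact one_ne_zero this
  have hx : x = 1 / 2 := by
    have h2' := h2.resolve_right (by rintro rfl; simp at hne)
    have : 2 * (c * (x * (x - 1))) * (2 * x - 1) = 0 := by linear_combination c * h2'
    rcases mul_eq_zero.1 this with h0 | h0
    · exact absurd (by linear_combination h0 / 2) hne
    · linear_combination h0 / 2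
  have hc16 : c = 16 := by
    rw [hx] at h1
    linear_combination 16 * h1
  refine eq_quot ?_ hden
  rw [hc, hc16, C_0, sub_zero]

/-- The coverings with a triple pole at `∞` and a simple pole at `0`, and with two double zeros. -/
theorem num_denom_of_poles {ψ : RatFunc ℂ} (hn : Nonconst ψ) (hd : ratDegree ψ = 4)
    (hi : img ψ OnePoint.infty = singPt 2) (ri : ramIdx ψ OnePoint.infty = 3)
    (h0 : img ψ ((0 : ℂ) : OnePoint ℂ) = singPt 2) (r0 : ramIdx ψ ((0 : ℂ) : OnePoint ℂ) = 1)
    (hz : fiberPartition ψ (singPt 0) = {2, 2}) :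
    ψ.denom = X - C 0 ∧ ∃ a b c : ℂ, ψ.num = (X - C a) ^ 2 * (X - C b) ^ 2 * C c := by
  refine ⟨?_, ?_⟩
  · have h1 := natDegree_fiberPoly_add hi
    rw [ri, hd] at h1
    have h2 : ψ.denom.natDegree = 1 := by
      change ψ.denom.natDegree + 3 = 4 at h1; omega
    have h3 := dvd_denom h0 r0
    rw [pow_one] at h3
    exact eq_of_monic_of_dvd_of_natDegree_le (monic_X_sub_C 0) ψ.monic_denom h3
      (by rw [h2, natDegree_X_sub_C])
  · obtain ⟨a, b, hab, ha, hb, ra, rb⟩ := exists_finite_pair hn hz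
      (by rw [hi]; exact singPt_ne (by decide))
    obtain ⟨c, hc⟩ := eq_mul_C_of_sq_dvd hab (dvd_num ha ra) (dvd_num hb rb)
      ((natDegree_num_le ψ).trans hd.le)
    exact ⟨a, b, c, hc⟩

/-- The simple pole is placed at `0`, the triple pole at `∞`, and the triple point above `1` at `1`.
-/
theorem table_two_isNormalForm :
    IsNormalForm (quot ((X ^ 2 - C 6 * X - C 3) ^ 2 * C (1 / 64)) (X - C 0))
      ![{2, 2}, {3, 1}, {3, 1}] := by
  refine ⟨nonconst_of_hasPattern table_two_hasPattern 0 (by decide), table_two_hasPattern,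
    fun φ hφ hA => ?_⟩
  have hd : ratDegree φ = 4 := ratDegree_of_hasPattern hA 0 (by decide)
  have e0 : fiberPartition φ (singPt 0) = {2, 2} := hA 0
  have e1 : fiberPartition φ (singPt 1) = {3, 1} := hA 1
  have e2 : fiberPartition φ (singPt 2) = {3, 1} := hA 2
  obtain ⟨s₀, i₀, r₀⟩ := exists_of_mem_fiberPartition hφ (z := singPt 2) (m := 1) (by simp [e2])
  obtain ⟨s₁, i₁, r₁⟩ := exists_of_mem_fiberPartition hφ (z := singPt 1) (m := 3) (by simp [e1])
  obtain ⟨s₂, i₂, r₂⟩ := exists_of_mem_fiberPartition hφ (z := singPt 2) (m := 3) (by simp [e2])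
  obtain ⟨M, ψ, hM, hψ, hn, hdeg, hpart, ⟨j0, k0⟩, ⟨j1, k1⟩, j2, k2⟩ := exists_normalization hφ
    (ne_of_img_ne i₀ i₁ (by decide)) (by rintro rfl; omega)
    (ne_of_img_ne i₁ i₂ (by decide))
  rw [i₀] at j0
  rw [i₁] at j1
  rw [i₂] at j2
  refine ⟨M, hM, hψ.trans ?_⟩
  obtain ⟨hden, a, b, c, hc⟩ := num_denom_of_poles hn (hdeg.trans hd) j2 (k2.trans r₂) j0
    (k0.trans r₀) ((hpart _).trans e0)
  have h3 := dvd_num_sub_denom j1 (k1.trans r₁)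
  obtain ⟨h1, h2, h3⟩ := eval_derivative_of_cube_dvd h3
  rw [hden, hc] at h1 h2 h3
  simp [derivative_mul, derivative_pow] at h1 h2 h3
  -- The value and the derivative at `1` of the quadratic polynomial with the roots `a`, `b`.
  obtain ⟨g, hg⟩ : ∃ g, g = (1 - a) * (1 - b) := ⟨_, rfl⟩
  obtain ⟨g', hg'⟩ : ∃ g', g' = 2 - a - b := ⟨_, rfl⟩
  have q1 : c * g ^ 2 = 1 := by rw [hg]; linear_combination h1
  have q2 : 2 * c * g * g' = 1 := by rw [hg, hg']; linear_combination h2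
  have c0 : c ≠ 0 := by rintro rfl; simp at q1
  have q3 : g' ^ 2 + 2 * g = 0 := by
    rw [hg, hg']
    linear_combination h3.resolve_right c0 / 2
  have g0 : g ≠ 0 := by rintro rfl; simp at q1
  have hgg : g = 2 * g' := by
    refine mul_left_cancel₀ (mul_ne_zero c0 g0) ?_
    linear_combination q1 - q2
  have hg4 : g' = -4 := by
    have hg0 : g' ≠ 0 := by rintro rfl; exact g0 (by rw [hgg, mul_zero])
    refine mul_left_cancel₀ hg0 ?_
    linear_combination q3 - 2 * hgg
  have hab : a + b = 6 := by linear_combination hg' - hg4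
  have hab' : a * b = -3 := by linear_combination hgg - hg + 2 * hg4 + hab
  have hc64 : c = 1 / 64 := by
    rw [hgg, hg4] at q1; linear_combination q1 / 64
  refine eq_quot ?_ hden
  rw [hc, hc64, ← mul_pow]
  congr 2
  refine Polynomial.funext fun t => ?_
  simp
  linear_combination -t * hab + hab'

/-- There is no covering with the branching pattern `2+2 = 2+2 = 3+1`: it would give polynomials
`g`, `h` of degree two for which `g² - h²` has degree one. -/
theorem not_hasPattern_table_three {φ : RatFunc ℂ} :
    ¬ HasPattern φ 1 ![{2, 2}, {2, 2}, {3, 1}] := by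
  intro hA
  have hφ : Nonconst φ := nonconst_of_hasPattern hA 0 (by decide)
  have hd : ratDegree φ = 4 := ratDegree_of_hasPattern hA 0 (by decide)
  have e0 : fiberPartition φ (singPt 0) = {2, 2} := hA 0
  have e1 : fiberPartition φ (singPt 1) = {2, 2} := hA 1
  have e2 : fiberPartition φ (singPt 2) = {3, 1} := hA 2
  obtain ⟨s₀, i₀, r₀⟩ := exists_of_mem_fiberPartition hφ (z := singPt 2) (m := 1) (by simp [e2])
  obtain ⟨s₁, i₁, -⟩ := exists_of_mem_fiberPartition hφ (z := singPt 1) (m := 2) (by simp [e1])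
  obtain ⟨s₂, i₂, r₂⟩ := exists_of_mem_fiberPartition hφ (z := singPt 2) (m := 3) (by simp [e2])
  obtain ⟨M, ψ, hM, hψ, hn, hdeg, hpart, ⟨j0, k0⟩, -, j2, k2⟩ := exists_normalization hφ
    (ne_of_img_ne i₀ i₁ (by decide)) (by rintro rfl; omega)
    (ne_of_img_ne i₁ i₂ (by decide))
  rw [i₀] at j0
  rw [i₂] at j2
  obtain ⟨hden, a, b, c, hc⟩ := num_denom_of_poles hn (hdeg.trans hd) j2 (k2.trans r₂) j0
    (k0.trans r₀) ((hpart _).trans e0)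
  obtain ⟨a', b', hab, ha, hb, ra, rb⟩ := exists_finite_pair hn ((hpart _).trans e1)
    (by rw [j2]; exact singPt_ne (by decide))
  obtain ⟨c', hc'⟩ := eq_mul_C_of_sq_dvd hab (dvd_num_sub_denom ha ra) (dvd_num_sub_denom hb rb)
    ((natDegree_num_sub_denom_le ψ).trans (hdeg.trans hd).le)
  rw [hc, hden] at hc'
  have ev : ∀ t, c * (t ^ 2 - (a + b) * t + a * b) ^ 2 - t =
      c' * (t ^ 2 - (a' + b') * t + a' * b') ^ 2 := fun t => by
    have := congrArg (eval t) hc'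
    simp at this
    linear_combination this
  generalize a + b = u at ev
  generalize a * b = v at ev
  generalize a' + b' = u' at ev
  generalize a' * b' = v' at ev
  -- Differences of the values at `0`, `±1`, `±2` are the differences of the coefficients.
  have f0 := ev 0
  have f1 := ev 1
  have f2 := ev 2
  have f3 := ev (-1)
  have f4 := ev (-2)
  have hcc : c' = c := by linear_combination -(f2 - 4 * f1 + 6 * f0 - 4 * f3 + f4) / 24
  subst hcc
  have q1 : c' * (u' * v' - u * v) = 1 / 2 := by
    linear_combination (8 * (f1 - f3) - (f2 - f4)) / 24
  have c0 : c' ≠ 0 := by rintro rfl; norm_num at q1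
  have hu : u' = u := by
    refine mul_left_cancel₀ c0 ?_
    linear_combination (f2 - 2 * f1 + 2 * f3 - f4) / 24
  subst hu
  have hv : v' = v := by
    refine mul_left_cancel₀ c0 ?_
    linear_combination -(-f2 + 16 * f1 - 30 * f0 + 16 * f3 - f4) / 48
  rw [hv, sub_self, mul_zero] at q1
  norm_num at q1

/-- The double zeros are placed at `0` and `∞`, and one of the double poles at `1`. Then `φ - 1` is
minus the quotient of the squares of two monic quadratic polynomials, and a comparison of the
coefficients determines both. -/
theorem table_four_isNormalForm :
    IsNormalForm (quot (X ^ 2 * C (-4)) ((X - C 1) ^ 2 * (X - C (-1)) ^ 2))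
      ![{2, 2}, {2, 2}, {2, 2}] := by
  refine ⟨nonconst_of_hasPattern table_four_hasPattern 0 (by decide), table_four_hasPattern,
    fun φ hφ hA => ?_⟩
  have hd : ratDegree φ = 4 := ratDegree_of_hasPattern hA 0 (by decide)
  have e0 : fiberPartition φ (singPt 0) = {2, 2} := hA 0
  have e1 : fiberPartition φ (singPt 1) = {2, 2} := hA 1
  have e2 : fiberPartition φ (singPt 2) = {2, 2} := hA 2
  obtain ⟨s₀, s₂, h02, i₀, i₂, r₀, r₂⟩ := exists_pair_of_fiberPartition hφ e0
  obtain ⟨s₁, i₁, -⟩ := exists_of_mem_fiberPartition hφ (z := singPt 2) (m := 2) (by simp [e2])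
  obtain ⟨M, ψ, hM, hψ, hn, hdeg, hpart, ⟨j0, k0⟩, ⟨j1, -⟩, j2, k2⟩ := exists_normalization hφ
    (ne_of_img_ne i₀ i₁ (by decide)) h02 (ne_of_img_ne i₁ i₂ (by decide))
  rw [i₀] at j0
  rw [i₁] at j1
  rw [i₂] at j2
  refine ⟨M, hM, hψ.trans ?_⟩
  obtain ⟨c, hc⟩ := exists_eq_mul_C_of_monic_dvd ((monic_X_sub_C 0).pow 2)
    (dvd_num j0 (k0.trans r₀)) (by
      have h1 := natDegree_fiberPoly_add j2
      rw [fiberPoly_singPt_zero, k2, r₂, hdeg, hd] at h1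
      rw [natDegree_pow, natDegree_X_sub_C]
      omega)
  obtain ⟨a, b, hab, ha, hb, ra, rb⟩ := exists_finite_pair hn ((hpart _).trans e2)
    (by rw [j2]; exact singPt_ne (by decide))
  have hden : ψ.denom = (X - C a) ^ 2 * (X - C b) ^ 2 := by
    refine eq_of_monic_of_dvd_of_natDegree_le
      (((monic_X_sub_C a).pow 2).mul ((monic_X_sub_C b).pow 2)) ψ.monic_denom
      (sq_mul_sq_dvd hab (dvd_denom ha ra) (dvd_denom hb rb)) ?_
    rw [((monic_X_sub_C a).pow 2).natDegree_mul ((monic_X_sub_C b).pow 2), natDegree_pow,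
      natDegree_pow, natDegree_X_sub_C, natDegree_X_sub_C]
    exact (le_max_right _ _).trans (hdeg.trans hd).le
  obtain ⟨a', b', hab', ha', hb', ra', rb'⟩ := exists_finite_pair hn ((hpart _).trans e1)
    (by rw [j2]; exact singPt_ne (by decide))
  obtain ⟨c', hc'⟩ := eq_mul_C_of_sq_dvd hab' (dvd_num_sub_denom ha' ra')
    (dvd_num_sub_denom hb' rb') ((natDegree_num_sub_denom_le ψ).trans (hdeg.trans hd).le)
  rw [hc, hden] at hc'
  have c0 : c ≠ 0 := by
    rintro rfl
    exact hn.num_ne_zero (by rw [hc, C_0, mul_zero])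
  have h1 : (1 - a) * (1 - b) = 0 := by
    have h3 : (fiberPoly ψ (singPt 2)).eval 1 = 0 := by
      have := X_sub_C_pow_dvd_fiberPoly ψ (m := 1) j1 (ramIdx_pos hn _)
      rw [pow_one] at this
      exact dvd_iff_isRoot.1 this
    change ψ.denom.eval 1 = 0 at h3
    rw [hden] at h3
    simp only [eval_mul, eval_pow, eval_sub, eval_X, eval_C, ← mul_pow] at h3
    exact pow_eq_zero_iff two_ne_zero |>.1 h3
  have ev : ∀ t, c * t ^ 2 - (t ^ 2 - (a + b) * t + a * b) ^ 2 =
      c' * (t ^ 2 - (a' + b') * t + a' * b') ^ 2 := fun t => by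
    have := congrArg (eval t) hc'
    simp at this
    linear_combination this
  obtain ⟨u, hu⟩ : ∃ u, u = a + b := ⟨_, rfl⟩
  obtain ⟨v, hv⟩ : ∃ v, v = a * b := ⟨_, rfl⟩
  rw [← hu, ← hv] at ev
  generalize a' + b' = u' at ev
  generalize a' * b' = v' at ev
  -- Differences of the values at `0`, `±1`, `±2` are the differences of the coefficients.
  have f0 := ev 0
  have f1 := ev 1
  have f2 := ev 2
  have f3 := ev (-1)
  have f4 := ev (-2)
  have hcc : c' = -1 := by linear_combination -(f2 - 4 * f1 + 6 * f0 - 4 * f3 + f4) / 24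
  subst hcc
  have huu : u' = u := by linear_combination -(f2 - 2 * f1 + 2 * f3 - f4) / 24
  subst huu
  have hvv : c = 2 * (v - v') := by
    linear_combination (-f2 + 16 * f1 - 30 * f0 + 16 * f3 - f4) / 24
  have hv0 : v - v' ≠ 0 := fun h => c0 (by rw [hvv, h, mul_zero])
  have hu0 : u' = 0 := by
    refine (mul_eq_zero.1 ?_).resolve_right hv0
    linear_combination (8 * (f1 - f3) - (f2 - f4)) / 24
  have hv1 : v = -1 := by linear_combination h1 + hv - hu + hu0
  have hv2 : v + v' = 0 := by
    refine (mul_eq_zero.1 ?_).resolve_left hv0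
    linear_combination -f0
  have hc4 : c = -4 := by linear_combination hvv - 2 * hv2 + 4 * hv1
  refine eq_quot ?_ ?_
  · rw [hc, hc4, C_0, sub_zero]
  · rw [hden, ← mul_pow, ← mul_pow]
    congr 1
    refine Polynomial.funext fun t => ?_
    simp
    linear_combination t * (hu - hu0) - hv + hv1

/-- The triple zero is placed at `0`, the double point above `1` at `1`, and the double pole at `∞`.
-/
theorem table_five_isNormalForm :
    IsNormalForm (quot (X ^ 3 * C (1 / 3)) (X - C (2 / 3))) ![{3}, {2, 1}, {2, 1}] := by
  refine ⟨nonconst_of_hasPattern table_five_hasPattern 0 (by decide), table_five_hasPattern,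
    fun φ hφ hA => ?_⟩
  have hd : ratDegree φ = 3 := ratDegree_of_hasPattern hA 0 (by decide)
  have e0 : fiberPartition φ (singPt 0) = {3} := hA 0
  have e1 : fiberPartition φ (singPt 1) = {2, 1} := hA 1
  have e2 : fiberPartition φ (singPt 2) = {2, 1} := hA 2
  obtain ⟨s₀, i₀, r₀⟩ := exists_of_mem_fiberPartition hφ (z := singPt 0) (m := 3) (by simp [e0])
  obtain ⟨s₁, i₁, r₁⟩ := exists_of_mem_fiberPartition hφ (z := singPt 1) (m := 2) (by simp [e1])
  obtain ⟨s₂, i₂, r₂⟩ := exists_of_mem_fiberPartition hφ (z := singPt 2) (m := 2) (by simp [e2])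
  obtain ⟨M, ψ, hM, hψ, hn, hdeg, -, ⟨j0, k0⟩, ⟨j1, k1⟩, j2, k2⟩ := exists_normalization hφ
    (ne_of_img_ne i₀ i₁ (by decide)) (ne_of_img_ne i₀ i₂ (by decide))
    (ne_of_img_ne i₁ i₂ (by decide))
  rw [i₀] at j0
  rw [i₁] at j1
  rw [i₂] at j2
  refine ⟨M, hM, hψ.trans ?_⟩
  obtain ⟨r, hden⟩ : ∃ r, ψ.denom = X + C r := by
    have h1 := natDegree_fiberPoly_add j2
    rw [k2, r₂, hdeg, hd] at h1
    exact ⟨_, ψ.monic_denom.eq_X_add_C (by change ψ.denom.natDegree + 2 = 3 at h1; omega)⟩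
  obtain ⟨c, hc⟩ := exists_eq_mul_C_of_monic_dvd ((monic_X_sub_C 0).pow 3)
    (dvd_num j0 (k0.trans r₀)) (by
      rw [natDegree_pow, natDegree_X_sub_C]; exact (natDegree_num_le ψ).trans (hdeg.trans hd).le)
  obtain ⟨h1, h2⟩ := eval_derivative_of_sq_dvd (dvd_num_sub_denom j1 (k1.trans r₁))
  rw [hden, hc] at h1 h2
  simp [derivative_mul, derivative_pow] at h1 h2
  have hc3 : c = 1 / 3 := by linear_combination h2 / 3
  have hr : r = -(2 / 3) := by linear_combination hc3 - h1
  refine eq_quot ?_ ?_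
  · rw [hc, hc3, C_0, sub_zero]
  · rw [hden, hr, C_neg, sub_eq_add_neg]

/-- The triple zero is placed at `0`, the triple pole at `∞`, and a point above `1` at `1`. -/
theorem table_six_isNormalForm : IsNormalForm (quot (X ^ 3) 1) ![{3}, {1, 1, 1}, {3}] := by
  refine ⟨nonconst_of_hasPattern table_six_hasPattern 0 (by decide), table_six_hasPattern,
    fun φ hφ hA => ?_⟩
  have hd : ratDegree φ = 3 := ratDegree_of_hasPattern hA 0 (by decide)
  have e0 : fiberPartition φ (singPt 0) = {3} := hA 0
  have e1 : fiberPartition φ (singPt 1) = {1, 1, 1} := hA 1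
  have e2 : fiberPartition φ (singPt 2) = {3} := hA 2
  obtain ⟨s₀, i₀, r₀⟩ := exists_of_mem_fiberPartition hφ (z := singPt 0) (m := 3) (by simp [e0])
  obtain ⟨s₁, i₁, -⟩ := exists_of_mem_fiberPartition hφ (z := singPt 1) (m := 1) (by simp [e1])
  obtain ⟨s₂, i₂, r₂⟩ := exists_of_mem_fiberPartition hφ (z := singPt 2) (m := 3) (by simp [e2])
  obtain ⟨M, ψ, hM, hψ, hn, hdeg, -, ⟨j0, k0⟩, ⟨j1, -⟩, j2, k2⟩ := exists_normalization hφ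
    (ne_of_img_ne i₀ i₁ (by decide)) (ne_of_img_ne i₀ i₂ (by decide))
    (ne_of_img_ne i₁ i₂ (by decide))
  rw [i₀] at j0
  rw [i₁] at j1
  rw [i₂] at j2
  refine ⟨M, hM, hψ.trans ?_⟩
  have hden : ψ.denom = 1 := denom_eq_one_of_infty j2 (by rw [k2, r₂, hdeg, hd])
  obtain ⟨c, hc⟩ := exists_eq_mul_C_of_monic_dvd ((monic_X_sub_C 0).pow 3)
    (dvd_num j0 (k0.trans r₀)) (by
      rw [natDegree_pow, natDegree_X_sub_C]; exact (natDegree_num_le ψ).trans (hdeg.trans hd).le)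
  have h1 := num_eval_eq hn j1
  rw [hc, hden] at h1
  simp only [eval_mul, eval_pow, eval_sub, eval_X, eval_C, eval_one] at h1
  refine eq_quot ?_ hden
  have : c = 1 := by linear_combination h1
  rw [hc, this]; simp

/-! ### Compositions -/

theorem nonconst_of_two_le {g : RatFunc ℂ} (h : ¬ ratDegree g ≤ 1) : Nonconst g :=
  nonconst_iff.2 (by omega)

theorem isIndecomposable_of_ratDegree_three {φ : RatFunc ℂ} (hφ : ratDegree φ = 3) :
    IsIndecomposable φ := by
  rintro g h rfl
  by_contra! hgh
  have hg := nonconst_of_two_le (not_le.2 hgh.1)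
  have hh := nonconst_of_two_le (not_le.2 hgh.2)
  rw [ratDegree_comp hg hh] at hφ
  nlinarith [hgh.1, hgh.2]

/-- A branching index three cannot be the product of branching indices of quadratic functions. -/
theorem isIndecomposable_of_ramIdx_three {φ : RatFunc ℂ} (hφ : ratDegree φ = 4) {s : OnePoint ℂ}
    (hs : ramIdx φ s = 3) : IsIndecomposable φ := by
  rintro g h rfl
  by_contra! hgh
  have hg := nonconst_of_two_le (not_le.2 hgh.1)
  have hh := nonconst_of_two_le (not_le.2 hgh.2)
  rw [ratDegree_comp hg hh] at hφ
  rw [ramIdx_comp hg hh] at hs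
  have h1 := ramIdx_le hh s
  have h2 := ramIdx_le hg (img h s)
  have h3 : ratDegree g = 2 := by nlinarith [hgh.1, hgh.2]
  have h4 : ratDegree h = 2 := by nlinarith [hgh.1, hgh.2]
  rw [h3] at h2
  rw [h4] at h1
  generalize ramIdx h s = a at *
  generalize ramIdx g (img h s) = b at *
  interval_cases a <;> interval_cases b <;> omega

theorem ratComp_X_sq {p q : ℂ[X]} (h : Nonconst (quot p q)) :
    ratComp (quot (X ^ 2) 1) (quot p q) = quot (p ^ 2) (q ^ 2) := by
  obtain ⟨T, hTX, hT⟩ := h.exists_hom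
  rw [hT]
  have : quot (X ^ 2) 1 = RatFunc.X ^ 2 := by simp [quot]
  rw [this, map_pow, hTX, quot, quot, div_pow, map_pow, map_pow]

theorem ratDegree_X_sq : ratDegree (quot (X ^ 2) 1) = 2 :=
  ratDegree_quot isCoprime_one_right one_ne_zero (by simp)

/-- A decomposition of the normal form through the squaring map gives decompositions of all
coverings with a permuted branching pattern. -/
theorem IsNormalForm.exists_decomposition {φ₀ φ h₀ : RatFunc ℂ} {A : Fin 3 → Multiset ℕ}
    (h : IsNormalForm φ₀ A) (h₀2 : ratDegree h₀ = 2) (hφ₀ : ratComp (quot (X ^ 2) 1) h₀ = φ₀)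
    {σ : Equiv.Perm (Fin 3)} (hφ : HasPattern φ σ A) :
    ∃ g f, ratDegree g = 2 ∧ ratDegree f = 2 ∧ φ = ratComp g f ∧
      ∀ j, fiberPartition g (singPt (σ j)) = quadraticPattern j := by
  obtain ⟨μ, hμ, hμσ⟩ := exists_moebius_perm σ
  obtain ⟨N, hN, rfl⟩ := h.exists_eq_comp hμ hμσ hφ
  have hq := quadratic_isNormalForm.nonconst
  have hn : Nonconst h₀ := nonconst_iff.2 (by omega)
  refine ⟨ratComp μ (quot (X ^ 2) 1), ratComp h₀ N, ?_, ?_, ?_, fun j => ?_⟩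
  · rw [ratDegree_comp hμ.nonconst hq, hμ, ratDegree_X_sq]
  · rw [ratDegree_comp hn hN.nonconst, hN, h₀2]
  · rw [← hφ₀, ratComp_assoc _ hn hN.nonconst, ratComp_assoc _ hq (hn.comp hN.nonconst)]
  · rw [← hμσ, fiberPartition_comp_left hq hμ]
    exact quadratic_hasPattern j

/-- Uniqueness and decompositions of the coverings of the table. Degree three is prime, a branching
index three obstructs a decomposition in degree four, and the remaining normal forms are squares. -/
theorem table_composition {r : TableRow} (hr : r ∈ table) (σ : Equiv.Perm (Fin 3)) :
    r.composition.Holds σ r.pattern := by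
  simp only [table, List.mem_cons, List.not_mem_nil, or_false] at hr
  rcases hr with rfl | rfl | rfl | rfl | rfl | rfl | rfl
  · exact ⟨table_zero_isNormalForm.uniqueCovering σ, fun φ hφ =>
      isIndecomposable_of_ratDegree_three (ratDegree_of_hasPattern hφ 0 (by decide))⟩
  · refine ⟨table_one_isNormalForm.uniqueCovering σ, fun φ hφ => ?_⟩
    have hd : (X * (X - C 1) * C 4 : ℂ[X]).natDegree = 2 := by
      rw [natDegree_mul_C (by norm_num), natDegree_mul X_ne_zero (X_sub_C_ne_zero _), natDegree_X,
        natDegree_X_sub_C]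
    have hd' : max (X * (X - C 1) * C 4 : ℂ[X]).natDegree (1 : ℂ[X]).natDegree = 2 := by
      rw [hd, natDegree_one]; rfl
    obtain ⟨g, f, hg, hf, h, -⟩ := table_one_isNormalForm.exists_decomposition
      (ratDegree_quot isCoprime_one_right one_ne_zero hd') (by
        rw [ratComp_X_sq (nonconst_quot isCoprime_one_right one_ne_zero hd' two_pos)]
        refine congrArg₂ quot ?_ ?_
        · rw [mul_pow, mul_pow, ← C_pow]; norm_num
        · rw [one_pow]) hφ
    exact ⟨g, f, hg, hf, h⟩
  · refine ⟨table_two_isNormalForm.uniqueCovering σ, fun φ hφ => ?_⟩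
    have hn := table_two_isNormalForm.nonconst_of_hasPattern hφ
    obtain ⟨s, -, hs⟩ := exists_of_mem_fiberPartition hn (z := singPt (σ 1)) (m := 3)
      (by rw [hφ 1]; simp)
    exact isIndecomposable_of_ramIdx_three (ratDegree_of_hasPattern hφ 0 (by decide)) hs
  · rintro ⟨φ, hφ⟩
    obtain ⟨μ, hμ, hμσ⟩ := exists_moebius_perm σ
    obtain ⟨ν, hν, -, hνμ⟩ := hμ.exists_inverse
    exact not_hasPattern_table_three (hφ.comp_inverse (nonconst_of_hasPattern hφ 0 (by decide)) hμ
      hμσ hν hνμ)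
  · refine ⟨table_four_isNormalForm.uniqueCovering σ, fun φ hφ i => ?_⟩
    have hd : max (X * C (2 * Complex.I) : ℂ[X]).natDegree
        ((X - C 1) * (X - C (-1)) : ℂ[X]).natDegree = 2 := by
      rw [natDegree_mul (X_sub_C_ne_zero _) (X_sub_C_ne_zero _), natDegree_X_sub_C,
        natDegree_X_sub_C, natDegree_mul_C (by simp), natDegree_X]
      rfl
    have hq : ((X - C 1) * (X - C (-1)) : ℂ[X]) ≠ 0 :=
      mul_ne_zero (X_sub_C_ne_zero _) (X_sub_C_ne_zero _)
    have hpq : IsCoprime (X * C (2 * Complex.I) : ℂ[X]) ((X - C 1) * (X - C (-1))) :=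
      (isCoprime_X_sub_C (by simp)).mul_right (isCoprime_X_sub_C (by simp))
    -- All three partitions agree, so that the fibres can be permuted.
    have hall : ∀ j, fiberPartition φ (singPt j) = {2, 2} := fun j => by
      have := hφ (σ.symm j)
      rw [Equiv.apply_symm_apply] at this
      rw [this]
      generalize σ.symm j = i
      fin_cases i <;> rfl
    have hτ : HasPattern φ (Equiv.swap 1 i) ![{2, 2}, {2, 2}, {2, 2}] := fun j => by
      rw [hall]; fin_cases j <;> rfl
    obtain ⟨g, f, hg, hf, h, hgj⟩ := table_four_isNormalForm.exists_decomposition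
      (ratDegree_quot hpq hq hd) (by
        rw [ratComp_X_sq (nonconst_quot hpq hq hd two_pos)]
        refine congrArg₂ quot ?_ ?_
        · rw [mul_pow, ← C_pow, mul_pow, Complex.I_sq]; norm_num
        · rw [mul_pow]) hτ
    refine ⟨g, f, hg, hf, h, ?_, fun j hj => ?_⟩
    · have := hgj 1
      rwa [Equiv.swap_apply_left] at this
    · have := hgj (Equiv.swap 1 i j)
      rw [Equiv.swap_apply_self] at this
      rw [this]
      have hne : Equiv.swap 1 i j ≠ 1 := fun h1 => hj (by
        rw [← Equiv.swap_apply_self 1 i j, h1, Equiv.swap_apply_left])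
      generalize Equiv.swap 1 i j = k at hne
      fin_cases k
      · rfl
      · exact absurd rfl hne
      · rfl
  · exact ⟨table_five_isNormalForm.uniqueCovering σ, fun φ hφ =>
      isIndecomposable_of_ratDegree_three (ratDegree_of_hasPattern hφ 0 (by decide))⟩
  · exact ⟨table_six_isNormalForm.uniqueCovering σ, fun φ hφ =>
      isIndecomposable_of_ratDegree_three (ratDegree_of_hasPattern hφ 0 (by decide))⟩

/-! ### Families with two or three parameters -/

section

variable {I : Ideal (MvPolynomial (Fin 3) ℂ)}

theorem mem_iff_eval [I.IsPrime] {f : MvPolynomial (Fin 3) ℂ} :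
    f ∈ I ↔ ∀ p ∈ MvPolynomial.zeroLocus ℂ I, MvPolynomial.eval p f = 0 := by
  conv_lhs => rw [← MvPolynomial.IsPrime.vanishingIdeal_zeroLocus (K := ℂ) I]
  simp only [MvPolynomial.mem_vanishingIdeal_iff, MvPolynomial.aeval_eq_eval]

/-- Finitely many polynomials that do not vanish identically on an irreducible variety have no zeros
at generic points. -/
theorem genericOn_of_finset [I.IsPrime] {ι : Type*} (S : Finset ι)
    (f : ι → MvPolynomial (Fin 3) ℂ) {A : (Fin 3 → ℂ) → Prop}
    (h : ∀ p ∈ MvPolynomial.zeroLocus ℂ I,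
      (∀ i ∈ S, MvPolynomial.eval p (f i) = 0 → f i ∈ I) → A p) :
    GenericOn (MvPolynomial.zeroLocus ℂ I) A := by
  classical
  refine ⟨∏ i ∈ S with f i ∉ I, f i, ?_, fun p hp hF => h p hp fun i hi h0 => ?_⟩
  · have hF : ∏ i ∈ S with f i ∉ I, f i ∉ I := by
      rw [Ideal.IsPrime.prod_mem_iff]
      rintro ⟨i, hi, h⟩
      exact (Finset.mem_filter.1 hi).2 h
    rw [mem_iff_eval] at hF
    push Not at hF
    exact hF
  · by_contra hi'
    rw [map_prod, Finset.prod_ne_zero_iff] at hF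
    exact hF i (Finset.mem_filter.2 ⟨hi, hi'⟩) h0

theorem ringKrullDim_mvPolynomial_three : ringKrullDim (MvPolynomial (Fin 3) ℂ) = 3 := by
  rw [MvPolynomial.ringKrullDim_of_isNoetherianRing, ringKrullDim_eq_zero_of_field]
  simp

theorem ringKrullDim_succ_le_of_lt {P Q : Ideal (MvPolynomial (Fin 3) ℂ)} [P.IsPrime] (h : P < Q) :
    ringKrullDim (MvPolynomial (Fin 3) ℂ ⧸ Q) + 1 ≤ ringKrullDim (MvPolynomial (Fin 3) ℂ ⧸ P) := by
  obtain ⟨f, hfQ, hfP⟩ := Set.exists_of_ssubset h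
  refine ringKrullDim_succ_le_of_surjective (Ideal.Quotient.factor h.le)
    (Ideal.Quotient.factor_surjective h.le) (r := Ideal.Quotient.mk P f) ?_ ?_
  · rw [mem_nonZeroDivisors_iff_ne_zero, Ne, Ideal.Quotient.eq_zero_iff_mem]
    exact hfP
  · rw [Ideal.Quotient.factor_mk, Ideal.Quotient.eq_zero_iff_mem]
    exact hfQ

theorem ringKrullDim_quotient_bot :
    ringKrullDim (MvPolynomial (Fin 3) ℂ ⧸ (⊥ : Ideal (MvPolynomial (Fin 3) ℂ))) = 3 := by
  rw [← ringKrullDim_mvPolynomial_three]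
  exact ringKrullDim_eq_of_ringEquiv (RingEquiv.quotientBot _)

theorem eq_bot_of_ringKrullDim (h : ringKrullDim (MvPolynomial (Fin 3) ℂ ⧸ I) = (3 : ℕ)) :
    I = ⊥ := by
  by_contra hI
  have := ringKrullDim_succ_le_of_lt (bot_lt_iff_ne_bot.2 hI)
  rw [h, ringKrullDim_quotient_bot] at this
  exact absurd this (by decide)

theorem irreducible_expDiffPoly_sub (j : Fin 3) (e : ℂ) :
    Irreducible (expDiffPoly j - MvPolynomial.C e) := by
  have hle : (expDiffPoly j - MvPolynomial.C e).totalDegree ≤ 1 := by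
    have hX : ∀ i : Fin 3, (MvPolynomial.X i : MvPolynomial (Fin 3) ℂ).totalDegree ≤ 1 := fun i =>
      (MvPolynomial.totalDegree_X i).le
    have hsub : ∀ {f g : MvPolynomial (Fin 3) ℂ}, f.totalDegree ≤ 1 → g.totalDegree ≤ 1 →
        (f - g).totalDegree ≤ 1 := fun hf hg =>
      (MvPolynomial.totalDegree_sub _ _).trans (max_le hf hg)
    refine hsub ?_ (by simp)
    fin_cases j
    · exact hsub (by simp) (hX 2)
    · exact hsub (hsub (hX 2) (hX 0)) (hX 1)
    · exact hsub (hX 0) (hX 1)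
  obtain ⟨p, hp⟩ := exists_expDiff_eq fun _ => e
  obtain ⟨p', hp'⟩ := exists_expDiff_eq fun _ => e + 1
  refine MvPolynomial.irreducible_of_totalDegree_eq_one (le_antisymm hle ?_) fun x hx => ?_
  · by_contra h0
    have h1 := MvPolynomial.totalDegree_eq_zero_iff_eq_C.1 (Nat.lt_one_iff.1 (not_le.1 h0))
    have h2 := congrArg (MvPolynomial.eval p) h1
    have h3 := congrArg (MvPolynomial.eval p') h1
    rw [MvPolynomial.eval_C] at h2 h3
    rw [← h2] at h3
    simp [hp, hp'] at h3
  · rw [isUnit_iff_ne_zero]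
    rintro rfl
    have h1 : expDiffPoly j - MvPolynomial.C e = 0 := by
      ext i
      simpa using hx i
    have h2 := congrArg (MvPolynomial.eval p') h1
    simp [hp'] at h2

/-- A surface on which an exponent difference is constant is a plane. -/
theorem zeroLocus_eq_fixedExpDiff [I.IsPrime]
    (h : ringKrullDim (MvPolynomial (Fin 3) ℂ ⧸ I) = (2 : ℕ)) {j : Fin 3} {e : ℂ}
    (hI : expDiffPoly j - MvPolynomial.C e ∈ I) :
    MvPolynomial.zeroLocus ℂ I = fixedExpDiff j e := by
  have hirr := irreducible_expDiffPoly_sub j e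
  have hprime : (Ideal.span {expDiffPoly j - MvPolynomial.C e}).IsPrime :=
    (Ideal.span_singleton_prime hirr.ne_zero).2 hirr.prime
  have heq : Ideal.span {expDiffPoly j - MvPolynomial.C e} = I := by
    by_contra hne
    have h1 := ringKrullDim_succ_le_of_lt
      (lt_of_le_of_ne ((Ideal.span_singleton_le_iff_mem _).2 hI) hne)
    have h2 := ringKrullDim_succ_le_of_lt (P := ⊥)
      (bot_lt_iff_ne_bot.2 (mt Ideal.span_singleton_eq_bot.1 hirr.ne_zero))
    rw [h] at h1
    rw [ringKrullDim_quotient_bot] at h2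
    have h3 := (add_le_add_left h1 1).trans h2
    exact absurd h3 (by decide)
  rw [← heq, MvPolynomial.zeroLocus_span]
  ext p
  simp [fixedExpDiff, sub_eq_zero, MvPolynomial.aeval_eq_eval]

/-- If `(m e)² - 1` vanishes on an irreducible variety, then so does one of its factors. -/
theorem exists_unit_of_sq_mem [I.IsPrime] {j : Fin 3} {m : ℕ} (hm : m ≠ 0)
    (hI : ((m : MvPolynomial (Fin 3) ℂ) * expDiffPoly j) ^ 2 - 1 ∈ I) :
    ∃ s : ℤˣ, expDiffPoly j - MvPolynomial.C ((s : ℤ) / (m : ℂ)) ∈ I := by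
  have hm' : (m : ℂ) ≠ 0 := Nat.cast_ne_zero.2 hm
  have key : ∀ s : ℤˣ, expDiffPoly j - MvPolynomial.C ((s : ℤ) / (m : ℂ)) =
      MvPolynomial.C (m : ℂ)⁻¹ * ((m : MvPolynomial (Fin 3) ℂ) * expDiffPoly j -
        ((s : ℤ) : MvPolynomial (Fin 3) ℂ)) := by
    intro s
    have h1 : (MvPolynomial.C (m : ℂ)⁻¹ : MvPolynomial (Fin 3) ℂ) * (m : MvPolynomial (Fin 3) ℂ) =
        1 := by
      rw [← map_natCast (MvPolynomial.C : ℂ →+* MvPolynomial (Fin 3) ℂ), ← map_mul,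
        inv_mul_cancel₀ hm', map_one]
    have h2 : (MvPolynomial.C ((s : ℤ) / (m : ℂ)) : MvPolynomial (Fin 3) ℂ) =
        MvPolynomial.C (m : ℂ)⁻¹ * ((s : ℤ) : MvPolynomial (Fin 3) ℂ) := by
      rw [div_eq_inv_mul, map_mul, map_intCast]
    rw [h2]
    linear_combination (-expDiffPoly j) * h1
  have hfac : ((m : MvPolynomial (Fin 3) ℂ) * expDiffPoly j - 1) *
      ((m : MvPolynomial (Fin 3) ℂ) * expDiffPoly j + 1) ∈ I := by
    convert hI using 1; ring
  rcases Ideal.IsPrime.mem_or_mem ‹_› hfac with h | h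
  · exact ⟨1, by rw [key]; exact I.mul_mem_left _ (by simpa using h)⟩
  · exact ⟨-1, by rw [key]; exact I.mul_mem_left _ (by simpa using h)⟩

end

/-- The polynomials whose vanishing is to be avoided: an exponent difference is `±1/m`, or two
exponent differences agree up to sign. -/
def avoidPoly (d : ℕ) : Fin 3 × Fin (d + 1) ⊕ Fin 3 × Fin 3 → MvPolynomial (Fin 3) ℂ :=
  Sum.elim (fun x => (((x.2 : ℕ) : MvPolynomial (Fin 3) ℂ) * expDiffPoly x.1) ^ 2 - 1)
    fun x => expDiffPoly x.1 ^ 2 - expDiffPoly x.2 ^ 2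

theorem eval_mul_expDiffPoly_sq_sub_one (p : Fin 3 → ℂ) (j : Fin 3) (m : ℕ) :
    MvPolynomial.eval p (((m : MvPolynomial (Fin 3) ℂ) * expDiffPoly j) ^ 2 - 1) =
      (m * expDiff p j) ^ 2 - 1 := by
  simp

section

variable {I : Ideal (MvPolynomial (Fin 3) ℂ)} {d : ℕ}

/-- If no exponent difference is `±1/m` identically on the family, then it is not so at generic
points. -/
theorem genericOn_controlled [I.IsPrime]
    (h : ∀ j (m : ℕ), m ≠ 0 → m ≤ d →
      ((m : MvPolynomial (Fin 3) ℂ) * expDiffPoly j) ^ 2 - 1 ∉ I) :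
    GenericOn (MvPolynomial.zeroLocus ℂ I) fun p => Controlled p d 0 0 := by
  refine genericOn_of_finset Finset.univ (avoidPoly d) fun p hp hS => ⟨by decide, by simp, ?_⟩
  intro j m hm hmd he
  refine absurd (hS (Sum.inl (j, ⟨m, by omega⟩)) (Finset.mem_univ _) ?_) (h j m (by omega) hmd)
  exact (eval_mul_expDiffPoly_sq_sub_one p j m).trans (sub_eq_zero.2 he)

/-- On the plane on which an exponent difference is `±1/k`, the other exponent differences are
generic. -/
theorem genericOn_controlled_plane [I.IsPrime] {j₀ : Fin 3} {k : ℕ} (hk : k ≠ 0) {s : ℤˣ}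
    (hI : MvPolynomial.zeroLocus ℂ I = fixedExpDiff j₀ ((s : ℤ) / (k : ℂ))) :
    GenericOn (MvPolynomial.zeroLocus ℂ I) fun p =>
      Controlled p d j₀ (if k = 1 then 0 else k) := by
  refine genericOn_of_finset Finset.univ (avoidPoly d) fun p hp hS => ?_
  have hp2 := sq_of_mem_fixedExpDiff hk (hI ▸ hp)
  refine ⟨by split_ifs with h <;> [decide; exact h], fun h => ?_, fun j m hm hmd he => ?_⟩
  · split_ifs at h ⊢ with h1
    · exact absurd rfl h
    · exact hp2
  · have hmem := hS (Sum.inl (j, ⟨m, by omega⟩)) (Finset.mem_univ _)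
      ((eval_mul_expDiffPoly_sq_sub_one p j m).trans (sub_eq_zero.2 he))
    have hj : j = j₀ := by
      by_contra hj
      obtain ⟨q, hq⟩ := exists_expDiff_eq fun i => if i = j₀ then (s : ℤ) / (k : ℂ) else 0
      have hqV : q ∈ MvPolynomial.zeroLocus ℂ I := by rw [hI]; simp [fixedExpDiff, hq]
      have h1 := mem_iff_eval.1 hmem q hqV
      have h2 := (eval_mul_expDiffPoly_sq_sub_one q j m).symm.trans h1
      simp [hq, hj] at h2
    subst hj
    have hmk : m = k := by
      have h0 : expDiff p j ^ 2 ≠ 0 := fun h0 => by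
        rw [mul_pow, h0, mul_zero] at hp2; exact zero_ne_one hp2
      have h1 : (m : ℂ) ^ 2 = (k : ℂ) ^ 2 := by
        refine mul_right_cancel₀ h0 ?_
        rw [← mul_pow, ← mul_pow, he, hp2]
      exact Nat.pow_left_injective two_ne_zero (by exact_mod_cast h1)
    subst hmk
    by_cases h1 : m = 1
    · refine Or.inr ⟨h1, fun i i' hii hi hi' hsq => ?_⟩
      have hmem := hS (Sum.inr (i, i')) (Finset.mem_univ _) (by
        simp [avoidPoly, hsq])
      obtain ⟨q, hq⟩ := exists_expDiff_eq fun l =>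
        if l = j then (s : ℤ) / (m : ℂ) else if l = i then 0 else 1
      have hqV : q ∈ MvPolynomial.zeroLocus ℂ I := by rw [hI]; simp [fixedExpDiff, hq]
      have h2 := mem_iff_eval.1 hmem q hqV
      simp [avoidPoly, hq, hi, hi', hii.symm] at h2
    · exact Or.inl ⟨rfl, by rw [if_neg h1]⟩

end

theorem GenericOn.mono {V : Set (Fin 3 → ℂ)} {A B : (Fin 3 → ℂ) → Prop} (h : GenericOn V A)
    (hAB : ∀ p, A p → B p) : GenericOn V B := by
  obtain ⟨F, h0, hF⟩ := h
  exact ⟨F, h0, fun p hp hpF => hAB p (hF p hp hpF)⟩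

/-- The classification for families with three parameters. -/
theorem three_parameters {V : Set (Fin 3 → ℂ)} (hV : IsParameterFamily 3 V) (d : ℕ) :
    GenericOn V fun p => ∀ (φ : RatFunc ℂ) (h : HeunParams), ratDegree φ = d →
      h.HasFourSingularities → PullsBackTo p φ h →
      ratDegree φ = 2 ∧ ∃ σ, HasPattern φ σ quadraticPattern ∧ EqUpToSign h.expDiffs
        (quadraticDiffs (expDiff p (σ 0)) (expDiff p (σ 1)) (expDiff p (σ 2))) := by
  obtain ⟨I, hI, hdim, rfl⟩ := hV
  obtain rfl := eq_bot_of_ringKrullDim hdim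
  refine (genericOn_controlled (d := d) fun j m hm _ h0 => ?_).mono fun p hp φ h hd hh hpb => ?_
  · obtain ⟨q, hq⟩ := exists_expDiff_eq 0
    have h1 := congrArg (MvPolynomial.eval q) (Ideal.mem_bot.1 h0)
    rw [eval_mul_expDiffPoly_sq_sub_one, hq] at h1
    simp at h1
  · subst hd
    exact (hp.classification hh hpb).resolve_right fun h => h.1 rfl

/-- The classification for families with two parameters. -/
theorem two_parameters {V : Set (Fin 3 → ℂ)} (hV : IsParameterFamily 2 V) (d : ℕ) :
    GenericOn V fun p => ∀ (φ : RatFunc ℂ) (h : HeunParams), ratDegree φ = d →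
      h.HasFourSingularities → PullsBackTo p φ h →
      (ratDegree φ = 2 ∧ ∃ σ, HasPattern φ σ quadraticPattern ∧ EqUpToSign h.expDiffs
        (quadraticDiffs (expDiff p (σ 0)) (expDiff p (σ 1)) (expDiff p (σ 2)))) ∨
      ∃ r ∈ table, ∃ (σ : Equiv.Perm (Fin 3)) (s : ℤˣ),
        V = fixedExpDiff (σ 0) ((s : ℤ) / (r.k : ℂ)) ∧
        ratDegree φ = r.deg ∧ HasPattern φ σ r.pattern ∧
        EqUpToSign h.expDiffs (r.heunDiffs (expDiff p (σ 1)) (expDiff p (σ 2))) := by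
  obtain ⟨I, hI, hdim, rfl⟩ := hV
  by_cases hex : ∃ j, ∃ m : ℕ, m ≠ 0 ∧ m ≤ d ∧
      ((m : MvPolynomial (Fin 3) ℂ) * expDiffPoly j) ^ 2 - 1 ∈ I
  · obtain ⟨j, m, hm, -, hmem⟩ := hex
    obtain ⟨s, hs⟩ := exists_unit_of_sq_mem hm hmem
    have hV := zeroLocus_eq_fixedExpDiff hdim hs
    refine (genericOn_controlled_plane (d := d) hm hV).mono fun p hp φ h hd hh hpb => ?_
    subst hd
    refine (hp.classification hh hpb).imp_right ?_
    rintro ⟨hk, r, hr, hrk, σ, rfl, hdeg, hpat, hexp⟩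
    refine ⟨r, hr, σ, s, ?_, hdeg, hpat, hexp⟩
    rw [hV, hrk]
    split_ifs at hk ⊢
    · exact absurd rfl hk
    · rfl
  · push Not at hex
    refine (genericOn_controlled hex).mono fun p hp φ h hd hh hpb => ?_
    subst hd
    exact Or.inl ((hp.classification hh hpb).resolve_right fun h => h.1 rfl)

end HeunPullback

end

open HeunPullback in
theorem mainTheorem1 :
    -- three free parameters: only the quadratic transformations
    (∀ V, IsParameterFamily 3 V → ∀ d : ℕ, GenericOn V fun p =>
      ∀ (φ : RatFunc ℂ) (h : HeunParams), ratDegree φ = d → h.HasFourSingularities →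
        PullsBackTo p φ h →
        ratDegree φ = 2 ∧ ∃ σ, HasPattern φ σ quadraticPattern ∧
          EqUpToSign h.expDiffs
            (quadraticDiffs (expDiff p (σ 0)) (expDiff p (σ 1)) (expDiff p (σ 2)))) ∧
    -- the quadratic transformations exist and transform all hypergeometric equations
    (∀ σ, UniqueCovering σ quadraticPattern ∧
      ∀ φ, HasPattern φ σ quadraticPattern →
        (∀ p, ∃ h : HeunParams, PullsBackTo p φ h ∧
          EqUpToSign h.expDiffs
            (quadraticDiffs (expDiff p (σ 0)) (expDiff p (σ 1)) (expDiff p (σ 2)))) ∧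
        GenericOn Set.univ fun p => ∃ h : HeunParams, h.HasFourSingularities ∧ PullsBackTo p φ h) ∧
    -- two free parameters: specialized quadratic transformations, and the rows of the table
    (∀ V, IsParameterFamily 2 V → ∀ d : ℕ, GenericOn V fun p =>
      ∀ (φ : RatFunc ℂ) (h : HeunParams), ratDegree φ = d → h.HasFourSingularities →
        PullsBackTo p φ h →
        (ratDegree φ = 2 ∧ ∃ σ, HasPattern φ σ quadraticPattern ∧
          EqUpToSign h.expDiffs
            (quadraticDiffs (expDiff p (σ 0)) (expDiff p (σ 1)) (expDiff p (σ 2)))) ∨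
        ∃ r ∈ table, ∃ (σ : Equiv.Perm (Fin 3)) (s : ℤˣ),
          V = fixedExpDiff (σ 0) ((s : ℤ) / (r.k : ℂ)) ∧
          ratDegree φ = r.deg ∧ HasPattern φ σ r.pattern ∧
          EqUpToSign h.expDiffs (r.heunDiffs (expDiff p (σ 1)) (expDiff p (σ 2)))) ∧
    -- the coverings in the table, and the transformations that they give
    (∀ r ∈ table, ∀ σ, r.composition.Holds σ r.pattern ∧
      ∀ φ, HasPattern φ σ r.pattern → ∀ s : ℤˣ,
        (∀ p ∈ fixedExpDiff (σ 0) ((s : ℤ) / (r.k : ℂ)), ∃ h : HeunParams, PullsBackTo p φ h ∧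
          EqUpToSign h.expDiffs (r.heunDiffs (expDiff p (σ 1)) (expDiff p (σ 2)))) ∧
        GenericOn (fixedExpDiff (σ 0) ((s : ℤ) / (r.k : ℂ))) fun p =>
          ∃ h : HeunParams, h.HasFourSingularities ∧ PullsBackTo p φ h) := by
  exact ⟨fun V hV d => three_parameters hV d,
    fun σ => ⟨quadratic_isNormalForm.uniqueCovering σ, fun φ hφ => quadratic_transformations hφ⟩,
    fun V hV d => two_parameters hV d,
    fun r hr σ => ⟨table_composition hr σ, fun φ hφ s => table_transformations hr hφ s⟩⟩
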